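/- **Setting.** Let $m\ge n\ge 1$, and let $A\in\mathbb{R}^{m\times n}$ have full column rank and no zero row; let $b\in\mathbb{R}^n$, $c\in\mathbb{R}^m$. For $x,s\in\mathbb{R}^m_{>0}$ and $\mu>0$ put $X=\mathrm{diag}(x)$, $S=\mathrm{diag}(s)$ (similarly for other vectors) and $w(x,s,\mu)_i=x_is_i/\mu$. For a matrix $M$ of full column rank let $\sigma(M)_i=(M(M^\top M)^{-1}M^\top)_{ii}$. Write $u\approx_\delta v$ for $e^{-\delta}v\le u\le e^{\delta}v$ (entrywise for vectors, in the Loewner order for symmetric matrices), and $\|v\|_M=\sqrt{v^\top Mv}$. Fix the parameters $$\alpha=\frac1{4\log(4m/n)},\quad \epsilon=\frac{\alpha^2}{240},\quad \lambda=\frac{36\log(400m/\epsilon^2)}{\epsilon},\quad \gamma=\frac{\epsilon}{100\lambda},\quad r=\frac{\epsilon\gamma}{\sqrt n}$$ and the weight function $\tau(x,s)=\sigma(X^{1/2-\alpha}S^{-1/2-\alpha}A)+\frac nm\mathbf 1$. Let $\phi(t)=e^{\lambda(t-1)}+e^{-\lambda(t-1)}$, $\Phi(v)=\sum_{i=1}^m\phi(v_i)$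 for $v\in\mathbb{R}^m$, and $\Phi(x,s,\mu)=\Phi\big(w(x,s,\mu)/\tau(x,s)\big)$ (entrywise quotient). For a positive vector $t$ let $\|v\|_{t+\infty}=\|v\|_\infty+\frac{10}{\alpha}\big(\sum_i t_iv_i^2\big)^{1/2}$, and let $h^{\flat(t)}$ be a maximizer of $\langle h,v\rangle$ over $\|v\|_{t+\infty}=1$. Call $(x,s,\mu)\in\mathbb{R}^m_{>0}\times\mathbb{R}^m_{>0}\times\mathbb{R}_{>0}$ *$\epsilon$-centered* if $0\le\epsilon<1/80$, $w(x,s,\mu)\approx_\epsilon\tau(x,s)$, $Ay+s=c$ for some $y\in\mathbb{R}^n$, and $\|A^\top x-b\|_{(A^\top XS^{-1}A)^{-1}}\le\epsilon\gamma\sqrt\mu$. **The LS short step** (with constant $C$), on input $x,s\in\mathbb{R}^m_{>0}$ and $\mu,\mu^{\rm new}>0$ such that $(x,s,\mu)$ is $\epsilon$-centered and $|\mu^{\rm new}-\mu|\le r\mu$: 1. Find any $\bar x\approx_\epsilon x$, $\bar s\approx_\epsilon s$, $\bar\tau\approx_\epsilon\tau(x,s)$, and $\bar v\in\mathbb{R}^m_{>0}$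 with $\|\bar v-w(x,s,\mu)/\tau(x,s)\|_\infty\le\gamma$. Let $g=-\gamma\,(\nabla\Phi(\bar v))^{\flat(\bar\tau)}$. 2. Let $\bar A=\bar X^{1/2}\bar S^{-1/2}A$ and $\bar W=\mathrm{diag}(w(\bar x,\bar s,\mu))$. Find any symmetric $\bar H\approx_\gamma\bar A^\top\bar A$. Let $\delta_p=\bar W^{-1/2}\bar A\bar H^{-1}\bar A^\top\bar W^{1/2}g$, $\delta_c=\mu^{-1/2}\bar W^{-1/2}\bar A\bar H^{-1}(A^\top x-b)$, $\delta_r=(1+2\alpha)\delta_p+\delta_c$. 3. Find any $q\in\mathbb{R}^m_{>0}$ with $q_i\ge\frac m{\sqrt n}\Big(\frac{(\delta_r)_i^2}{\|\delta_r\|_2^2}+\frac1m\Big)+C\,\sigma(\bar A)_i\log\big(\tfrac m{\epsilon r}\big)\gamma^{-2}$ (reading $0/0=0$ if $\delta_r=0$). Draw a random diagonal matrix $R\in\mathbb{R}^{m\times m}$ with independent diagonal entries: $R_{ii}=1/\min\{q_i,1\}$ with probability $\min\{q_i,1\}$ and $R_{ii}=0$ otherwise. 4. Output $x^{\rm new}=x+\bar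 X\big((1+2\alpha)g-R\delta_r\big)$ and $s^{\rm new}=s+(1-2\alpha)\bar S\delta_p$. **Lemma (LS Short Step).** There is an absolute constant $C_0>0$ such that for every $C\ge C_0$ and all $m,n,A,b,c$ as above, the LS short step is an $(\epsilon,r,\lambda,\gamma,\tau)$-short step procedure, however the quantities to be found in steps 1–3 are chosen. That is: $\epsilon\in(0,1/80)$, $r\in(0,1/2)$, $\gamma\in[0,1)$, $\tau(x,s)\in\mathbb{R}^m_{>0}$ for all $x,s\in\mathbb{R}^m_{>0}$, $$\lambda\ge\frac{12\log(16m/r)}{\epsilon},$$ and on every input as above the random output satisfies $x^{\rm new},s^{\rm new}\in\mathbb{R}^m_{>0}$ with probability $1$ and * $Ay^{\rm new}+s^{\rm new}=c$ for some $y^{\rm new}\in\mathbb{R}^n$, with probability $1$; * $\mathbb{E}\big[\Phi(x^{\rm new},s^{\rm new},\mu^{\rm new})\big]\le(1-\lambda r)\,\Phi(x,s,\mu)+\exp(\lambda\epsilon/6)$, where the expectation is finite; * $\mathbb{P}\Big[\|A^\top x^{\rm new}-b\|_{(A^\top X^{\rm new}(S^{\rm new})^{-1}A)^{-1}}\le\frac\epsilon2\gamma\sqrt{\mu^{\rm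 new}}\Big]\ge1-r$. -/

import Mathlib

open Matrix MeasureTheory

namespace LSIPM

noncomputable section

/-! ### Linear algebra notation -/

/-- A matrix is non-degenerate if its rows are all non-zero and it has full column rank. -/
def NonDegenerate {m n : ℕ} (A : Matrix (Fin m) (Fin n) ℝ) : Prop :=
  (∀ i, A i ≠ 0) ∧ A.rank = n

/-- Entrywise positive vectors. -/
def Pos {m : ℕ} (v : Fin m → ℝ) : Prop := ∀ i, 0 < v i

/-- `u ≈_δ v` for vectors: `exp (-δ) v ≤ u ≤ exp δ v` entrywise. -/
def ApproxVec {m : ℕ} (δ : ℝ) (u v : Fin m → ℝ) : Prop :=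
  ∀ i, Real.exp (-δ) * v i ≤ u i ∧ u i ≤ Real.exp δ * v i

/-- `M ≈_δ N` for symmetric matrices: `exp (-δ) N ≼ M ≼ exp δ N` in the Loewner order. -/
def ApproxMat {n : ℕ} (δ : ℝ) (M N : Matrix (Fin n) (Fin n) ℝ) : Prop :=
  (M - Real.exp (-δ) • N).PosSemidef ∧ (Real.exp δ • N - M).PosSemidef

/-- `‖v‖_M = √(vᵀ M v)`. -/
def matNorm {n : ℕ} (M : Matrix (Fin n) (Fin n) ℝ) (v : Fin n → ℝ) : ℝ :=
  √(v ⬝ᵥ (M *ᵥ v))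

/-- The leverage scores: the diagonal of the projection `M (Mᵀ M)⁻¹ Mᵀ`
(for `M` of full column rank). -/
def leverage {m n : ℕ} (M : Matrix (Fin m) (Fin n) ℝ) (i : Fin m) : ℝ :=
  (M * (Mᵀ * M)⁻¹ * Mᵀ) i i

/-! ### Centrality and short-step procedures for a general weight function `τ` -/

/-- `w(x, s, μ)_i = x_i s_i / μ`. -/
def wVec {m : ℕ} (x s : Fin m → ℝ) (μ : ℝ) (i : Fin m) : ℝ := x i * s i / μ

/-- The infeasibility `‖Aᵀ x - b‖` in the norm of `(Aᵀ X S⁻¹ A)⁻¹`. -/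
def infeasibility {m n : ℕ} (A : Matrix (Fin m) (Fin n) ℝ) (b : Fin n → ℝ)
    (x s : Fin m → ℝ) : ℝ :=
  matNorm (Aᵀ * diagonal (fun i => x i / s i) * A)⁻¹ (Aᵀ *ᵥ x - b)

/-- `(x, s, μ)` is `ε`-centered, with respect to `γ` and the weight function `τ`. -/
structure IsCentered {m n : ℕ} (A : Matrix (Fin m) (Fin n) ℝ) (b : Fin n → ℝ) (c : Fin m → ℝ)
    (ε γ : ℝ) (τ : (Fin m → ℝ) → (Fin m → ℝ) → Fin m → ℝ)
    (x s : Fin m → ℝ) (μ : ℝ) : Prop where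
  eps_nonneg : 0 ≤ ε
  eps_lt : ε < 1 / 80
  pos_x : Pos x
  pos_s : Pos s
  pos_mu : 0 < μ
  centrality : ApproxVec ε (wVec x s μ) (τ x s)
  dual_feasible : ∃ y : Fin n → ℝ, A *ᵥ y + s = c
  primal_feasible : infeasibility A b x s ≤ ε * γ * √μ

/-- `φ(t) = exp (lam (t - 1)) + exp (-lam (t - 1))`. -/
def phi (lam t : ℝ) : ℝ := Real.exp (lam * (t - 1)) + Real.exp (-lam * (t - 1))

/-- The centrality potential `Φ(x, s, μ) = ∑ i, φ (w_i / τ_i)`. -/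
def centralityPotential {m : ℕ} (lam : ℝ) (τ : (Fin m → ℝ) → (Fin m → ℝ) → Fin m → ℝ)
    (x s : Fin m → ℝ) (μ : ℝ) : ℝ :=
  ∑ i, phi lam (wVec x s μ i / τ x s i)

/-- A randomized procedure with input `(x, s, μ, μnew)`; its value is the law of the random
output `(xnew, snew)`. -/
abbrev RandomizedStep (m : ℕ) : Type :=
  (Fin m → ℝ) → (Fin m → ℝ) → ℝ → ℝ → Measure ((Fin m → ℝ) × (Fin m → ℝ))

/-- The guarantee that an `(ε, r, lam, γ, τ)`-short step procedure gives for the law `ν` of its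
output `p = (xnew, snew)` on the input `(x, s, μ, μnew)`. -/
structure ShortStepGuarantee {m n : ℕ} (A : Matrix (Fin m) (Fin n) ℝ) (b : Fin n → ℝ)
    (c : Fin m → ℝ) (ε r lam γ : ℝ) (τ : (Fin m → ℝ) → (Fin m → ℝ) → Fin m → ℝ)
    (x s : Fin m → ℝ) (μ μnew : ℝ) (ν : Measure ((Fin m → ℝ) × (Fin m → ℝ))) : Prop where
  isProbability : IsProbabilityMeasure ν
  positive : ∀ᵐ p ∂ν, Pos p.1 ∧ Pos p.2
  dual_feasible : ∀ᵐ p ∂ν, ∃ y : Fin n → ℝ, A *ᵥ y + p.2 = c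
  integrable : Integrable (fun p => centralityPotential lam τ p.1 p.2 μnew) ν
  potential : ∫ p, centralityPotential lam τ p.1 p.2 μnew ∂ν ≤
    (1 - lam * r) * centralityPotential lam τ x s μ + Real.exp (lam * ε / 6)
  primal_feasible :
    1 - r ≤ ν.real {p | infeasibility A b p.1 p.2 ≤ ε / 2 * γ * √μnew}

/-- `(ε, r, lam, γ, τ)`-short step procedures. -/
structure IsShortStepProcedure {m n : ℕ} (A : Matrix (Fin m) (Fin n) ℝ) (b : Fin n → ℝ)
    (c : Fin m → ℝ) (ε r lam γ : ℝ) (τ : (Fin m → ℝ) → (Fin m → ℝ) → Fin m → ℝ)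
    (step : RandomizedStep m) : Prop where
  eps_mem : ε ∈ Set.Ioo (0 : ℝ) (1 / 80)
  r_mem : r ∈ Set.Ioo (0 : ℝ) (1 / 2)
  lam_ge : 12 * Real.log (16 * m / r) / ε ≤ lam
  weight_pos : ∀ x s, Pos x → Pos s → Pos (τ x s)
  gamma_mem : γ ∈ Set.Ico (0 : ℝ) 1
  guarantee : ∀ (x s : Fin m → ℝ) (μ μnew : ℝ), 0 < μnew →
    IsCentered A b c ε γ τ x s μ → |μnew - μ| ≤ r * μ →
    ShortStepGuarantee A b c ε r lam γ τ x s μ μnew (step x s μ μnew)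

/-! ### Parameters and weight function of the Lee–Sidford short step -/

/-- `α = 1 / (4 log (4m/n))`. -/
def lsAlpha (m n : ℕ) : ℝ := 1 / (4 * Real.log (4 * m / n))

/-- `ε = α² / 240`. -/
def lsEps (m n : ℕ) : ℝ := lsAlpha m n ^ 2 / 240

/-- `lam = 36 ε⁻¹ log (400 m / ε²)`. -/
def lsLam (m n : ℕ) : ℝ := 36 * (lsEps m n)⁻¹ * Real.log (400 * m / lsEps m n ^ 2)

/-- `γ = ε / (100 lam)`. -/
def lsGamma (m n : ℕ) : ℝ := lsEps m n / (100 * lsLam m n)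

/-- `r = ε γ / √n`. -/
def lsR (m n : ℕ) : ℝ := lsEps m n * lsGamma m n / √n

/-- The Lee–Sidford weight function `τ(x, s) = σ(X^(1/2 - α) S^(-1/2 - α) A) + n/m`. -/
def lsWeight {m n : ℕ} (A : Matrix (Fin m) (Fin n) ℝ) (x s : Fin m → ℝ) (i : Fin m) : ℝ :=
  leverage (diagonal (fun j =>
    x j ^ (1 / 2 - lsAlpha m n) * s j ^ (-(1 / 2) - lsAlpha m n)) * A) i + n / m

/-- The mixed norm `‖v‖_{t+∞} = ‖v‖_∞ + (10/α) (∑ i, t_i v_i²)^(1/2)`, for a weight vector `t`.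
(The norm of `Fin m → ℝ` is the sup norm.) -/
def mixedNorm {m : ℕ} (α : ℝ) (t v : Fin m → ℝ) : ℝ :=
  ‖v‖ + 10 / α * √(∑ i, t i * v i ^ 2)

/-- `f` is a dual vector `h^{♭(t)}`: a maximizer of `⟨h, ·⟩` over `‖·‖_{t+∞} = 1`. -/
def IsDualVector {m : ℕ} (α : ℝ) (t h f : Fin m → ℝ) : Prop :=
  mixedNorm α t f = 1 ∧ ∀ v, mixedNorm α t v = 1 → h ⬝ᵥ v ≤ h ⬝ᵥ f

/-- The gradient of `v ↦ ∑ i, φ (v i)`. -/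
def potentialGrad {m : ℕ} (lam : ℝ) (v : Fin m → ℝ) (i : Fin m) : ℝ := deriv (phi lam) (v i)

/-! ### The short step -/

/-- The quantities that one run of the short step finds: approximations `xbar`, `sbar`, `taubar`
of `x`, `s`, `τ(x, s)`, an approximation `vbar` of `w / τ`, a dual vector `flat` of the
gradient at `vbar`, a spectral approximation `H` of `Abarᵀ Abar`, and the sampling weights `q`. -/
structure LSChoice (m n : ℕ) where
  xbar : Fin m → ℝ
  sbar : Fin m → ℝ
  taubar : Fin m → ℝ
  vbar : Fin m → ℝ
  flat : Fin m → ℝ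
  H : Matrix (Fin n) (Fin n) ℝ
  q : Fin m → ℝ

namespace LSChoice

variable {m n : ℕ} (ch : LSChoice m n) (A : Matrix (Fin m) (Fin n) ℝ) (b : Fin n → ℝ)
  (x s : Fin m → ℝ) (μ : ℝ)

/-- `g = -γ ∇Φ(vbar)^{♭(taubar)}`. -/
def g : Fin m → ℝ := -(lsGamma m n) • ch.flat

/-- `Abar = Xbar^(1/2) Sbar^(-1/2) A`. -/
def Abar : Matrix (Fin m) (Fin n) ℝ := diagonal (fun i => √(ch.xbar i) / √(ch.sbar i)) * A

/-- The diagonal of `Wbar^(1/2)`, where `wbar = w(xbar, sbar, μ)`. -/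
def sqrtWbar (i : Fin m) : ℝ := √(wVec ch.xbar ch.sbar μ i)

/-- `δ_p = Wbar^(-1/2) Abar H⁻¹ Abarᵀ Wbar^(1/2) g`. -/
def deltaP : Fin m → ℝ :=
  (diagonal (ch.sqrtWbar μ))⁻¹ *ᵥ (ch.Abar A *ᵥ (ch.H⁻¹ *ᵥ ((ch.Abar A)ᵀ *ᵥ
    (diagonal (ch.sqrtWbar μ) *ᵥ ch.g))))

/-- `δ_c = μ^(-1/2) Wbar^(-1/2) Abar H⁻¹ (Aᵀ x - b)`. -/
def deltaC : Fin m → ℝ :=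
  (√μ)⁻¹ • ((diagonal (ch.sqrtWbar μ))⁻¹ *ᵥ (ch.Abar A *ᵥ (ch.H⁻¹ *ᵥ (Aᵀ *ᵥ x - b))))

/-- `δ_r = (1 + 2α) δ_p + δ_c`. -/
def deltaR : Fin m → ℝ := (1 + 2 * lsAlpha m n) • ch.deltaP A μ + ch.deltaC A b x μ

/-- The output `(x + δ_x, s + δ_s)`, with `δ_x = Xbar ((1 + 2α) g - R δ_r)` and
`δ_s = (1 - 2α) Sbar δ_p`, when the sampled diagonal matrix is `diag R`. -/
def output (R : Fin m → ℝ) : (Fin m → ℝ) × (Fin m → ℝ) :=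
  (x + ch.xbar * ((1 + 2 * lsAlpha m n) • ch.g - R * ch.deltaR A b x μ),
    s + (1 - 2 * lsAlpha m n) • (ch.sbar * ch.deltaP A μ))

/-- The requirements on what the short step finds, with the constant `C` in the lower bound for
the sampling weights. -/
structure Admissible (C : ℝ) : Prop where
  xbar_approx : ApproxVec (lsEps m n) ch.xbar x
  sbar_approx : ApproxVec (lsEps m n) ch.sbar s
  taubar_approx : ApproxVec (lsEps m n) ch.taubar (lsWeight A x s)
  vbar_pos : Pos ch.vbar
  vbar_approx : ‖ch.vbar - fun i => wVec x s μ i / lsWeight A x s i‖ ≤ lsGamma m n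
  flat_dual : IsDualVector (lsAlpha m n) ch.taubar (potentialGrad (lsLam m n) ch.vbar) ch.flat
  H_approx : ApproxMat (lsGamma m n) ch.H ((ch.Abar A)ᵀ * ch.Abar A)
  q_pos : Pos ch.q
  q_ge : ∀ i, m / √n * (ch.deltaR A b x μ i ^ 2 / (∑ j, ch.deltaR A b x μ j ^ 2) + 1 / m)
    + C * leverage (ch.Abar A) i * Real.log (m / (lsEps m n * lsR m n)) / lsGamma m n ^ 2
    ≤ ch.q i

end LSChoice

/-- The law of one diagonal entry of the sampling matrix: with `p = min {q, 1}`, the value `p⁻¹`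
with probability `p`, and `0` otherwise. -/
def entryLaw (q : ℝ) : Measure ℝ :=
  ENNReal.ofReal (min q 1) • Measure.dirac (min q 1)⁻¹
    + ENNReal.ofReal (1 - min q 1) • Measure.dirac 0

/-- `ν` is the law of the output of a run of the Lee–Sidford short step on `(x, s, μ)`, for some
admissible outcome of the steps that find approximations; the diagonal entries of the sampling
matrix are drawn independently. -/
def IsLSShortStepLaw {m n : ℕ} (C : ℝ) (A : Matrix (Fin m) (Fin n) ℝ) (b : Fin n → ℝ)
    (x s : Fin m → ℝ) (μ : ℝ) (ν : Measure ((Fin m → ℝ) × (Fin m → ℝ))) : Prop :=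
  ∃ ch : LSChoice m n, ch.Admissible A b x s μ C ∧
    ν = (Measure.pi fun i => entryLaw (ch.q i)).map (ch.output A b x s μ)

/-- `step` implements the Lee–Sidford short step: on all inputs that satisfy its assumptions it
outputs the result of a run. -/
def ImplementsLSShortStep {m n : ℕ} (C : ℝ) (A : Matrix (Fin m) (Fin n) ℝ) (b : Fin n → ℝ)
    (c : Fin m → ℝ) (step : RandomizedStep m) : Prop :=
  ∀ (x s : Fin m → ℝ) (μ μnew : ℝ), 0 < μnew →
    IsCentered A b c (lsEps m n) (lsGamma m n) (lsWeight A) x s μ →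
    |μnew - μ| ≤ lsR m n * μ →
    IsLSShortStepLaw C A b x s μ (step x s μ μnew)

end

end LSIPM

open LSIPM

open LSIPM

namespace LSIPM

/-! ### Quadratic forms -/

section Forms

variable {m n : ℕ}

/-! Write one outcome of the step as x' = x(1+ξ), s' = s(1+ζ), μ' = μ(1+ρ), τ' = τ(1+θ). Then w/τ is
multiplied by (1+ξ)(1+ζ)/((1+ρ)(1+θ)). If P is the projection whose diagonal gives the leverage
scores in τ, then to first order θ = L((1-2α)ξ - (1+2α)ζ) with L = T⁻¹(Σ - P⁽²⁾). The second order
error is bounded by the positive operator B = T⁻¹(Σ + P⁽²⁾) applied to squares of the changes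
(`leverage_diagonal_expansion`, `ProjWeights.opB_sq_le`, `ratio_change_bounds`). L and B depend on
the input only, so they commute with the expectation over the sampling, which is a finite sum over
coin flips.

Drift. With u = g - 2δ_p, the reflection of g, the expected first order change of w/τ is g + (2α -
(1-4α²)L)u plus small terms from δ_c, ρ and the approximations. L is self-adjoint for the τ-inner
product with spectrum in [0,1], so the operator on u has τ-norm 1-2α-4α², and the reflection almost
preserves the norm. Part of the sup norm must be paid for by the Euclidean norm; the factor 10/α in
the mixed norm makes this cheap. Hence the drift differs from g by at most (1-α)γ in mixed norm
(`StepBounds.mixedNorm_main_le`, `StepBounds.mixedNorm_drift_le`). This uses that vectors in the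
range of W^(-1/2)Ā have sup norm bounded by their τ-norm, which is `LSInput.leverage_Abar_le`, the
place where α ~ 1/log(m/n) is needed.

Potential. The vector g is -γ times the maximizer dual to the gradient f, so pairing f with the
drift gives at most -αγF, where F is the dual norm of f. The second moments have mixed norm O(γ²)
(`StepBounds.mixedNorm_second_moment_le`): the sampling weights bound the variance of each
coordinate by δ_r² plus a constant of size 1/√n. As λγ = ε/100, these errors consume at most half of
the gain. Testing f against the all-ones vector, of mixed norm O(√n/α), bounds F below by Φ, and the
decrease by the factor 1-λr follows up to an additive 2m (`StepBounds.sum_cubeExp_phi_le`).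

Feasibility. The new primal residual is √μ((H - ĀᵀĀ)z - Āᵀ(R - 1)Āz) with δ_r = W^(-1/2)Āz
(`LSInput.residual_eq`). The first part is O(γ²) because H is a γ-approximation. The second is a sum
of independent centred vectors, each small because the sampling weights dominate leverage scores,
and `cubeExp_norm_tail_le` bounds it: cosh of the norm of the partial sums is almost a
supermartingale. Dual feasibility is exact, since S̄δ_p lies in the range of A. -/

lemma form_comm (G : Matrix (Fin n) (Fin n) ℝ) (hG : Gᵀ = G) (y z : Fin n → ℝ) :
    y ⬝ᵥ G *ᵥ z = z ⬝ᵥ G *ᵥ y := by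
  rw [dotProduct_mulVec, ← mulVec_transpose, hG, dotProduct_comm]

lemma posDef_symm {G : Matrix (Fin n) (Fin n) ℝ} (hG : G.PosDef) : Gᵀ = G := by
  simpa using hG.isHermitian.eq

lemma posSemidef_symm {G : Matrix (Fin n) (Fin n) ℝ} (hG : G.PosSemidef) : Gᵀ = G := by
  simpa using hG.isHermitian.eq

lemma posSemidef_form_nonneg {G : Matrix (Fin n) (Fin n) ℝ} (hG : G.PosSemidef)
    (z : Fin n → ℝ) : 0 ≤ z ⬝ᵥ G *ᵥ z := by
  simpa using hG.dotProduct_mulVec_nonneg z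

/-- Cauchy-Schwarz for a positive semidefinite form. -/
lemma form_sq_le {G : Matrix (Fin n) (Fin n) ℝ} (hG : G.PosSemidef) (y z : Fin n → ℝ) :
    (y ⬝ᵥ G *ᵥ z) ^ 2 ≤ (y ⬝ᵥ G *ᵥ y) * (z ⬝ᵥ G *ᵥ z) := by
  have h := LinearMap.BilinForm.apply_sq_le_of_symm (Matrix.toBilin' G)
    (fun x => by rw [Matrix.toBilin'_apply']; exact posSemidef_form_nonneg hG x)
    ⟨fun x y => by
      simp only [Matrix.toBilin'_apply', RingHom.id_apply]
      exact form_comm G (posSemidef_symm hG) x y⟩ y z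
  simpa only [Matrix.toBilin'_apply'] using h

lemma posDef_mul_inv {G : Matrix (Fin n) (Fin n) ℝ} (hG : G.PosDef) : G * G⁻¹ = 1 :=
  Matrix.mul_nonsing_inv _ ((Matrix.isUnit_iff_isUnit_det _).1 hG.isUnit)

lemma posDef_inv_mul {G : Matrix (Fin n) (Fin n) ℝ} (hG : G.PosDef) : G⁻¹ * G = 1 :=
  Matrix.nonsing_inv_mul _ ((Matrix.isUnit_iff_isUnit_det _).1 hG.isUnit)

lemma mulVec_inv_mulVec {G : Matrix (Fin n) (Fin n) ℝ} (hG : G.PosDef) (h : Fin n → ℝ) :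
    G *ᵥ (G⁻¹ *ᵥ h) = h := by
  rw [mulVec_mulVec, posDef_mul_inv hG, one_mulVec]

lemma inv_mulVec_mulVec {G : Matrix (Fin n) (Fin n) ℝ} (hG : G.PosDef) (h : Fin n → ℝ) :
    G⁻¹ *ᵥ (G *ᵥ h) = h := by
  rw [mulVec_mulVec, posDef_inv_mul hG, one_mulVec]

lemma dotProduct_sq_le_inv {G : Matrix (Fin n) (Fin n) ℝ} (hG : G.PosDef) (h z : Fin n → ℝ) :
    (h ⬝ᵥ z) ^ 2 ≤ (h ⬝ᵥ G⁻¹ *ᵥ h) * (z ⬝ᵥ G *ᵥ z) := by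
  have := form_sq_le hG.posSemidef z (G⁻¹ *ᵥ h)
  rw [mulVec_inv_mulVec hG] at this
  rw [dotProduct_comm h z, mul_comm, dotProduct_comm h]
  exact this

/-- Inversion reverses the Loewner order, in terms of quadratic forms. -/
lemma inv_form_le {G G' : Matrix (Fin n) (Fin n) ℝ} (hG : G.PosDef) (hG' : G'.PosDef) {K : ℝ}
    (hle : ∀ z, z ⬝ᵥ G *ᵥ z ≤ K * (z ⬝ᵥ G' *ᵥ z)) (h : Fin n → ℝ) :
    h ⬝ᵥ G'⁻¹ *ᵥ h ≤ K * (h ⬝ᵥ G⁻¹ *ᵥ h) := by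
  -- Pairing `h` with `G'⁻¹ *ᵥ h` puts the quantity to be bounded squared on the left and, through
  -- `hle`, once on the right. One factor cancels unless it is zero.
  have h1 := dotProduct_sq_le_inv hG h (G'⁻¹ *ᵥ h)
  have h2 := hle (G'⁻¹ *ᵥ h)
  rw [mulVec_inv_mulVec hG', dotProduct_comm (G'⁻¹ *ᵥ h) h] at h2
  have h3 : 0 ≤ h ⬝ᵥ G⁻¹ *ᵥ h := posSemidef_form_nonneg hG.inv.posSemidef h
  have h4 : 0 ≤ h ⬝ᵥ G'⁻¹ *ᵥ h := posSemidef_form_nonneg hG'.inv.posSemidef h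
  rcases h4.eq_or_lt with h5 | h5
  · have h6 := posSemidef_form_nonneg hG.posSemidef (G'⁻¹ *ᵥ h)
    rcases lt_or_ge K 0 with hK | hK
    · have hz : h = 0 := by
        by_contra hne
        have := hG'.inv.dotProduct_mulVec_pos hne
        simp only [star_trivial] at this
        linarith
      simp [hz]
    · rw [← h5]; positivity
  · have := h1.trans (mul_le_mul_of_nonneg_left h2 h3)
    by_contra! hc
    nlinarith

/-- A symmetric matrix bounded by `c G` in the Loewner order maps the `G`-norm to the dual norm
with norm at most `c`. -/
lemma form_inv_le_of_abs_le {G D : Matrix (Fin n) (Fin n) ℝ} (hG : G.PosDef) (hD : Dᵀ = D) {c : ℝ}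
    (hc : 0 < c) (hle : ∀ z, |z ⬝ᵥ D *ᵥ z| ≤ c * (z ⬝ᵥ G *ᵥ z)) (h : Fin n → ℝ) :
    (D *ᵥ h) ⬝ᵥ G⁻¹ *ᵥ (D *ᵥ h) ≤ c ^ 2 * (h ⬝ᵥ G *ᵥ h) := by
  set y := G⁻¹ *ᵥ (D *ᵥ h) with hy
  have hGy : G *ᵥ y = D *ᵥ h := mulVec_inv_mulVec hG _
  have e1 : (D *ᵥ h) ⬝ᵥ y = y ⬝ᵥ G *ᵥ y := by rw [hGy, dotProduct_comm]
  have e2 : y ⬝ᵥ D *ᵥ h = y ⬝ᵥ G *ᵥ y := by rw [hGy]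
  -- Polarization: the difference of the forms of `D` at `y ± c • h` is 4c times the pairing of `y`
  -- with `D *ᵥ h`, which is the `G`-form of `y`. The scale `c` makes the resulting inequality the
  -- sharp one.
  have a1 := (abs_le.1 (hle (y + c • h))).2
  have a2 := (abs_le.1 (hle (y - c • h))).1
  have s1 := form_comm D hD y h
  have s2 := form_comm G (posDef_symm hG) y h
  simp only [mulVec_add, mulVec_sub, mulVec_smul, dotProduct_add, add_dotProduct, dotProduct_sub,
    sub_dotProduct, smul_dotProduct, dotProduct_smul, smul_eq_mul] at a1 a2
  rw [e1]
  rw [← s1, e2] at a1 a2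
  rw [← s2] at a1 a2
  have : c * (y ⬝ᵥ G *ᵥ y) ≤ c * (c ^ 2 * (h ⬝ᵥ G *ᵥ h)) := by nlinarith
  exact le_of_mul_le_mul_left this hc

lemma gram_form (M : Matrix (Fin m) (Fin n) ℝ) (z : Fin n → ℝ) :
    z ⬝ᵥ (Mᵀ * M) *ᵥ z = ∑ i, (M *ᵥ z) i ^ 2 := by
  rw [← mulVec_mulVec, dotProduct_mulVec, vecMul_transpose]
  simp [dotProduct, sq]

lemma weighted_gram_form (M : Matrix (Fin m) (Fin n) ℝ) (d : Fin m → ℝ) (y z : Fin n → ℝ) :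
    y ⬝ᵥ (Mᵀ * diagonal d * M) *ᵥ z = ∑ i, d i * ((M *ᵥ y) i * (M *ᵥ z) i) := by
  rw [← mulVec_mulVec, ← mulVec_mulVec, dotProduct_mulVec, vecMul_transpose]
  simp only [dotProduct, mulVec_diagonal]
  exact Finset.sum_congr rfl fun i _ => by ring

lemma gram_posDef {M : Matrix (Fin m) (Fin n) ℝ} (hM : Function.Injective M.mulVec) :
    (Mᵀ * M).PosDef := by
  simpa using Matrix.PosDef.conjTranspose_mul_self M hM

lemma weighted_gram_posDef {M : Matrix (Fin m) (Fin n) ℝ} (hM : Function.Injective M.mulVec)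
    {d : Fin m → ℝ} (hd : ∀ i, 0 < d i) : (Mᵀ * diagonal d * M).PosDef := by
  refine Matrix.PosDef.of_dotProduct_mulVec_pos ?_ fun {x} hx => ?_
  · simp [Matrix.IsHermitian, Matrix.mul_assoc]
  · rw [star_trivial, weighted_gram_form]
    have hne : M *ᵥ x ≠ 0 := fun h0 => hx (hM (by simpa using h0))
    obtain ⟨i, hi⟩ := Function.ne_iff.1 hne
    refine Finset.sum_pos' (fun j _ => ?_) ⟨i, Finset.mem_univ _, ?_⟩
    · have := hd j; have := mul_self_nonneg ((M *ᵥ x) j); positivity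
    · have := hd i; have := mul_self_pos.2 hi; positivity

lemma NonDegenerate.injective {A : Matrix (Fin m) (Fin n) ℝ} (hA : NonDegenerate A) :
    Function.Injective A.mulVec := by
  have h := LinearMap.finrank_range_add_finrank_ker A.mulVecLin
  have h2 : Module.finrank ℝ (LinearMap.range A.mulVecLin) = n := hA.2
  rw [h2] at h
  have h3 : LinearMap.ker A.mulVecLin = ⊥ := by
    simpa using h
  exact LinearMap.ker_eq_bot.1 h3

lemma diagonal_mul_injective {M : Matrix (Fin m) (Fin n) ℝ} (hM : Function.Injective M.mulVec)
    {d : Fin m → ℝ} (hd : ∀ i, d i ≠ 0) : Function.Injective (diagonal d * M).mulVec := by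
  intro y z h
  refine hM (funext fun i => ?_)
  have := congrFun h i
  simp only [← mulVec_mulVec, mulVec_diagonal] at this
  exact mul_left_cancel₀ (hd i) this

end Forms

/-! ### Projections and leverage scores -/

section Leverage

variable {m n : ℕ}

/-- The orthogonal projection onto the column space of a matrix of full column rank. -/
noncomputable def colProj (M : Matrix (Fin m) (Fin n) ℝ) : Matrix (Fin m) (Fin m) ℝ :=
  M * (Mᵀ * M)⁻¹ * Mᵀ

lemma colProj_transpose (M : Matrix (Fin m) (Fin n) ℝ) : (colProj M)ᵀ = colProj M := by
  simp [colProj, Matrix.transpose_mul, Matrix.transpose_nonsing_inv, Matrix.mul_assoc]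

lemma colProj_mul_self {M : Matrix (Fin m) (Fin n) ℝ} (hM : Function.Injective M.mulVec) :
    colProj M * colProj M = colProj M := by
  have h := posDef_mul_inv (gram_posDef hM)
  calc colProj M * colProj M
      = M * (Mᵀ * M)⁻¹ * ((Mᵀ * M) * (Mᵀ * M)⁻¹) * Mᵀ := by
        simp only [colProj, Matrix.mul_assoc]
    _ = colProj M := by rw [h, Matrix.mul_one, colProj]

lemma colProj_trace {M : Matrix (Fin m) (Fin n) ℝ} (hM : Function.Injective M.mulVec) :
    ∑ i, colProj M i i = n := by
  have h := posDef_inv_mul (gram_posDef hM)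
  have : (colProj M).trace = n := by
    rw [colProj, Matrix.mul_assoc, Matrix.trace_mul_comm, Matrix.mul_assoc, h, Matrix.trace_one,
      Fintype.card_fin]
  simpa [Matrix.trace] using this

lemma sum_sq_eq_diag {P : Matrix (Fin m) (Fin m) ℝ} (hs : Pᵀ = P) (hP : P * P = P) (i : Fin m) :
    ∑ j, P i j ^ 2 = P i i := by
  conv_rhs => rw [← hP, Matrix.mul_apply]
  refine Finset.sum_congr rfl fun j _ => ?_
  have : P j i = P i j := congrFun (congrFun hs i) j
  rw [this, sq]

lemma proj_diag_nonneg {P : Matrix (Fin m) (Fin m) ℝ} (hs : Pᵀ = P) (hP : P * P = P) (i : Fin m) :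
    0 ≤ P i i := by
  rw [← sum_sq_eq_diag hs hP]; positivity

lemma proj_diag_le_one {P : Matrix (Fin m) (Fin m) ℝ} (hs : Pᵀ = P) (hP : P * P = P) (i : Fin m) :
    P i i ≤ 1 := by
  have h := sum_sq_eq_diag hs hP i
  have : P i i ^ 2 ≤ ∑ j, P i j ^ 2 :=
    Finset.single_le_sum (f := fun j => P i j ^ 2) (fun j _ => sq_nonneg _) (Finset.mem_univ i)
  nlinarith

lemma colProj_mulVec_sq_le {P : Matrix (Fin m) (Fin m) ℝ} (hs : Pᵀ = P) (hP : P * P = P)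
    (k : Fin m → ℝ) : ∑ i, (P *ᵥ k) i ^ 2 ≤ ∑ i, k i ^ 2 := by
  have h1 : ∑ i, (P *ᵥ k) i ^ 2 = ∑ i, k i * (P *ᵥ k) i := by
    have e := gram_form P k
    rw [hs, hP] at e
    rw [← e]; rfl
  have h2 : 0 ≤ ∑ i, (k i - (P *ᵥ k) i) ^ 2 := by positivity
  have h3 : ∑ i, (k i - (P *ᵥ k) i) ^ 2
      = ∑ i, k i ^ 2 - 2 * ∑ i, k i * (P *ᵥ k) i + ∑ i, (P *ᵥ k) i ^ 2 := by
    rw [Finset.mul_sum, ← Finset.sum_sub_distrib, ← Finset.sum_add_distrib]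
    exact Finset.sum_congr rfl fun i _ => by ring
  linarith

/-- Turns the dual norm of a vector in the range of `Mᵀ` into the Euclidean norm of a projected
vector. The contraction property of projections and the vector tail bound both apply in that form.
-/
lemma colProj_mulVec_sq {M : Matrix (Fin m) (Fin n) ℝ} (hM : Function.Injective M.mulVec)
    (k : Fin m → ℝ) :
    ∑ i, (colProj M *ᵥ k) i ^ 2 = (Mᵀ *ᵥ k) ⬝ᵥ (Mᵀ * M)⁻¹ *ᵥ (Mᵀ *ᵥ k) := by
  rw [← gram_form, colProj_transpose, colProj_mul_self hM, colProj, ← mulVec_mulVec,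
    ← mulVec_mulVec, dotProduct_mulVec, ← mulVec_transpose]

lemma leverage_eq_colProj (M : Matrix (Fin m) (Fin n) ℝ) (i : Fin m) :
    leverage M i = colProj M i i := rfl

lemma leverage_eq_form (M : Matrix (Fin m) (Fin n) ℝ) (i : Fin m) :
    leverage M i = M i ⬝ᵥ (Mᵀ * M)⁻¹ *ᵥ M i := by
  rw [leverage, Matrix.mul_apply', dotProduct_mulVec]
  rfl

lemma colProj_apply (M : Matrix (Fin m) (Fin n) ℝ) (j i : Fin m) :
    (M *ᵥ ((Mᵀ * M)⁻¹ *ᵥ M i)) j = colProj M j i := by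
  rw [mulVec_mulVec, colProj, Matrix.mul_apply']
  rfl

/-- A row of `M` applied to `z` is controlled by the leverage score. -/
lemma mulVec_apply_sq_le {M : Matrix (Fin m) (Fin n) ℝ} (hM : Function.Injective M.mulVec)
    (z : Fin n → ℝ) (i : Fin m) :
    (M *ᵥ z) i ^ 2 ≤ leverage M i * ∑ j, (M *ᵥ z) j ^ 2 := by
  have := dotProduct_sq_le_inv (gram_posDef hM) (M i) z
  rwa [← leverage_eq_form, gram_form] at this

lemma diagonal_gram (M : Matrix (Fin m) (Fin n) ℝ) (e : Fin m → ℝ) :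
    (diagonal e * M)ᵀ * (diagonal e * M) = Mᵀ * diagonal (fun i => e i ^ 2) * M := by
  rw [transpose_mul, diagonal_transpose, Matrix.mul_assoc, ← Matrix.mul_assoc (diagonal e),
    diagonal_mul_diagonal, Matrix.mul_assoc]
  simp only [sq]

lemma diagonal_mul_row (M : Matrix (Fin m) (Fin n) ℝ) (e : Fin m → ℝ) (i : Fin m) :
    (diagonal e * M) i = e i • M i := by
  ext j; simp [Matrix.diagonal_mul]

/-- Rescaling the rows changes leverage scores by at most the ratio of the squared scales. -/
lemma leverage_diagonal_le {M : Matrix (Fin m) (Fin n) ℝ} (hM : Function.Injective M.mulVec)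
    {e : Fin m → ℝ} {l u : ℝ} (hl : 0 < l) (he : ∀ i, e i ≠ 0) (hle : ∀ i, l ≤ e i ^ 2)
    (hu : ∀ i, e i ^ 2 ≤ u) (i : Fin m) :
    leverage (diagonal e * M) i ≤ u / l * leverage M i := by
  have hM' := diagonal_mul_injective hM he
  have h1 := inv_form_le (gram_posDef hM) (gram_posDef hM') (K := l⁻¹) (fun z => by
    rw [gram_form, gram_form, Finset.mul_sum]
    refine Finset.sum_le_sum fun j _ => ?_
    rw [← mulVec_mulVec, mulVec_diagonal, mul_pow]
    have := hle j
    rw [← mul_assoc]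
    refine le_mul_of_one_le_left (sq_nonneg _) ?_
    rw [inv_mul_eq_div, one_le_div hl]; exact this) (M i)
  rw [← leverage_eq_form] at h1
  have hlev : 0 ≤ leverage M i :=
    proj_diag_nonneg (colProj_transpose M) (colProj_mul_self hM) i
  rw [leverage_eq_form, diagonal_mul_row, mulVec_smul, dotProduct_smul, smul_dotProduct,
    smul_eq_mul, smul_eq_mul, ← mul_assoc, ← sq]
  calc e i ^ 2 * _ ≤ e i ^ 2 * (l⁻¹ * leverage M i) :=
        mul_le_mul_of_nonneg_left h1 (sq_nonneg _)
    _ ≤ u * (l⁻¹ * leverage M i) := mul_le_mul_of_nonneg_right (hu i) (by positivity)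
    _ = _ := by ring

/-- Second order expansion of leverage scores under a rescaling of the rows, in terms of the
projection of the unscaled matrix only. -/
lemma leverage_diagonal_expansion {M : Matrix (Fin m) (Fin n) ℝ}
    (hM : Function.Injective M.mulVec) {e E : Fin m → ℝ} (heE : ∀ i, e i ^ 2 = 1 + E i)
    (hE : ∀ i, |E i| ≤ 1 / 2) (i : Fin m) :
    |leverage (diagonal e * M) i - leverage M i
        - (leverage M i * E i - ∑ j, colProj M i j ^ 2 * E j)|
      ≤ 4 * (leverage M i * E i ^ 2 + ∑ j, colProj M i j ^ 2 * E j ^ 2) := by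
  have he : ∀ i, e i ≠ 0 := fun i h0 => by
    have := heE i; have := abs_le.1 (hE i); rw [h0] at *; norm_num at *; linarith
  have hM' := diagonal_mul_injective hM he
  have hsymm : ∀ j k, colProj M j k = colProj M k j := fun j k =>
    congrFun (congrFun (colProj_transpose M) k) j
  have hP := colProj_mul_self hM
  set G := Mᵀ * M with hG
  set G' := (diagonal e * M)ᵀ * (diagonal e * M) with hG'
  have pG : G.PosDef := gram_posDef hM
  have pG' : G'.PosDef := gram_posDef hM'
  set D := Mᵀ * diagonal E * M with hD
  have hadd : G' = G + D := by
    rw [hG', diagonal_gram, hG, hD]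
    have : (diagonal fun i => e i ^ 2) = (1 : Matrix (Fin m) (Fin m) ℝ) + diagonal E := by
      rw [← diagonal_one, diagonal_add]; simp [heE]
    rw [this, Matrix.mul_add, Matrix.add_mul, Matrix.mul_one]
  set h := M i
  set z := G⁻¹ *ᵥ h with hz
  have hMz : ∀ j, (M *ᵥ z) j = colProj M j i := fun j => colProj_apply M j i
  set y := D *ᵥ z with hy
  -- resolvent identity
  have hres : G'⁻¹ *ᵥ h = z - G'⁻¹ *ᵥ y := by
    have h1 : G' *ᵥ z = h + y := by rw [hadd, add_mulVec, hz, mulVec_inv_mulVec pG]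
    have h2 : G'⁻¹ *ᵥ (G' *ᵥ z) = G'⁻¹ *ᵥ h + G'⁻¹ *ᵥ y := by rw [h1, mulVec_add]
    rw [inv_mulVec_mulVec pG'] at h2
    rw [h2]; abel
  have sG' : (G'⁻¹)ᵀ = G'⁻¹ := posDef_symm pG'.inv
  have hhy : h ⬝ᵥ G'⁻¹ *ᵥ y = z ⬝ᵥ y - y ⬝ᵥ G'⁻¹ *ᵥ y := by
    rw [form_comm _ sG' h y, hres, dotProduct_sub, dotProduct_comm y z]
  -- The resolvent identity is used twice, so that the perturbed matrix survives only in the last,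
  -- second order term.
  have hmain : h ⬝ᵥ G'⁻¹ *ᵥ h = h ⬝ᵥ z - z ⬝ᵥ y + y ⬝ᵥ G'⁻¹ *ᵥ y := by
    conv_lhs => rw [hres]
    rw [dotProduct_sub, hhy]; ring
  have ea : z ⬝ᵥ y = ∑ j, colProj M i j ^ 2 * E j := by
    rw [hy, hD, weighted_gram_form]
    refine Finset.sum_congr rfl fun j _ => ?_
    rw [hMz, hsymm j i]; ring
  have elev : h ⬝ᵥ z = leverage M i := (leverage_eq_form M i).symm
  set c := y ⬝ᵥ G'⁻¹ *ᵥ y with hc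
  have hc0 : 0 ≤ c := posSemidef_form_nonneg pG'.inv.posSemidef y
  have hc1 : c ≤ 2 * ∑ j, colProj M i j ^ 2 * E j ^ 2 := by
    -- Since `E ≥ -1/2`, the unperturbed Gram matrix is at most twice the perturbed one. This
    -- replaces `G'⁻¹` by `G⁻¹` and leaves the norm of a projected vector.
    have h1 := inv_form_le pG pG' (K := 2) (fun w => by
      rw [hG, hG', gram_form, gram_form, Finset.mul_sum]
      refine Finset.sum_le_sum fun j _ => ?_
      rw [← mulVec_mulVec, mulVec_diagonal, mul_pow, heE]
      have := abs_le.1 (hE j)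
      nlinarith [sq_nonneg ((M *ᵥ w) j)]) y
    refine h1.trans (mul_le_mul_of_nonneg_left ?_ (by norm_num))
    have hyv : y = Mᵀ *ᵥ (fun j => E j * colProj M j i) := by
      rw [hy, hD, ← mulVec_mulVec, ← mulVec_mulVec]
      congr 1
      ext j
      rw [mulVec_diagonal, hMz]
    have h2 : y ⬝ᵥ G⁻¹ *ᵥ y
        = ∑ j, (colProj M *ᵥ (fun j => E j * colProj M j i)) j ^ 2 := by
      rw [colProj_mulVec_sq hM, ← hyv]
    rw [h2]
    refine (colProj_mulVec_sq_le (colProj_transpose M) hP _).trans (le_of_eq ?_)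
    refine Finset.sum_congr rfl fun j _ => ?_
    rw [hsymm j i]; ring
  have hnew : leverage (diagonal e * M) i
      = (1 + E i) * (leverage M i - (∑ j, colProj M i j ^ 2 * E j) + c) := by
    rw [leverage_eq_form, diagonal_mul_row, mulVec_smul, dotProduct_smul, smul_dotProduct,
      smul_eq_mul, smul_eq_mul, ← mul_assoc, ← sq, heE, ← hG', hmain, ea, elev]
  have hsum := sum_sq_eq_diag (colProj_transpose M) hP i
  rw [← leverage_eq_colProj] at hsum
  set a := ∑ j, colProj M i j ^ 2 * E j with ha
  set q := ∑ j, colProj M i j ^ 2 * E j ^ 2 with hq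
  -- The product of the two first order terms is split by AM-GM, with the numbers `colProj M i j ^
  -- 2` as weights of total mass the leverage score.
  have hEa : |E i * a| ≤ (leverage M i * E i ^ 2 + q) / 2 := by
    rw [ha, Finset.mul_sum, ← hsum, hq, Finset.sum_mul, ← Finset.sum_add_distrib, Finset.sum_div]
    refine (Finset.abs_sum_le_sum_abs _ _).trans (Finset.sum_le_sum fun j _ => ?_)
    rw [abs_le]
    constructor <;> nlinarith [sq_nonneg (E i + E j), sq_nonneg (E i - E j),
      sq_nonneg (colProj M i j), mul_nonneg (sq_nonneg (colProj M i j)) (sq_nonneg (E i + E j)),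
      mul_nonneg (sq_nonneg (colProj M i j)) (sq_nonneg (E i - E j))]
  have hl0 : 0 ≤ leverage M i := proj_diag_nonneg (colProj_transpose M) hP i
  have hEi := abs_le.1 (hE i)
  have hq0 : 0 ≤ q := by linarith
  have hEa' := abs_le.1 hEa
  have hcE1 : 0 ≤ (1 + E i) * c := mul_nonneg (by linarith) hc0
  have hcE2 : (1 + E i) * c ≤ 3 * q := by nlinarith
  have hls : 0 ≤ leverage M i * E i ^ 2 := by positivity
  rw [hnew, abs_le]
  constructor <;> nlinarith

end Leverage

/-! ### Independent coin flips -/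

section Cube

variable {m : ℕ}

/-- The probability of an outcome `c` of independent coin flips with success probabilities `p`. -/
noncomputable def cubeWeight (p : Fin m → ℝ) (c : Fin m → Bool) : ℝ :=
  ∏ i, if c i then p i else 1 - p i

/-- Expectation over independent coin flips with success probabilities `p`. -/
noncomputable def cubeExp (p : Fin m → ℝ) (f : (Fin m → Bool) → ℝ) : ℝ :=
  ∑ c, cubeWeight p c * f c

lemma cubeWeight_nonneg {p : Fin m → ℝ} (h0 : ∀ i, 0 ≤ p i) (h1 : ∀ i, p i ≤ 1)
    (c : Fin m → Bool) : 0 ≤ cubeWeight p c :=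
  Finset.prod_nonneg fun i _ => by
    have := h0 i; have := h1 i
    split_ifs <;> linarith

lemma sum_bool_prod (h : Fin m → Bool → ℝ) :
    ∑ c : Fin m → Bool, ∏ i, h i (c i) = ∏ i, (h i true + h i false) := by
  have := Finset.prod_univ_sum (fun _ : Fin m => (Finset.univ : Finset Bool)) h
  simp only [Fintype.piFinset_univ] at this
  rw [← this]
  simp

lemma cubeExp_const (p : Fin m → ℝ) (a : ℝ) : cubeExp p (fun _ => a) = a := by
  rw [cubeExp, ← Finset.sum_mul]
  have := sum_bool_prod (fun i c => if c then p i else 1 - p i)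
  simp only [cubeWeight, this]
  simp

lemma cubeExp_coord (p : Fin m → ℝ) (i : Fin m) (F : Bool → ℝ) :
    cubeExp p (fun c => F (c i)) = p i * F true + (1 - p i) * F false := by
  have := sum_bool_prod (fun j c => (if c then p j else 1 - p j) * (if j = i then F c else 1))
  rw [Finset.prod_eq_single i] at this
  · simp only [Finset.prod_mul_distrib, Finset.prod_ite_eq', Finset.mem_univ, if_true] at this
    rw [cubeExp]
    simpa [cubeWeight] using this
  · intro j _ hj; simp [hj]
  · simp

lemma cubeExp_add (p : Fin m → ℝ) (f g : (Fin m → Bool) → ℝ) :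
    cubeExp p (fun c => f c + g c) = cubeExp p f + cubeExp p g := by
  simp [cubeExp, mul_add, Finset.sum_add_distrib]

lemma cubeExp_sub (p : Fin m → ℝ) (f g : (Fin m → Bool) → ℝ) :
    cubeExp p (fun c => f c - g c) = cubeExp p f - cubeExp p g := by
  simp [cubeExp, mul_sub, Finset.sum_sub_distrib]

lemma cubeExp_const_mul (p : Fin m → ℝ) (a : ℝ) (f : (Fin m → Bool) → ℝ) :
    cubeExp p (fun c => a * f c) = a * cubeExp p f := by
  simp only [cubeExp, Finset.mul_sum]
  exact Finset.sum_congr rfl fun c _ => by ring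

lemma cubeExp_sum {ι : Type*} (p : Fin m → ℝ) (s : Finset ι) (f : ι → (Fin m → Bool) → ℝ) :
    cubeExp p (fun c => ∑ i ∈ s, f i c) = ∑ i ∈ s, cubeExp p (f i) := by
  simp only [cubeExp, Finset.mul_sum]
  exact Finset.sum_comm

lemma cubeExp_mono {p : Fin m → ℝ} (h0 : ∀ i, 0 ≤ p i) (h1 : ∀ i, p i ≤ 1)
    {f g : (Fin m → Bool) → ℝ} (h : ∀ c, f c ≤ g c) : cubeExp p f ≤ cubeExp p g :=
  Finset.sum_le_sum fun c _ => mul_le_mul_of_nonneg_left (h c) (cubeWeight_nonneg h0 h1 c)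

lemma cubeExp_nonneg {p : Fin m → ℝ} (h0 : ∀ i, 0 ≤ p i) (h1 : ∀ i, p i ≤ 1)
    {f : (Fin m → Bool) → ℝ} (h : ∀ c, 0 ≤ f c) : 0 ≤ cubeExp p f :=
  Finset.sum_nonneg fun c _ => mul_nonneg (cubeWeight_nonneg h0 h1 c) (h c)

lemma abs_cubeExp_le {p : Fin m → ℝ} (h0 : ∀ i, 0 ≤ p i) (h1 : ∀ i, p i ≤ 1)
    {f g : (Fin m → Bool) → ℝ} (h : ∀ c, |f c| ≤ g c) : |cubeExp p f| ≤ cubeExp p g := by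
  rw [abs_le]
  constructor
  · have := cubeExp_mono h0 h1 (f := fun c => -1 * g c) (g := f)
      fun c => by have := (abs_le.1 (h c)).1; linarith
    rw [cubeExp_const_mul] at this; linarith
  · exact cubeExp_mono h0 h1 fun c => (abs_le.1 (h c)).2

/-- Conditioning on the first coin, for the induction in `cubeExp_cosh_le`. -/
lemma cubeExp_succ (p : Fin (m + 1) → ℝ) (f : (Fin (m + 1) → Bool) → ℝ) :
    cubeExp p f = p 0 * cubeExp (Fin.tail p) (fun c => f (Fin.cons true c))
      + (1 - p 0) * cubeExp (Fin.tail p) (fun c => f (Fin.cons false c)) := by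
  have e : cubeExp p f = ∑ x : Bool × (Fin m → Bool),
      cubeWeight p (Fin.cons x.1 x.2) * f (Fin.cons x.1 x.2) :=
    (Fintype.sum_equiv (Fin.consEquiv fun _ => Bool) _ _ fun x => rfl).symm
  rw [e, Fintype.sum_prod_type]
  simp only [Fintype.sum_bool, cubeExp, cubeWeight, Fin.prod_univ_succ, Fin.cons_zero,
    Fin.cons_succ, Finset.mul_sum, Fin.tail]
  simp [mul_assoc]

end Cube

/-! ### A dimension-free Bernstein bound for vectors -/

section Pinelis

variable {V : Type*} [NormedAddCommGroup V] [InnerProductSpace ℝ V]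

/-- The function y ↦ cosh √y is convex on y ≥ 0, because its power series has nonnegative
coefficients and each power is convex. -/
lemma cosh_sqrt_chord {y₁ y₂ s t : ℝ} (hs : 0 ≤ s) (ht : 0 ≤ t) (hst : s + t = 1)
    {a₁ a₂ a : ℝ} (h1 : y₁ = a₁ ^ 2) (h2 : y₂ = a₂ ^ 2) (h : s * y₁ + t * y₂ = a ^ 2) :
    Real.cosh a ≤ s * Real.cosh a₁ + t * Real.cosh a₂ := by
  refine hasSum_le (fun k => ?_) (Real.hasSum_cosh a)
    (((Real.hasSum_cosh a₁).mul_left s).add ((Real.hasSum_cosh a₂).mul_left t))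
  rw [pow_mul, pow_mul, pow_mul, ← h1, ← h2, ← h, ← mul_div_assoc, ← mul_div_assoc, ← add_div]
  have := (convexOn_pow k (𝕜 := ℝ)).2 (x := y₁) (y := y₂) (by rw [h1]; exact sq_nonneg a₁)
    (by rw [h2]; exact sq_nonneg a₂) hs ht hst
  simp only [smul_eq_mul] at this
  gcongr

/-- If k is the cosine of the angle between `z` and `x`, then ‖z + x‖² is the convex combination of
(‖z‖ + ‖x‖)² and (‖z‖ - ‖x‖)² with weights (1 ± k)/2. Convexity of cosh √y and the addition formulas
finish. -/
lemma cosh_norm_add_le (z x : V) :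
    Real.cosh ‖z + x‖ ≤ Real.cosh ‖z‖ * Real.cosh ‖x‖
      + (inner ℝ z x / (‖z‖ * ‖x‖)) * (Real.sinh ‖z‖ * Real.sinh ‖x‖) := by
  rcases eq_or_ne z 0 with rfl | hz
  · simp
  rcases eq_or_ne x 0 with rfl | hx
  · simp
  have hz' := norm_pos_iff.2 hz
  have hx' := norm_pos_iff.2 hx
  have hi := abs_le.1 (abs_real_inner_div_norm_mul_norm_le_one z x)
  set k := inner ℝ z x / (‖z‖ * ‖x‖) with hk
  have hk' : inner ℝ z x = k * (‖z‖ * ‖x‖) := by rw [hk]; field_simp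
  have := cosh_sqrt_chord (s := (1 + k) / 2) (t := (1 - k) / 2) (a₁ := ‖z‖ + ‖x‖)
    (a₂ := ‖z‖ - ‖x‖) (a := ‖z + x‖) (by linarith) (by linarith) (by ring) rfl rfl (by
      rw [norm_add_sq_real, hk']; ring)
  rw [Real.cosh_add, Real.cosh_sub] at this
  linarith

lemma sinh_sub_nonneg {b : ℝ} (hb : 0 ≤ b) : 0 ≤ Real.sinh b - b := by
  linarith [Real.self_le_sinh_iff.2 hb]

/-- One step of the supermartingale `cosh ‖z + X‖` for a two-valued centred vector `X`. -/
lemma cosh_two_point_le (z u : V) {p a b W : ℝ} (hp : 0 ≤ p) (hp1 : p ≤ 1)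
    (hmean : p * a + (1 - p) * b = 0)
    (hW : p * (Real.exp ‖a • u‖ - 1 - ‖a • u‖) + (1 - p) * (Real.exp ‖b • u‖ - 1 - ‖b • u‖) ≤ W) :
    p * Real.cosh ‖z + a • u‖ + (1 - p) * Real.cosh ‖z + b • u‖ ≤
      Real.cosh ‖z‖ * (1 + W) := by
  -- Splitting sinh‖x‖ as ‖x‖ plus a nonnegative remainder isolates a term linear in `x`, which
  -- vanishes in the mean. The remainder is bounded with cosine ≤ 1 and sinh ≤ cosh, and cosh + sinh
  -- = exp recombines it.
  have key : ∀ x : V, Real.cosh ‖z + x‖ ≤ Real.cosh ‖z‖ * (Real.exp ‖x‖ - ‖x‖)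
      + (Real.sinh ‖z‖ / ‖z‖) * inner ℝ z x := by
    intro x
    have h := cosh_norm_add_le z x
    rcases eq_or_ne z 0 with rfl | hz
    · simp only [zero_add, norm_zero, Real.cosh_zero, one_mul, inner_zero_left, mul_zero, add_zero]
      have := sinh_sub_nonneg (norm_nonneg x)
      have := Real.cosh_add_sinh ‖x‖
      linarith
    rcases eq_or_ne x 0 with rfl | hx
    · simp
    have hz' := norm_pos_iff.2 hz
    have hx' := norm_pos_iff.2 hx
    have e1 : (inner ℝ z x / (‖z‖ * ‖x‖)) * (Real.sinh ‖z‖ * Real.sinh ‖x‖)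
        = (Real.sinh ‖z‖ / ‖z‖) * inner ℝ z x
          + (inner ℝ z x / (‖z‖ * ‖x‖)) * Real.sinh ‖z‖ * (Real.sinh ‖x‖ - ‖x‖) := by
      field_simp; ring
    have hi := (abs_le.1 (abs_real_inner_div_norm_mul_norm_le_one z x)).2
    have hs := Real.sinh_nonneg_iff.2 hz'.le
    have hsx := sinh_sub_nonneg hx'.le
    have h2 : (inner ℝ z x / (‖z‖ * ‖x‖)) * Real.sinh ‖z‖ * (Real.sinh ‖x‖ - ‖x‖)
        ≤ Real.cosh ‖z‖ * (Real.sinh ‖x‖ - ‖x‖) := by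
      refine mul_le_mul_of_nonneg_right ?_ hsx
      have := Real.sinh_lt_cosh ‖z‖
      nlinarith
    have h3 := Real.cosh_add_sinh ‖x‖
    rw [e1] at h
    have h4 : Real.cosh ‖z‖ * (Real.exp ‖x‖ - ‖x‖) = Real.cosh ‖z‖ * Real.cosh ‖x‖
        + Real.cosh ‖z‖ * (Real.sinh ‖x‖ - ‖x‖) := by rw [← h3]; ring
    linarith
  have h1 := mul_le_mul_of_nonneg_left (key (a • u)) hp
  have h2 := mul_le_mul_of_nonneg_left (key (b • u)) (sub_nonneg.2 hp1)
  rw [inner_smul_right] at h1 h2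
  have h3 := mul_le_mul_of_nonneg_left hW (Real.cosh_pos ‖z‖).le
  have h4 : (Real.sinh ‖z‖ / ‖z‖) * inner ℝ z u * (p * a + (1 - p) * b) = 0 := by
    rw [hmean, mul_zero]
  linarith

/-- Iterates the one-step bound coin by coin, with 1 + W ≤ exp W. The starting point `z` is left
free for the induction. No dimension enters, as only norms of the summands are used. -/
lemma cubeExp_cosh_le {m : ℕ} (p : Fin m → ℝ) (h0 : ∀ i, 0 ≤ p i) (h1 : ∀ i, p i ≤ 1)
    (ξ : Fin m → Bool → ℝ) (u : Fin m → V) (W : Fin m → ℝ)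
    (hmean : ∀ i, p i * ξ i true + (1 - p i) * ξ i false = 0)
    (hW : ∀ i, p i * (Real.exp ‖ξ i true • u i‖ - 1 - ‖ξ i true • u i‖)
      + (1 - p i) * (Real.exp ‖ξ i false • u i‖ - 1 - ‖ξ i false • u i‖) ≤ W i) (z : V) :
    cubeExp p (fun c => Real.cosh ‖z + ∑ i, ξ i (c i) • u i‖) ≤
      Real.cosh ‖z‖ * Real.exp (∑ i, W i) := by
  induction m generalizing z with
  | zero => simp [cubeExp_const]
  | succ m ih =>
    rw [cubeExp_succ]
    have step := fun w => ih (Fin.tail p) (fun i => h0 i.succ) (fun i => h1 i.succ) (Fin.tail ξ)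
      (Fin.tail u) (Fin.tail W) (fun i => hmean i.succ) (fun i => hW i.succ) w
    simp only [Fin.sum_univ_succ, Fin.cons_zero, Fin.cons_succ, ← add_assoc]
    simp only [Fin.tail] at step ⊢
    have s1 := mul_le_mul_of_nonneg_left (step (z + ξ 0 true • u 0)) (h0 0)
    have s2 := mul_le_mul_of_nonneg_left (step (z + ξ 0 false • u 0)) (sub_nonneg.2 (h1 0))
    have s3 := cosh_two_point_le z (u 0) (h0 0) (h1 0) (hmean 0) (hW 0)
    have s4 : Real.cosh ‖z‖ * (1 + W 0) ≤ Real.cosh ‖z‖ * Real.exp (W 0) :=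
      mul_le_mul_of_nonneg_left (by linarith [Real.add_one_le_exp (W 0)]) (Real.cosh_pos _).le
    have s5 := mul_le_mul_of_nonneg_right (s3.trans s4)
      (Real.exp_pos (∑ i : Fin m, W i.succ)).le
    rw [Real.exp_add]
    linarith

lemma exp_sub_one_sub_le_sq {y : ℝ} (h0 : 0 ≤ y) (h1 : y ≤ 1) : Real.exp y - 1 - y ≤ y ^ 2 := by
  have := Real.abs_exp_sub_one_sub_id_le (x := y) (by rw [abs_of_nonneg h0]; exact h1)
  exact (le_abs_self _).trans this

/-- A Bernstein-type tail bound for sums of independent centred two-valued vectors. -/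
lemma cubeExp_norm_tail_le {m : ℕ} (p : Fin m → ℝ) (h0 : ∀ i, 0 ≤ p i) (h1 : ∀ i, p i ≤ 1)
    (ξ : Fin m → Bool → ℝ) (u : Fin m → V) {θ t B : ℝ} (hθ : 0 ≤ θ)
    (hmean : ∀ i, p i * ξ i true + (1 - p i) * ξ i false = 0)
    (hbd : ∀ i b, θ * (|ξ i b| * ‖u i‖) ≤ 1)
    (hvar : ∑ i, (p i * ξ i true ^ 2 + (1 - p i) * ξ i false ^ 2) * ‖u i‖ ^ 2 ≤ B) :
    cubeExp p (fun c => if t < ‖∑ i, ξ i (c i) • u i‖ then 1 else 0) ≤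
      2 * Real.exp (-(θ * t) + θ ^ 2 * B) := by
  have hE := cubeExp_cosh_le p h0 h1 ξ (fun i => θ • u i)
    (fun i => θ ^ 2 * ((p i * ξ i true ^ 2 + (1 - p i) * ξ i false ^ 2) * ‖u i‖ ^ 2)) hmean
    (fun i => by
      have key : ∀ b, Real.exp ‖ξ i b • θ • u i‖ - 1 - ‖ξ i b • θ • u i‖
          ≤ θ ^ 2 * (ξ i b ^ 2 * ‖u i‖ ^ 2) := fun b => by
        have e : ‖ξ i b • θ • u i‖ = θ * (|ξ i b| * ‖u i‖) := by
          rw [norm_smul, norm_smul, Real.norm_eq_abs, Real.norm_eq_abs, abs_of_nonneg hθ]; ring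
        rw [e]
        refine (exp_sub_one_sub_le_sq (by positivity) (hbd i b)).trans (le_of_eq ?_)
        rw [mul_pow, mul_pow, sq_abs]
      have a1 := mul_le_mul_of_nonneg_left (key true) (h0 i)
      have a2 := mul_le_mul_of_nonneg_left (key false) (sub_nonneg.2 (h1 i))
      linarith) 0
  simp only [zero_add, norm_zero, Real.cosh_zero, one_mul, ← Finset.mul_sum] at hE
  -- Markov's inequality for cosh: on the event, 1 ≤ 2 exp(-θt) cosh(θ‖·‖).
  have hE2 : cubeExp p (fun c => if t < ‖∑ i, ξ i (c i) • u i‖ then 1 else 0) ≤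
      cubeExp p (fun c => 2 * Real.exp (-(θ * t)) *
        Real.cosh ‖∑ i, ξ i (c i) • θ • u i‖) := by
    refine cubeExp_mono h0 h1 fun c => ?_
    have e : ‖∑ i, ξ i (c i) • θ • u i‖ = θ * ‖∑ i, ξ i (c i) • u i‖ := by
      rw [← abs_of_nonneg hθ, ← Real.norm_eq_abs, ← norm_smul, Finset.smul_sum,
        Real.norm_eq_abs, abs_of_nonneg hθ]
      exact congrArg _ (Finset.sum_congr rfl fun i _ => smul_comm _ _ _)
    rw [e]
    split_ifs with hlt
    · have h2 : Real.exp (θ * t) ≤ 2 * Real.cosh (θ * ‖∑ i, ξ i (c i) • u i‖) := by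
        rw [Real.cosh_eq]
        have := Real.exp_le_exp.2 (mul_le_mul_of_nonneg_left hlt.le hθ)
        have := Real.exp_pos (-(θ * ‖∑ i, ξ i (c i) • u i‖))
        linarith
      have h3 := mul_le_mul_of_nonneg_left h2 (Real.exp_pos (-(θ * t))).le
      rw [← Real.exp_add, neg_add_cancel, Real.exp_zero] at h3
      linarith
    · have := Real.cosh_pos (θ * ‖∑ i, ξ i (c i) • u i‖); positivity
  rw [cubeExp_const_mul] at hE2
  refine hE2.trans ?_
  rw [Real.exp_add, ← mul_assoc]
  gcongr
  refine hE.trans (Real.exp_le_exp.2 ?_)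
  gcongr

end Pinelis

/-! ### The law of the sampling matrix -/

section Law

variable {m : ℕ} {Y : Type*} [MeasurableSpace Y]

/-- The law of a function of independent coin flips. -/
noncomputable def cubeLaw (p : Fin m → ℝ) (y : (Fin m → Bool) → Y) : Measure Y :=
  ∑ c, ENNReal.ofReal (cubeWeight p c) • Measure.dirac (y c)

/-- The sampled diagonal for an outcome of the coin flips. -/
noncomputable def samplePoint (p : Fin m → ℝ) (c : Fin m → Bool) (i : Fin m) : ℝ :=
  if c i then (p i)⁻¹ else 0

/-- The law has finitely many atoms, so every function is integrable. Measurability of the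
potential, with its leverage scores and real powers, never has to be shown. -/
lemma integral_cubeLaw [MeasurableSingletonClass Y]
    {p : Fin m → ℝ} (h0 : ∀ i, 0 ≤ p i) (h1 : ∀ i, p i ≤ 1)
    (y : (Fin m → Bool) → Y) (f : Y → ℝ) :
    Integrable f (cubeLaw p y) ∧ ∫ z, f z ∂(cubeLaw p y) = cubeExp p (fun c => f (y c)) := by
  have hi : ∀ c ∈ (Finset.univ : Finset (Fin m → Bool)),
      Integrable f (ENNReal.ofReal (cubeWeight p c) • Measure.dirac (y c)) := fun c _ =>
    (integrable_dirac (by simp)).smul_measure ENNReal.ofReal_ne_top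
  refine ⟨integrable_finsetSum_measure.2 hi, ?_⟩
  rw [cubeLaw, integral_finsetSum_measure hi]
  refine Finset.sum_congr rfl fun c _ => ?_
  rw [integral_smul_measure, integral_dirac, ENNReal.toReal_ofReal (cubeWeight_nonneg h0 h1 c),
    smul_eq_mul]

lemma ae_cubeLaw [MeasurableSingletonClass Y] {p : Fin m → ℝ} {y : (Fin m → Bool) → Y}
    {Q : Y → Prop} (h : ∀ c, Q (y c)) :
    ∀ᵐ z ∂(cubeLaw p y), Q z := by
  rw [cubeLaw, ← Measure.sum_fintype, Measure.ae_sum_iff]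
  intro c
  refine Measure.ae_smul_measure ?_ _
  rw [ae_dirac_eq]
  exact h c

lemma isProbabilityMeasure_cubeLaw {p : Fin m → ℝ} (h0 : ∀ i, 0 ≤ p i) (h1 : ∀ i, p i ≤ 1)
    (y : (Fin m → Bool) → Y) : IsProbabilityMeasure (cubeLaw p y) := by
  constructor
  rw [cubeLaw, Measure.finsetSum_apply]
  simp only [Measure.smul_apply, measure_univ, smul_eq_mul, mul_one]
  rw [← ENNReal.ofReal_sum_of_nonneg fun c _ => cubeWeight_nonneg h0 h1 c]
  have := cubeExp_const p 1
  simp only [cubeExp, mul_one] at this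
  rw [this, ENNReal.ofReal_one]

lemma real_cubeLaw [MeasurableSingletonClass Y]
    {p : Fin m → ℝ} (h0 : ∀ i, 0 ≤ p i) (h1 : ∀ i, p i ≤ 1)
    (y : (Fin m → Bool) → Y) (Q : Y → Prop) [DecidablePred Q] :
    (cubeLaw p y).real {z | Q z} = 1 - cubeExp p (fun c => if Q (y c) then 0 else 1) := by
  rw [Measure.real, cubeLaw, Measure.finsetSum_apply, ENNReal.toReal_sum fun c _ => by
    simp only [Measure.smul_apply, smul_eq_mul]
    exact ENNReal.mul_ne_top ENNReal.ofReal_ne_top (measure_ne_top _ _)]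
  have e1 := cubeExp_const p 1
  simp only [cubeExp, mul_one] at e1
  rw [eq_sub_iff_add_eq]
  refine Eq.trans ?_ e1
  rw [cubeExp, ← Finset.sum_add_distrib]
  refine Finset.sum_congr rfl fun c _ => ?_
  rw [Measure.smul_apply, Measure.dirac_apply, smul_eq_mul, ENNReal.toReal_mul,
    ENNReal.toReal_ofReal (cubeWeight_nonneg h0 h1 c)]
  by_cases h : Q (y c) <;> simp [h]

/-- The two measures agree on boxes: expanding the product of the two-term sums gives one term for
each outcome of the coins. -/
lemma pi_entryLaw {q : Fin m → ℝ} (hq : ∀ i, 0 < q i) :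
    (Measure.pi fun i => entryLaw (q i))
      = cubeLaw (fun i => min (q i) 1) (samplePoint fun i => min (q i) 1) := by
  have hfin : ∀ i, IsFiniteMeasure (entryLaw (q i)) := fun i => by
    constructor
    simp [entryLaw]
  symm
  apply (Measure.pi_eq _).symm
  intro s hs
  have e : ∀ i, entryLaw (q i) (s i) = ∑ b : Bool,
      ENNReal.ofReal (if b then min (q i) 1 else 1 - min (q i) 1) *
        (s i).indicator 1 (if b then (min (q i) 1)⁻¹ else 0) := fun i => by
    simp [entryLaw, Measure.dirac_apply' _ (hs i)]
  simp only [e]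
  rw [Finset.prod_univ_sum, Fintype.piFinset_univ, cubeLaw, Measure.finsetSum_apply]
  refine Finset.sum_congr rfl fun c _ => ?_
  rw [Measure.smul_apply, Measure.dirac_apply' _ (MeasurableSet.univ_pi hs), smul_eq_mul,
    Finset.prod_mul_distrib, cubeWeight, ENNReal.ofReal_prod_of_nonneg]
  · congr 1
    by_cases h : ∀ i, samplePoint (fun i => min (q i) 1) c i ∈ s i
    · rw [Set.indicator_of_mem (by simpa using h)]
      symm
      refine Finset.prod_eq_one fun i _ => ?_
      exact Set.indicator_of_mem (h i) _
    · rw [Set.indicator_of_notMem (by simpa using h)]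
      obtain ⟨i, hi⟩ := not_forall.1 h
      symm
      refine Finset.prod_eq_zero (Finset.mem_univ i) ?_
      exact Set.indicator_of_notMem hi _
  · intro i _
    have := hq i
    split_ifs
    · exact le_min this.le zero_le_one
    · simp

lemma map_cubeLaw {Z : Type*} [MeasurableSpace Z] (p : Fin m → ℝ) (y : (Fin m → Bool) → Y)
    {F : Y → Z} (hF : Measurable F) : (cubeLaw p y).map F = cubeLaw p (fun c => F (y c)) := by
  rw [cubeLaw, Measure.map_finset_sum hF.aemeasurable]
  refine Finset.sum_congr rfl fun c _ => ?_
  rw [Measure.map_smul, Measure.map_dirac' hF]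

end Law

/-! ### Weighted and mixed norms -/

section Norms

variable {m : ℕ}

/-- The weighted Euclidean norm `(∑ i, t_i v_i²)^(1/2)`. -/
noncomputable def wNorm (t v : Fin m → ℝ) : ℝ := √(∑ i, t i * v i ^ 2)

lemma wNorm_nonneg (t v : Fin m → ℝ) : 0 ≤ wNorm t v := Real.sqrt_nonneg _

lemma wNorm_sq {t : Fin m → ℝ} (ht : ∀ i, 0 ≤ t i) (v : Fin m → ℝ) :
    wNorm t v ^ 2 = ∑ i, t i * v i ^ 2 :=
  Real.sq_sqrt (Finset.sum_nonneg fun i _ => mul_nonneg (ht i) (sq_nonneg _))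

lemma wNorm_eq_norm {t : Fin m → ℝ} (ht : ∀ i, 0 ≤ t i) (v : Fin m → ℝ) :
    wNorm t v = ‖WithLp.toLp 2 (fun i => √(t i) * v i)‖ := by
  rw [wNorm, EuclideanSpace.norm_eq]
  congr 1
  refine Finset.sum_congr rfl fun i _ => ?_
  rw [Real.norm_eq_abs, sq_abs, mul_pow, Real.sq_sqrt (ht i)]

lemma wNorm_add_le {t : Fin m → ℝ} (ht : ∀ i, 0 ≤ t i) (u v : Fin m → ℝ) :
    wNorm t (u + v) ≤ wNorm t u + wNorm t v := by
  rw [wNorm_eq_norm ht, wNorm_eq_norm ht, wNorm_eq_norm ht]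
  refine le_trans (le_of_eq ?_) (norm_add_le _ _)
  congr 1
  ext i
  simp [mul_add]

lemma wNorm_smul {t : Fin m → ℝ} (a : ℝ) (v : Fin m → ℝ) :
    wNorm t (a • v) = |a| * wNorm t v := by
  rw [wNorm, wNorm, ← Real.sqrt_sq_eq_abs, ← Real.sqrt_mul (sq_nonneg a), Finset.mul_sum]
  congr 1
  refine Finset.sum_congr rfl fun i _ => ?_
  simp only [Pi.smul_apply, smul_eq_mul]; ring

lemma wNorm_mono {t u v : Fin m → ℝ} (ht : ∀ i, 0 ≤ t i) (h : ∀ i, |u i| ≤ |v i|) :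
    wNorm t u ≤ wNorm t v :=
  Real.sqrt_le_sqrt (Finset.sum_le_sum fun i _ =>
    mul_le_mul_of_nonneg_left (sq_le_sq.2 (h i)) (ht i))

lemma wNorm_le_of_weight_le {t t' : Fin m → ℝ} {K : ℝ} (hK : 0 ≤ K)
    (h : ∀ i, t i ≤ K ^ 2 * t' i) (v : Fin m → ℝ) : wNorm t v ≤ K * wNorm t' v := by
  rw [wNorm, wNorm, ← Real.sqrt_sq hK, ← Real.sqrt_mul (sq_nonneg _)]
  refine Real.sqrt_le_sqrt ?_
  rw [Finset.mul_sum]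
  refine Finset.sum_le_sum fun i _ => ?_
  rw [← mul_assoc]
  exact mul_le_mul_of_nonneg_right (h i) (sq_nonneg _)

lemma abs_apply_le_norm (v : Fin m → ℝ) (i : Fin m) : |v i| ≤ ‖v‖ := norm_le_pi_norm v i

lemma pi_norm_le {v : Fin m → ℝ} {a : ℝ} (ha : 0 ≤ a) (h : ∀ i, |v i| ≤ a) : ‖v‖ ≤ a :=
  (pi_norm_le_iff_of_nonneg ha).2 h

lemma mixedNorm_eq (α : ℝ) (t v : Fin m → ℝ) :
    mixedNorm α t v = ‖v‖ + 10 / α * wNorm t v := rfl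

variable {α : ℝ} {t : Fin m → ℝ}

lemma mixedNorm_nonneg (hα : 0 < α) (v : Fin m → ℝ) : 0 ≤ mixedNorm α t v := by
  have := wNorm_nonneg t v
  rw [mixedNorm_eq]; positivity

lemma norm_le_mixedNorm (hα : 0 < α) (v : Fin m → ℝ) : ‖v‖ ≤ mixedNorm α t v := by
  have := wNorm_nonneg t v
  rw [mixedNorm_eq]
  exact le_add_of_nonneg_right (by positivity)

lemma mixedNorm_add_le (hα : 0 < α) (ht : ∀ i, 0 ≤ t i) (u v : Fin m → ℝ) :
    mixedNorm α t (u + v) ≤ mixedNorm α t u + mixedNorm α t v := by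
  simp only [mixedNorm_eq]
  have h1 := norm_add_le u v
  have h2 := mul_le_mul_of_nonneg_left (wNorm_add_le ht u v) (show 0 ≤ 10 / α by positivity)
  linarith

lemma mixedNorm_smul (a : ℝ) (v : Fin m → ℝ) :
    mixedNorm α t (a • v) = |a| * mixedNorm α t v := by
  rw [mixedNorm_eq, mixedNorm_eq, norm_smul, wNorm_smul, Real.norm_eq_abs]; ring

lemma mixedNorm_mono (hα : 0 < α) (ht : ∀ i, 0 ≤ t i) {u v : Fin m → ℝ}
    (h : ∀ i, |u i| ≤ |v i|) : mixedNorm α t u ≤ mixedNorm α t v := by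
  simp only [mixedNorm_eq]
  have h1 : ‖u‖ ≤ ‖v‖ := pi_norm_le (norm_nonneg v) fun i => (h i).trans (abs_apply_le_norm v i)
  have h2 := mul_le_mul_of_nonneg_left (wNorm_mono ht h) (show 0 ≤ 10 / α by positivity)
  linarith

lemma mixedNorm_mul_le (hα : 0 < α) (ht : ∀ i, 0 ≤ t i) (u v : Fin m → ℝ) :
    mixedNorm α t (u * v) ≤ ‖u‖ * mixedNorm α t v := by
  have h := mixedNorm_smul (α := α) (t := t) ‖u‖ v
  rw [abs_of_nonneg (norm_nonneg _)] at h
  rw [← h]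
  refine mixedNorm_mono hα ht fun i => ?_
  rw [Pi.mul_apply, abs_mul, Pi.smul_apply, smul_eq_mul, abs_mul, abs_of_nonneg (norm_nonneg u)]
  exact mul_le_mul_of_nonneg_right (abs_apply_le_norm u i) (abs_nonneg _)

/-- By homogeneity, maximality on the unit sphere is the dual norm inequality, so `h ⬝ᵥ f` plays the
role of the dual norm of `h`. -/
lemma IsDualVector.dotProduct_le (hα : 0 < α) {h f : Fin m → ℝ} (hf : IsDualVector α t h f)
    (v : Fin m → ℝ) : h ⬝ᵥ v ≤ (h ⬝ᵥ f) * mixedNorm α t v := by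
  rcases eq_or_ne v 0 with rfl | hv
  · simp [mixedNorm_eq, wNorm]
  have hpos : 0 < mixedNorm α t v := (norm_pos_iff.2 hv).trans_le (norm_le_mixedNorm hα v)
  have := hf.2 ((mixedNorm α t v)⁻¹ • v) (by
    rw [mixedNorm_smul, abs_of_pos (inv_pos.2 hpos), inv_mul_cancel₀ hpos.ne'])
  rw [dotProduct_smul, smul_eq_mul, inv_mul_le_iff₀ hpos] at this
  linarith

lemma IsDualVector.dotProduct_nonneg {h f : Fin m → ℝ}
    (hf : IsDualVector α t h f) : 0 ≤ h ⬝ᵥ f := by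
  have := hf.2 (-f) (by
    have := mixedNorm_smul (α := α) (t := t) (-1) f
    rw [neg_one_smul] at this
    rw [this, hf.1]; norm_num)
  rw [dotProduct_neg] at this
  linarith

/-- The mixed norm depends on absolute values only, so `v` may be given the signs of `h` at no cost.
This form absorbs the second order errors, which carry |f| rather than f. -/
lemma IsDualVector.sum_abs_mul_le (hα : 0 < α) (ht : ∀ i, 0 ≤ t i) {h f : Fin m → ℝ}
    (hf : IsDualVector α t h f) (v : Fin m → ℝ) :
    ∑ i, |h i| * |v i| ≤ (h ⬝ᵥ f) * mixedNorm α t v := by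
  have h1 := hf.dotProduct_le hα (fun i => SignType.sign (h i) * |v i|)
  have h2 : h ⬝ᵥ (fun i => (SignType.sign (h i) : ℝ) * |v i|) = ∑ i, |h i| * |v i| :=
    Finset.sum_congr rfl fun i _ => by
      rw [← mul_assoc, mul_comm (h i), sign_mul_self]
  rw [h2] at h1
  refine h1.trans (mul_le_mul_of_nonneg_left (mixedNorm_mono hα ht fun i => ?_)
    hf.dotProduct_nonneg)
  rw [abs_mul, abs_abs]
  refine mul_le_of_le_one_left (abs_nonneg _) ?_
  rcases lt_trichotomy (h i) 0 with h | h | h <;> simp [h]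

end Norms

/-! ### The derivative of leverage scores, relative to weights -/

section Operators

variable {m : ℕ}

/-- The operator `T⁻¹ (Σ - P⁽²⁾)`. -/
noncomputable def opL (P : Matrix (Fin m) (Fin m) ℝ) (τ u : Fin m → ℝ) (i : Fin m) : ℝ :=
  (P i i * u i - ∑ j, P i j ^ 2 * u j) / τ i

/-- The operator `T⁻¹ (Σ + P⁽²⁾)`. -/
noncomputable def opB (P : Matrix (Fin m) (Fin m) ℝ) (τ u : Fin m → ℝ) (i : Fin m) : ℝ :=
  (P i i * u i + ∑ j, P i j ^ 2 * u j) / τ i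

/-- An orthogonal projection whose diagonal is dominated by positive weights `τ`. -/
structure ProjWeights (P : Matrix (Fin m) (Fin m) ℝ) (τ : Fin m → ℝ) : Prop where
  symm : Pᵀ = P
  idem : P * P = P
  pos : ∀ i, 0 < τ i
  le : ∀ i, P i i ≤ τ i

variable {P : Matrix (Fin m) (Fin m) ℝ} {τ : Fin m → ℝ}

/-- The Laplacian `Σ - P⁽²⁾`. -/
noncomputable def projLap (P : Matrix (Fin m) (Fin m) ℝ) : Matrix (Fin m) (Fin m) ℝ :=
  diagonal (fun i => P i i) - P ⊙ P

lemma projLap_mulVec (P : Matrix (Fin m) (Fin m) ℝ) (u : Fin m → ℝ) (i : Fin m) :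
    (projLap P *ᵥ u) i = P i i * u i - ∑ j, P i j ^ 2 * u j := by
  rw [projLap, sub_mulVec, Pi.sub_apply, mulVec_diagonal]
  simp [mulVec, dotProduct, sq]

namespace ProjWeights

lemma apply_comm (h : ProjWeights P τ) (i j : Fin m) : P i j = P j i :=
  congrFun (congrFun h.symm j) i

lemma diag_nonneg (h : ProjWeights P τ) (i : Fin m) : 0 ≤ P i i :=
  proj_diag_nonneg h.symm h.idem i

lemma sum_sq (h : ProjWeights P τ) (i : Fin m) : ∑ j, P i j ^ 2 = P i i :=
  sum_sq_eq_diag h.symm h.idem i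

/-- The rows of P⁽²⁾ sum to the diagonal of P, so Σ - P⁽²⁾ is a weighted graph Laplacian. -/
lemma form_eq (h : ProjWeights P τ) (u : Fin m → ℝ) :
    u ⬝ᵥ projLap P *ᵥ u = (∑ i, ∑ j, P i j ^ 2 * (u i - u j) ^ 2) / 2 := by
  have e1 : u ⬝ᵥ projLap P *ᵥ u = ∑ i, (P i i * u i ^ 2 - ∑ j, P i j ^ 2 * (u i * u j)) := by
    refine Finset.sum_congr rfl fun i _ => ?_
    rw [projLap_mulVec, mul_sub, Finset.mul_sum]
    congr 1
    · ring
    · exact Finset.sum_congr rfl fun j _ => by ring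
  have e2 : ∑ i, ∑ j, P i j ^ 2 * (u i - u j) ^ 2 = ∑ i, (P i i * u i ^ 2)
      + ∑ i, P i i * u i ^ 2 - 2 * ∑ i, ∑ j, P i j ^ 2 * (u i * u j) := by
    have s1 : ∑ i, P i i * u i ^ 2 = ∑ i, ∑ j, P i j ^ 2 * u i ^ 2 :=
      Finset.sum_congr rfl fun i _ => by rw [← h.sum_sq i, Finset.sum_mul]
    have s2 : ∑ i, P i i * u i ^ 2 = ∑ i, ∑ j, P i j ^ 2 * u j ^ 2 := by
      rw [s1, Finset.sum_comm]
      exact Finset.sum_congr rfl fun i _ => Finset.sum_congr rfl fun j _ => by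
        rw [h.apply_comm i j]
    conv_rhs => rw [s2]
    rw [← s2]
    nth_rw 1 [s1]
    rw [s2, Finset.mul_sum, ← Finset.sum_add_distrib, ← Finset.sum_sub_distrib]
    refine Finset.sum_congr rfl fun i _ => ?_
    rw [Finset.mul_sum, ← Finset.sum_add_distrib, ← Finset.sum_sub_distrib]
    exact Finset.sum_congr rfl fun j _ => by ring
  rw [e1, e2, Finset.sum_sub_distrib]; ring

lemma projLap_posSemidef (h : ProjWeights P τ) : (projLap P).PosSemidef := by
  refine PosSemidef.of_dotProduct_mulVec_nonneg ?_ fun u => ?_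
  · rw [Matrix.IsHermitian, conjTranspose_eq_transpose_of_trivial, projLap, transpose_sub,
      diagonal_transpose, transpose_hadamard, h.symm]
  · rw [star_trivial, h.form_eq]
    exact div_nonneg (Finset.sum_nonneg fun i _ => Finset.sum_nonneg fun j _ => by positivity)
      (by norm_num)

/-- The Schur product theorem makes P ⊙ P positive semidefinite, so dropping it only increases the
form. -/
lemma form_le (h : ProjWeights P τ) (u : Fin m → ℝ) :
    u ⬝ᵥ projLap P *ᵥ u ≤ ∑ i, τ i * u i ^ 2 := by
  have hPsd : P.PosSemidef := by
    have := Matrix.posSemidef_conjTranspose_mul_self P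
    rwa [conjTranspose_eq_transpose_of_trivial, h.symm, h.idem] at this
  have h1 := posSemidef_form_nonneg (hPsd.hadamard hPsd) u
  rw [projLap, sub_mulVec, dotProduct_sub]
  have h2 : u ⬝ᵥ (diagonal fun i => P i i) *ᵥ u ≤ ∑ i, τ i * u i ^ 2 := by
    refine Finset.sum_le_sum fun i _ => ?_
    rw [mulVec_diagonal]
    nlinarith [h.le i, sq_nonneg (u i)]
  linarith

lemma opL_eq (h : ProjWeights P τ) (u : Fin m → ℝ) (i : Fin m) :
    τ i * opL P τ u i = (projLap P *ᵥ u) i := by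
  rw [projLap_mulVec, opL, mul_div_cancel₀ _ (h.pos i).ne']

/-- In the τ-inner product `opL` is self-adjoint with spectrum in [0,1], hence L² ≤ L. The proof is
Cauchy-Schwarz for the Laplacian form between `opL P τ u` and `u`. -/
lemma wNorm_opL_sq_le (h : ProjWeights P τ) (u : Fin m → ℝ) :
    ∑ i, τ i * opL P τ u i ^ 2 ≤ u ⬝ᵥ projLap P *ᵥ u := by
  set w := opL P τ u with hw
  have e : ∑ i, τ i * w i ^ 2 = w ⬝ᵥ projLap P *ᵥ u :=
    Finset.sum_congr rfl fun i _ => by rw [← h.opL_eq]; ring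
  have h1 := form_sq_le h.projLap_posSemidef w u
  have h2 := h.form_le w
  have h3 := posSemidef_form_nonneg h.projLap_posSemidef u
  have h4 : 0 ≤ ∑ i, τ i * w i ^ 2 :=
    Finset.sum_nonneg fun i _ => mul_nonneg (h.pos i).le (sq_nonneg _)
  rw [← e] at h1
  by_contra! hc
  have h5 : 0 < ∑ i, τ i * w i ^ 2 := h3.trans_lt hc
  nlinarith [mul_le_mul_of_nonneg_right h2 h3]

/-- The operator norm of `a - b T⁻¹ (Σ - P⁽²⁾)` in the weighted Euclidean norm. -/
lemma wNorm_sub_opL_le (h : ProjWeights P τ) {a b K : ℝ} (hK : 0 ≤ K)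
    (hK1 : a ^ 2 ≤ K ^ 2) (hK2 : (a - b) ^ 2 ≤ K ^ 2) (u : Fin m → ℝ) :
    wNorm τ (a • u - b • opL P τ u) ≤ K * wNorm τ u := by
  have hτ := fun i => (h.pos i).le
  refine abs_le_of_sq_le_sq' ?_ (mul_nonneg hK (wNorm_nonneg _ _)) |>.2
  rw [mul_pow, wNorm_sq hτ, wNorm_sq hτ]
  have e : ∑ i, τ i * (a • u - b • opL P τ u) i ^ 2 = a ^ 2 * ∑ i, τ i * u i ^ 2
      - 2 * a * b * (u ⬝ᵥ projLap P *ᵥ u) + b ^ 2 * ∑ i, τ i * opL P τ u i ^ 2 := by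
    rw [dotProduct, Finset.mul_sum, Finset.mul_sum, Finset.mul_sum, ← Finset.sum_sub_distrib,
      ← Finset.sum_add_distrib]
    refine Finset.sum_congr rfl fun i _ => ?_
    rw [← h.opL_eq]
    simp only [Pi.sub_apply, Pi.smul_apply, smul_eq_mul]; ring
  rw [e]
  have h1 := h.wNorm_opL_sq_le u
  have h2 := h.form_le u
  have h3 := posSemidef_form_nonneg h.projLap_posSemidef u
  set q := u ⬝ᵥ projLap P *ᵥ u
  set s := ∑ i, τ i * u i ^ 2
  set l := ∑ i, τ i * opL P τ u i ^ 2
  -- With L² ≤ L, the square of a - bL is at most a²(1 - L) + (a - b)²L, a combination of the values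
  -- at the two ends of the spectrum.
  have h4 : b ^ 2 * l ≤ b ^ 2 * q := mul_le_mul_of_nonneg_left h1 (sq_nonneg _)
  nlinarith [mul_le_mul_of_nonneg_right hK1 (sub_nonneg.2 h2), mul_le_mul_of_nonneg_right hK2 h3]

lemma wNorm_opL_le (h : ProjWeights P τ) (u : Fin m → ℝ) :
    wNorm τ (opL P τ u) ≤ wNorm τ u := by
  have := h.wNorm_sub_opL_le (a := 0) (b := 1) (K := 1) (by norm_num) (by norm_num)
    (by norm_num) u
  have e : (0 : ℝ) • u - (1 : ℝ) • opL P τ u = (-1 : ℝ) • opL P τ u := by simp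
  rw [e, wNorm_smul] at this
  simpa using this

lemma sq_le_mul_diag (h : ProjWeights P τ) (i j : Fin m) : P i j ^ 2 ≤ P i i * P j j := by
  have e : P i j = ∑ k, P i k * P j k := by
    conv_lhs => rw [← h.idem, Matrix.mul_apply]
    exact Finset.sum_congr rfl fun k _ => by rw [h.apply_comm k j]
  rw [e, ← h.sum_sq i, ← h.sum_sq j]
  exact Finset.sum_mul_sq_le_sq_mul_sq _ _ _

lemma sum_sq_mul_sq_le (h : ProjWeights P τ) (u : Fin m → ℝ) (i : Fin m) :
    (∑ j, P i j ^ 2 * u j) ^ 2 ≤ P i i * ∑ j, P i j ^ 2 * u j ^ 2 := by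
  have := Finset.sum_mul_sq_le_sq_mul_sq Finset.univ (fun j => P i j) (fun j => P i j * u j)
  rw [h.sum_sq i] at this
  refine le_trans (le_of_eq ?_) (this.trans (le_of_eq ?_))
  · congr 1; exact Finset.sum_congr rfl fun j _ => by ring
  · congr 1; exact Finset.sum_congr rfl fun j _ => by ring

/-- Cauchy-Schwarz in each row, then P_ij² ≤ P_ii P_jj ≤ P_ii τ_j. Here the Euclidean norm controls
a sup norm without any loss in the dimension. -/
lemma abs_sum_sq_mul_le (h : ProjWeights P τ) (u : Fin m → ℝ) (i : Fin m) :
    |∑ j, P i j ^ 2 * u j| ≤ P i i * wNorm τ u := by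
  have h0 := h.diag_nonneg i
  refine abs_le_of_sq_le_sq ?_ (mul_nonneg h0 (wNorm_nonneg _ _))
  rw [mul_pow, wNorm_sq fun i => (h.pos i).le]
  refine (h.sum_sq_mul_sq_le u i).trans ?_
  rw [sq, mul_assoc]
  refine mul_le_mul_of_nonneg_left ?_ h0
  rw [Finset.mul_sum]
  refine Finset.sum_le_sum fun j _ => ?_
  have h1 := h.sq_le_mul_diag i j
  have h2 := h.le j
  rw [← mul_assoc]
  refine mul_le_mul_of_nonneg_right (h1.trans (mul_le_mul_of_nonneg_left h2 h0)) (sq_nonneg _)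

lemma diag_div_le_one (h : ProjWeights P τ) (i : Fin m) : P i i / τ i ≤ 1 :=
  (div_le_one (h.pos i)).2 (h.le i)

lemma diag_div_nonneg (h : ProjWeights P τ) (i : Fin m) : 0 ≤ P i i / τ i :=
  div_nonneg (h.diag_nonneg i) (h.pos i).le

/-- The diagonal of `opL` multiplies by a ratio in [0,1], so the diagonal multiplier lies between
`a` and `a - b`. The off-diagonal part costs only the weighted Euclidean norm. -/
lemma abs_sub_opL_le (h : ProjWeights P τ) {a b K : ℝ} (hb : 0 ≤ b) (hK1 : |a| ≤ K)
    (hK2 : |a - b| ≤ K) (u : Fin m → ℝ) (i : Fin m) :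
    |a * u i - b * opL P τ u i| ≤ K * |u i| + b * wNorm τ u := by
  have h1 := h.abs_sum_sq_mul_le u i
  have h0 := h.diag_div_nonneg i
  have h2 := h.diag_div_le_one i
  have e : a * u i - b * opL P τ u i
      = (a - b * (P i i / τ i)) * u i + b * ((∑ j, P i j ^ 2 * u j) / τ i) := by
    rw [opL]; ring
  rw [e]
  refine (abs_add_le _ _).trans (add_le_add ?_ ?_)
  · rw [abs_mul]
    refine mul_le_mul_of_nonneg_right ?_ (abs_nonneg _)
    have a1 := abs_le.1 hK1
    have a2 := abs_le.1 hK2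
    rw [abs_le]
    constructor <;> nlinarith
  · rw [abs_mul, abs_of_nonneg hb]
    refine mul_le_mul_of_nonneg_left ?_ hb
    rw [abs_div, abs_of_pos (h.pos i), div_le_iff₀ (h.pos i)]
    calc _ ≤ P i i * wNorm τ u := h1
      _ ≤ τ i * wNorm τ u := mul_le_mul_of_nonneg_right (h.le i) (wNorm_nonneg _ _)
      _ = _ := mul_comm _ _

lemma opB_mono (h : ProjWeights P τ) {u v : Fin m → ℝ} (huv : ∀ i, u i ≤ v i) (i : Fin m) :
    opB P τ u i ≤ opB P τ v i := by
  refine div_le_div_of_nonneg_right (add_le_add ?_ (Finset.sum_le_sum fun j _ => ?_)) (h.pos i).le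
  · exact mul_le_mul_of_nonneg_left (huv i) (h.diag_nonneg i)
  · exact mul_le_mul_of_nonneg_left (huv j) (sq_nonneg _)

lemma opB_nonneg (h : ProjWeights P τ) {u : Fin m → ℝ} (hu : ∀ i, 0 ≤ u i) (i : Fin m) :
    0 ≤ opB P τ u i := by
  refine div_nonneg (add_nonneg ?_ (Finset.sum_nonneg fun j _ => ?_)) (h.pos i).le
  · exact mul_nonneg (h.diag_nonneg i) (hu i)
  · exact mul_nonneg (sq_nonneg _) (hu j)

lemma opB_const_le (h : ProjWeights P τ) {a : ℝ} (ha : 0 ≤ a) (i : Fin m) :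
    opB P τ (fun _ => a) i ≤ 2 * a := by
  rw [opB, ← Finset.sum_mul, h.sum_sq, div_le_iff₀ (h.pos i)]
  nlinarith [h.le i]

lemma opB_le (h : ProjWeights P τ) {u : Fin m → ℝ} {a : ℝ} (ha : 0 ≤ a) (hu : ∀ i, u i ≤ a)
    (i : Fin m) : opB P τ u i ≤ 2 * a :=
  (h.opB_mono hu i).trans (h.opB_const_le ha i)

/-- Cauchy-Schwarz for a positive operator with row mass at most 2. It replaces the square of a
first order effect by a linear operator on squares, which an expectation can pass through. -/
lemma opB_sq_le (h : ProjWeights P τ) (u : Fin m → ℝ) (i : Fin m) :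
    opB P τ u i ^ 2 ≤ 2 * opB P τ (fun j => u j ^ 2) i := by
  have hp := h.pos i
  have h0 := h.diag_nonneg i
  have hle := h.le i
  have h1 := h.sum_sq_mul_sq_le u i
  rw [opB, opB, div_pow, ← mul_div_assoc, div_le_div_iff₀ (by positivity) hp]
  have hq : 0 ≤ ∑ j, P i j ^ 2 * u j ^ 2 := Finset.sum_nonneg fun j _ => by positivity
  set q := ∑ j, P i j ^ 2 * u j ^ 2
  set a := ∑ j, P i j ^ 2 * u j
  have h2 : (P i i * u i + a) ^ 2 ≤ 2 * (P i i * (P i i * u i ^ 2 + q)) := by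
    nlinarith [sq_nonneg (P i i * u i - a)]
  have h3 : P i i * (P i i * u i ^ 2 + q) ≤ τ i * (P i i * u i ^ 2 + q) :=
    mul_le_mul_of_nonneg_right hle (by positivity)
  nlinarith

lemma abs_opL_le_opB (h : ProjWeights P τ) {u v : Fin m → ℝ} (huv : ∀ i, |u i| ≤ v i)
    (i : Fin m) : |opL P τ u i| ≤ opB P τ v i := by
  rw [opL, abs_div, abs_of_pos (h.pos i), opB]
  refine div_le_div_of_nonneg_right ?_ (h.pos i).le
  refine (abs_sub _ _).trans (add_le_add ?_ ((Finset.abs_sum_le_sum_abs _ _).trans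
    (Finset.sum_le_sum fun j _ => ?_)))
  · rw [abs_mul, abs_of_nonneg (h.diag_nonneg i)]
    exact mul_le_mul_of_nonneg_left (huv i) (h.diag_nonneg i)
  · rw [abs_mul, abs_of_nonneg (sq_nonneg (P i j))]
    exact mul_le_mul_of_nonneg_left (huv j) (sq_nonneg _)

lemma opL_sub (u v : Fin m → ℝ) (i : Fin m) :
    opL P τ (u - v) i = opL P τ u i - opL P τ v i := by
  simp only [opL, Pi.sub_apply, mul_sub, Finset.sum_sub_distrib]; ring

lemma opL_add (u v : Fin m → ℝ) : opL P τ (u + v) = opL P τ u + opL P τ v := by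
  ext i
  simp only [opL, Pi.add_apply, mul_add, Finset.sum_add_distrib]; ring

lemma opL_smul (a : ℝ) (u : Fin m → ℝ) : opL P τ (a • u) = a • opL P τ u := by
  ext i
  simp only [opL, Pi.smul_apply, smul_eq_mul, mul_left_comm _ a, ← Finset.mul_sum]; ring

lemma opB_smul (a : ℝ) (u : Fin m → ℝ) : opB P τ (a • u) = a • opB P τ u := by
  ext i
  simp only [opB, Pi.smul_apply, smul_eq_mul, mul_left_comm _ a, ← Finset.mul_sum]; ring

lemma wNorm_opB_le (h : ProjWeights P τ) (u : Fin m → ℝ) :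
    wNorm τ (opB P τ u) ≤ 2 * wNorm τ u := by
  have hτ := fun i => (h.pos i).le
  refine abs_le_of_sq_le_sq' ?_ (mul_nonneg (by norm_num) (wNorm_nonneg _ _)) |>.2
  rw [mul_pow, wNorm_sq hτ, wNorm_sq hτ]
  have h1 : ∑ i, τ i * opB P τ u i ^ 2 ≤
      ∑ i, 2 * (P i i * u i ^ 2 + ∑ j, P i j ^ 2 * u j ^ 2) := by
    refine Finset.sum_le_sum fun i _ => ?_
    have h2 := mul_le_mul_of_nonneg_left (h.opB_sq_le u i) (hτ i)
    refine h2.trans (le_of_eq ?_)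
    rw [opB]
    have := (h.pos i).ne'
    field_simp
  have h3 : ∑ i, ∑ j, P i j ^ 2 * u j ^ 2 = ∑ j, P j j * u j ^ 2 := by
    rw [Finset.sum_comm]
    refine Finset.sum_congr rfl fun j _ => ?_
    rw [← h.sum_sq j, Finset.sum_mul]
    exact Finset.sum_congr rfl fun i _ => by rw [h.apply_comm i j]
  have h4 : ∑ j, P j j * u j ^ 2 ≤ ∑ j, τ j * u j ^ 2 :=
    Finset.sum_le_sum fun j _ => mul_le_mul_of_nonneg_right (h.le j) (sq_nonneg _)
  rw [← Finset.mul_sum, Finset.sum_add_distrib, h3] at h1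
  linarith

lemma norm_opB_le (h : ProjWeights P τ) (u : Fin m → ℝ) : ‖opB P τ u‖ ≤ 2 * ‖u‖ := by
  refine pi_norm_le (by positivity) fun i => ?_
  have h1 := h.opB_le (norm_nonneg u) (fun j => (le_abs_self _).trans (abs_apply_le_norm u j)) i
  have h2 := h.opB_le (u := -u) (norm_nonneg u)
    (fun j => (neg_le_abs _).trans (abs_apply_le_norm u j)) i
  have e : opB P τ (-u) i = - opB P τ u i := by
    simp only [opB, Pi.neg_apply, mul_neg, Finset.sum_neg_distrib]; ring
  rw [e] at h2
  exact abs_le.2 ⟨by linarith, h1⟩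

lemma norm_opL_le (h : ProjWeights P τ) (u : Fin m → ℝ) :
    ‖opL P τ u‖ ≤ ‖u‖ + wNorm τ u := by
  have := wNorm_nonneg τ u
  refine pi_norm_le (by positivity) fun i => ?_
  have h1 := h.abs_sub_opL_le (a := 0) (b := 1) (K := 1) (by norm_num) (by norm_num) (by norm_num)
    u i
  have h2 := abs_apply_le_norm u i
  simp only [zero_mul, zero_sub, one_mul, abs_neg] at h1
  linarith

end ProjWeights

end Operators

/-! ### Scalar expansions -/

section Scalar

lemma abs_log_one_add_sub_le {x : ℝ} (hx : |x| ≤ 1 / 100) :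
    |Real.log (1 + x) - x| ≤ 102 / 100 * x ^ 2 := by
  have h := abs_le.1 hx
  have hp : 0 < 1 + x := by linarith
  have h1 := Real.log_le_sub_one_of_pos hp
  have h2 := Real.one_sub_inv_le_log_of_pos hp
  have h3 : x - 102 / 100 * x ^ 2 ≤ 1 - (1 + x)⁻¹ := by
    have e : 1 - (1 + x)⁻¹ = x / (1 + x) := by field_simp; ring
    rw [e, le_div_iff₀ hp]
    nlinarith [sq_nonneg x, mul_nonneg (sq_nonneg x) (show 0 ≤ x + 1 / 100 by linarith)]
  rw [abs_le]
  constructor <;> nlinarith [sq_nonneg x]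

lemma abs_exp_sub_one_sub_le {x : ℝ} (hx : |x| ≤ 1) : |Real.exp x - 1 - x| ≤ x ^ 2 :=
  Real.abs_exp_sub_one_sub_id_le hx

/-- Expansion of the relative change of the squared row scaling. -/
lemma abs_rpow_mul_rpow_sub_le {α ξ ζ : ℝ} (hα : 0 < α) (hα' : α ≤ 1 / 5) (hξ : |ξ| ≤ 1 / 100)
    (hζ : |ζ| ≤ 1 / 100) :
    |(1 + ξ) ^ (1 - 2 * α) * (1 + ζ) ^ (-1 - 2 * α) - 1 - ((1 - 2 * α) * ξ - (1 + 2 * α) * ζ)| ≤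
      6 * (ξ ^ 2 + ζ ^ 2) := by
  have h1 := abs_le.1 hξ
  have h2 := abs_le.1 hζ
  have hp1 : 0 < 1 + ξ := by linarith
  have hp2 : 0 < 1 + ζ := by linarith
  rw [Real.rpow_def_of_pos hp1, Real.rpow_def_of_pos hp2, ← Real.exp_add]
  have l1 := abs_log_one_add_sub_le hξ
  have l2 := abs_log_one_add_sub_le hζ
  set a := Real.log (1 + ξ)
  set b := Real.log (1 + ζ)
  have la : |a| ≤ 103 / 100 * |ξ| := by
    have e : a = (a - ξ) + ξ := by ring
    have : ξ ^ 2 ≤ 1 / 100 * |ξ| := by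
      rw [← sq_abs, sq]; exact mul_le_mul_of_nonneg_right hξ (abs_nonneg _)
    have h3 := abs_add_le (a - ξ) ξ
    rw [← e] at h3
    have := abs_nonneg ξ
    linarith
  have lb : |b| ≤ 103 / 100 * |ζ| := by
    have e : b = (b - ζ) + ζ := by ring
    have : ζ ^ 2 ≤ 1 / 100 * |ζ| := by
      rw [← sq_abs, sq]; exact mul_le_mul_of_nonneg_right hζ (abs_nonneg _)
    have h3 := abs_add_le (b - ζ) ζ
    rw [← e] at h3
    have := abs_nonneg ζ
    linarith
  set t := a * (1 - 2 * α) + b * (-1 - 2 * α) with ht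
  have lt : |t| ≤ 103 / 100 * |ξ| + 145 / 100 * |ζ| := by
    have h3 := abs_add_le (a * (1 - 2 * α)) (b * (-1 - 2 * α))
    rw [abs_mul, abs_mul, abs_of_pos (show 0 < 1 - 2 * α by linarith),
      abs_of_neg (show -1 - 2 * α < 0 by linarith)] at h3
    have h4 : |a| * (1 - 2 * α) ≤ |a| * 1 :=
      mul_le_mul_of_nonneg_left (by linarith) (abs_nonneg _)
    have h5 : |b| * -(-1 - 2 * α) ≤ |b| * (7 / 5) :=
      mul_le_mul_of_nonneg_left (by linarith) (abs_nonneg _)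
    have := abs_nonneg ζ
    linarith
  have lt1 : |t| ≤ 1 := by linarith
  have ht2 : t ^ 2 ≤ 43 / 10 * (ξ ^ 2 + ζ ^ 2) := by
    rw [← sq_abs t, ← sq_abs ξ, ← sq_abs ζ]
    have := abs_nonneg t
    have := abs_nonneg ξ
    have := abs_nonneg ζ
    have h6 : |t| ^ 2 ≤ (103 / 100 * |ξ| + 145 / 100 * |ζ|) ^ 2 := by gcongr
    nlinarith [sq_nonneg (|ξ| - |ζ|), sq_nonneg |ξ|, sq_nonneg |ζ|]
  have h7 := abs_exp_sub_one_sub_le lt1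
  have e : Real.exp t - 1 - ((1 - 2 * α) * ξ - (1 + 2 * α) * ζ) = (Real.exp t - 1 - t)
      + ((1 - 2 * α) * (a - ξ) + (-1 - 2 * α) * (b - ζ)) := by rw [ht]; ring
  have h8 : |(1 - 2 * α) * (a - ξ) + (-1 - 2 * α) * (b - ζ)|
      ≤ 102 / 100 * ξ ^ 2 + 7 / 5 * (102 / 100 * ζ ^ 2) := by
    refine (abs_add_le _ _).trans (add_le_add ?_ ?_)
    · rw [abs_mul, abs_of_pos (show 0 < 1 - 2 * α by linarith)]
      nlinarith [abs_nonneg (a - ξ)]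
    · rw [abs_mul, abs_of_neg (show -1 - 2 * α < 0 by linarith)]
      exact mul_le_mul (by linarith) l2 (abs_nonneg _) (by norm_num)
  rw [e]
  refine (abs_add_le _ _).trans ?_
  nlinarith [sq_nonneg ξ, sq_nonneg ζ]

lemma ratio_expansion {ξ ζ θ ρ : ℝ} (hξ : |ξ| ≤ 1 / 100) (hζ : |ζ| ≤ 1 / 100)
    (hθ : |θ| ≤ 1 / 100) (hρ : |ρ| ≤ 1 / 100) :
    |(1 + ξ) * (1 + ζ) / ((1 + ρ) * (1 + θ)) - 1 - (ξ + ζ - θ - ρ)| ≤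
      8 * (ξ ^ 2 + ζ ^ 2 + θ ^ 2 + ρ ^ 2) := by
  have a1 := abs_le.1 hξ
  have a2 := abs_le.1 hζ
  have a3 := abs_le.1 hθ
  have a4 := abs_le.1 hρ
  have hd : 1 / 2 < (1 + ρ) * (1 + θ) := by nlinarith
  have hd0 : 0 < (1 + ρ) * (1 + θ) := by linarith
  -- The error has an exact formula whose numerator contains no first order term.
  have e : (1 + ξ) * (1 + ζ) / ((1 + ρ) * (1 + θ)) - 1 - (ξ + ζ - θ - ρ)
      = (ξ * ζ - ρ * θ * (1 + (ξ + ζ) - (ρ + θ)) - (ρ + θ) * ((ξ + ζ) - (ρ + θ)))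
        / ((1 + ρ) * (1 + θ)) := by
    rw [eq_div_iff hd0.ne', sub_mul, sub_mul, div_mul_cancel₀ _ hd0.ne']; ring
  rw [e, abs_div, abs_of_pos hd0, div_le_iff₀ hd0]
  have b1 : |ρ * θ| ≤ (ρ ^ 2 + θ ^ 2) / 2 := by
    rw [abs_le]; constructor <;> nlinarith [sq_nonneg (ρ + θ), sq_nonneg (ρ - θ)]
  have b2 : |ρ * θ * (1 + (ξ + ζ) - (ρ + θ))| ≤ ρ ^ 2 + θ ^ 2 := by
    rw [abs_mul]
    have : |1 + (ξ + ζ) - (ρ + θ)| ≤ 2 := by rw [abs_le]; constructor <;> linarith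
    have := mul_le_mul b1 this (abs_nonneg _) (by positivity)
    linarith
  have b3 : |ξ * ζ - ρ * θ * (1 + (ξ + ζ) - (ρ + θ)) - (ρ + θ) * ((ξ + ζ) - (ρ + θ))|
      ≤ 4 * (ξ ^ 2 + ζ ^ 2 + θ ^ 2 + ρ ^ 2) := by
    have b2' := abs_le.1 b2
    rw [abs_le]
    constructor <;> nlinarith [sq_nonneg (ξ - ζ), sq_nonneg (ξ + ζ), sq_nonneg (ρ - θ),
      sq_nonneg (ρ + θ), sq_nonneg (ξ + ζ + ρ + θ), sq_nonneg (ξ + ζ - ρ - θ)]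
  have hs : 0 ≤ ξ ^ 2 + ζ ^ 2 + θ ^ 2 + ρ ^ 2 := by positivity
  nlinarith

end Scalar

/-! ### Relative change of `w / τ` in one outcome -/

section Outcome

variable {m : ℕ} {P : Matrix (Fin m) (Fin m) ℝ} {τ : Fin m → ℝ}

/-- If `E` is the change of the squared scaling with first order part `β` and `θ` is the relative
change of the weights, then `θ = L β` up to second order terms. -/
lemma weight_change_bounds (h : ProjWeights P τ) {E β S θ : Fin m → ℝ}
    (hEβ : ∀ i, |E i - β i| ≤ 6 * S i) (hE : ∀ i, E i ^ 2 ≤ 5 * S i)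
    (hS : ∀ i, S i ≤ 1 / 100000)
    (hθ : ∀ i, |θ i - opL P τ E i| ≤ 4 * opB P τ (fun j => E j ^ 2) i) (i : Fin m) :
    |θ i - opL P τ β i| ≤ 26 * opB P τ S i ∧ θ i ^ 2 ≤ 22 * opB P τ S i := by
  have e1 : opB P τ (fun j => E j ^ 2) i ≤ 5 * opB P τ S i := by
    have := h.opB_mono hE i
    rwa [show (fun j => 5 * S j) = (5 : ℝ) • S from rfl, ProjWeights.opB_smul] at this
  have e2 : |opL P τ E i - opL P τ β i| ≤ 6 * opB P τ S i := by
    have := h.abs_opL_le_opB (u := E - β) (v := (6 : ℝ) • S) hEβ i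
    rwa [ProjWeights.opL_sub, ProjWeights.opB_smul] at this
  have e3 : opL P τ E i ^ 2 ≤ 10 * opB P τ S i := by
    have h1 := h.abs_opL_le_opB (u := E) (v := fun j => |E j|) (fun j => le_rfl) i
    have h2 := h.opB_sq_le (fun j => |E j|) i
    simp only [sq_abs] at h2
    have h3 : opL P τ E i ^ 2 ≤ opB P τ (fun j => |E j|) i ^ 2 := by
      rw [← sq_abs]
      exact pow_le_pow_left₀ (abs_nonneg _) h1 2
    linarith
  have e4 : opB P τ (fun j => E j ^ 2) i ≤ 1 / 1000 := by
    have := h.opB_le (u := fun j => E j ^ 2) (a := 5 / 100000) (by norm_num)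
      (fun j => by have := hE j; have := hS j; linarith) i
    linarith
  have e5 : 0 ≤ opB P τ (fun j => E j ^ 2) i := h.opB_nonneg (fun j => sq_nonneg _) i
  have h1 := hθ i
  constructor
  · have : θ i - opL P τ β i = (θ i - opL P τ E i) + (opL P τ E i - opL P τ β i) := by ring
    rw [this]
    refine (abs_add_le _ _).trans ?_
    linarith
  · have h2 : (θ i - opL P τ E i) ^ 2 ≤ (4 * opB P τ (fun j => E j ^ 2) i) ^ 2 := by
      rw [← sq_abs]
      exact pow_le_pow_left₀ (abs_nonneg _) h1 2
    -- This is θ² ≤ 2(θ - LE)² + 2(LE)². The first square is negligible because `e4` bounds one of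
    -- its factors by a small constant.
    nlinarith [sq_nonneg (θ i - 2 * opL P τ E i)]

/-- Second order expansion of the relative change of `w / τ`. -/
lemma ratio_change_bounds (h : ProjWeights P τ) {α κ ρ : ℝ} {ξ ζ E S θ : Fin m → ℝ}
    (hκ : κ ≤ 1 / 1000) (hρ : |ρ| ≤ κ)
    (hξ : ∀ i, |ξ i| ≤ κ) (hζ : ∀ i, |ζ i| ≤ κ) (hS : ∀ i, S i = ξ i ^ 2 + ζ i ^ 2)
    (hα : 0 < α) (hα' : α ≤ 1 / 5)
    (hE : ∀ i, E i = (1 + ξ i) ^ (1 - 2 * α) * (1 + ζ i) ^ (-1 - 2 * α) - 1)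
    (hθ : ∀ i, |θ i - opL P τ E i| ≤ 4 * opB P τ (fun j => E j ^ 2) i) (i : Fin m) :
    let d := (1 + ξ i) * (1 + ζ i) / ((1 + ρ) * (1 + θ i)) - 1
    let Q := S i + opB P τ S i + ρ ^ 2
    |d - (ξ i + ζ i - opL P τ ((1 - 2 * α) • ξ - (1 + 2 * α) • ζ) i - ρ)| ≤ 210 * Q ∧
      d ^ 2 ≤ 120 * Q ∧ |d| ≤ 15 * κ ∧ |θ i| ≤ 10 * κ := by
  intro d Q
  have hκ0 : 0 ≤ κ := (abs_nonneg ρ).trans hρ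
  have hξ' : ∀ i, |ξ i| ≤ 1 / 100 := fun i => (hξ i).trans (by linarith)
  have hζ' : ∀ i, |ζ i| ≤ 1 / 100 := fun i => (hζ i).trans (by linarith)
  have hξ2 : ∀ i, ξ i ^ 2 ≤ κ ^ 2 := fun i => by
    rw [← sq_abs]; exact pow_le_pow_left₀ (abs_nonneg _) (hξ i) 2
  have hζ2 : ∀ i, ζ i ^ 2 ≤ κ ^ 2 := fun i => by
    rw [← sq_abs]; exact pow_le_pow_left₀ (abs_nonneg _) (hζ i) 2
  have hκ2 : κ ^ 2 ≤ 1 / 1000000 := by nlinarith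
  have hSle : ∀ i, S i ≤ 2 * κ ^ 2 := fun i => by rw [hS]; linarith [hξ2 i, hζ2 i]
  have hEβ : ∀ i, |E i - ((1 - 2 * α) • ξ - (1 + 2 * α) • ζ) i| ≤ 6 * S i := fun i => by
    rw [hE, hS]
    exact abs_rpow_mul_rpow_sub_le hα hα' (hξ' i) (hζ' i)
  have hE2 : ∀ i, E i ^ 2 ≤ 5 * S i := fun i => by
    have h1 := hEβ i
    simp only [Pi.sub_apply, Pi.smul_apply, smul_eq_mul] at h1
    rw [hS] at h1 ⊢
    set x := ξ i
    set z := ζ i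
    have h2 : |E i| ≤ 107 / 100 * |x| + 147 / 100 * |z| := by
      have e : E i = (E i - ((1 - 2 * α) * x - (1 + 2 * α) * z))
        + ((1 - 2 * α) * x + -((1 + 2 * α) * z)) := by ring
      rw [e]
      refine (abs_add_le _ _).trans ?_
      have h3 := abs_add_le ((1 - 2 * α) * x) (-((1 + 2 * α) * z))
      rw [abs_neg, abs_mul, abs_mul, abs_of_pos (show 0 < 1 - 2 * α by linarith),
        abs_of_pos (show 0 < 1 + 2 * α by linarith)] at h3
      have h4 : x ^ 2 ≤ 1 / 100 * |x| := by
        rw [← sq_abs, sq]; exact mul_le_mul_of_nonneg_right (hξ' i) (abs_nonneg _)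
      have h5 : z ^ 2 ≤ 1 / 100 * |z| := by
        rw [← sq_abs, sq]; exact mul_le_mul_of_nonneg_right (hζ' i) (abs_nonneg _)
      have := abs_nonneg x
      have := abs_nonneg z
      have h6 : (1 - 2 * α) * |x| ≤ 1 * |x| :=
        mul_le_mul_of_nonneg_right (by linarith) (abs_nonneg _)
      have h7 : (1 + 2 * α) * |z| ≤ 7 / 5 * |z| :=
        mul_le_mul_of_nonneg_right (by linarith) (abs_nonneg _)
      linarith
    have h3 : E i ^ 2 ≤ (107 / 100 * |x| + 147 / 100 * |z|) ^ 2 := by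
      rw [← sq_abs (E i)]; exact pow_le_pow_left₀ (abs_nonneg _) h2 2
    rw [← sq_abs x, ← sq_abs z]
    nlinarith [sq_nonneg (|x| - |z|), sq_nonneg |x|, sq_nonneg |z|]
  obtain ⟨t1, t2⟩ := weight_change_bounds h hEβ hE2 (fun i => (hSle i).trans (by linarith)) hθ i
  have hS0 : ∀ j, 0 ≤ S j := fun j => by rw [hS]; positivity
  have hBS : 0 ≤ opB P τ S i := h.opB_nonneg hS0 i
  have hBS2 : opB P τ S i ≤ 4 * κ ^ 2 := by
    have := h.opB_le (a := 2 * κ ^ 2) (by positivity) hSle i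
    linarith
  have hθκ : |θ i| ≤ 10 * κ := by
    refine abs_le_of_sq_le_sq ?_ (by linarith)
    nlinarith
  have hr := ratio_expansion (hξ' i) (hζ' i) (hθκ.trans (by linarith))
    (hρ.trans (by linarith : κ ≤ 1 / 100))
  have hSi := hS i
  change |d - (ξ i + ζ i - θ i - ρ)| ≤ _ at hr
  have hρ2 : 0 ≤ ρ ^ 2 := sq_nonneg _
  -- The four absolute values add up to at most (1 + 1 + 10 + 1)κ = 13κ, so the prefactor yields the
  -- bound 15κ.
  have hd : |d| ≤ 15 / 13 * (|ξ i| + |ζ i| + |θ i| + |ρ|) := by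
    have e : d = (d - (ξ i + ζ i - θ i - ρ)) + (ξ i + ζ i - θ i - ρ) := by ring
    rw [e]
    refine (abs_add_le _ _).trans ?_
    have h1 : |ξ i + ζ i - θ i - ρ| ≤ |ξ i| + |ζ i| + |θ i| + |ρ| := by
      have := abs_sub (ξ i + ζ i - θ i) ρ
      have := abs_sub (ξ i + ζ i) (θ i)
      have := abs_add_le (ξ i) (ζ i)
      linarith
    have key : ∀ x : ℝ, |x| ≤ 1 / 100 → 8 * x ^ 2 ≤ 2 / 13 * |x| := fun x hx => by
      rw [← sq_abs, sq]; nlinarith [abs_nonneg x]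
    have k1 := key _ (hξ' i)
    have k2 := key _ (hζ' i)
    have k3 := key _ (hθκ.trans (by linarith))
    have k4 := key _ (hρ.trans (by linarith : κ ≤ 1 / 100))
    linarith
  refine ⟨?_, ?_, ?_, hθκ⟩
  · have e : d - (ξ i + ζ i - opL P τ ((1 - 2 * α) • ξ - (1 + 2 * α) • ζ) i - ρ)
        = (d - (ξ i + ζ i - θ i - ρ))
          - (θ i - opL P τ ((1 - 2 * α) • ξ - (1 + 2 * α) • ζ) i) := by ring
    rw [e]
    refine (abs_sub _ _).trans ?_
    have hS0' := hS0 i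
    simp only [Q]
    linarith
  · have h1 : d ^ 2 ≤ (15 / 13 * (|ξ i| + |ζ i| + |θ i| + |ρ|)) ^ 2 := by
      rw [← sq_abs d]; exact pow_le_pow_left₀ (abs_nonneg _) hd 2
    have h2 : (|ξ i| + |ζ i| + |θ i| + |ρ|) ^ 2
        ≤ 4 * (ξ i ^ 2 + ζ i ^ 2 + θ i ^ 2 + ρ ^ 2) := by
      rw [← sq_abs (ξ i), ← sq_abs (ζ i), ← sq_abs (θ i), ← sq_abs ρ]
      nlinarith [sq_nonneg (|ξ i| - |ζ i|), sq_nonneg (|ξ i| - |θ i|), sq_nonneg (|ξ i| - |ρ|),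
        sq_nonneg (|ζ i| - |θ i|), sq_nonneg (|ζ i| - |ρ|), sq_nonneg (|θ i| - |ρ|)]
    have hS0' := hS0 i
    simp only [Q]
    rw [mul_pow] at h1
    linarith
  · have := hξ i
    have := hζ i
    linarith

end Outcome

/-! ### Drift and second moment of a step -/

section Drift

variable {m : ℕ}

/-- Bounds on the ingredients `g`, `δ_p`, `δ_c` of a step, relative to the leverage projection `P`,
weights `τ` and approximate weights `τb`. -/
structure StepBounds (α ε γ : ℝ) (P : Matrix (Fin m) (Fin m) ℝ) (τ τb g dp dc : Fin m → ℝ) :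
    Prop where
  proj : ProjWeights P τ
  α_pos : 0 < α
  α_le : α ≤ 1 / 5
  ε_eq : ε = α ^ 2 / 240
  γ_pos : 0 < γ
  tb_nonneg : ∀ i, 0 ≤ τb i
  tb_le : ∀ v, wNorm τb v ≤ (1 + ε) * wNorm τ v
  t_le : ∀ v, wNorm τ v ≤ (1 + ε) * wNorm τb v
  g_norm : mixedNorm α τb g ≤ γ
  dp_w : wNorm τ dp ≤ (1 + 10 * ε) * wNorm τ g
  dp_sup : ‖dp‖ ≤ 3 / 2 * wNorm τ g
  refl_w : wNorm τ (g - (2 : ℝ) • dp) ≤ (1 + 10 * ε) * wNorm τ g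
  dc_w : wNorm τ dc ≤ (1 + 10 * ε) * (ε * γ)
  dc_sup : ‖dc‖ ≤ 3 / 2 * (ε * γ)

namespace StepBounds

variable {α ε γ : ℝ} {P : Matrix (Fin m) (Fin m) ℝ} {τ τb g dp dc : Fin m → ℝ}

lemma ε_pos (h : StepBounds α ε γ P τ τb g dp dc) : 0 < ε := by
  have := h.α_pos; rw [h.ε_eq]; positivity

lemma ε_le (h : StepBounds α ε γ P τ τb g dp dc) : ε ≤ α / 1200 := by
  have := h.α_pos; have := h.α_le; rw [h.ε_eq]; nlinarith

lemma ten_div_mul (h : StepBounds α ε γ P τ τb g dp dc) (c : ℝ) : 10 / α * (α / 10 * c) = c := by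
  have := h.α_pos.ne'; field_simp

lemma mixedNorm_le (h : StepBounds α ε γ P τ τb g dp dc) {v : Fin m → ℝ} {A B : ℝ}
    (hA : ‖v‖ ≤ A) (hB : wNorm τ v ≤ α / 10 * B) : mixedNorm α τb v ≤ A + (1 + ε) * B := by
  have h1 := h.ε_pos
  have h2 := h.α_pos
  rw [mixedNorm_eq]
  refine add_le_add hA ?_
  calc 10 / α * wNorm τb v ≤ 10 / α * ((1 + ε) * (α / 10 * B)) := by
        refine mul_le_mul_of_nonneg_left ((h.tb_le v).trans ?_) (by positivity)
        exact mul_le_mul_of_nonneg_left hB (by linarith)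
    _ = (1 + ε) * B := by rw [← h.ten_div_mul ((1 + ε) * B)]; ring

/-- The budget γ of the mixed norm is shared between the sup norm and the Euclidean norm. What the
sup norm leaves, γ - ‖g‖, is kept explicit because the contraction acts differently on the two
shares. -/
lemma g_w (h : StepBounds α ε γ P τ τb g dp dc) :
    wNorm τ g ≤ α / 10 * ((1 + ε) * (γ - ‖g‖)) := by
  have h1 := h.g_norm
  have h2 := h.α_pos
  have h3 := h.ε_pos
  rw [mixedNorm_eq] at h1
  have h4 : wNorm τb g ≤ α / 10 * (γ - ‖g‖) := by
    have : α / 10 * (10 / α * wNorm τb g) ≤ α / 10 * (γ - ‖g‖) :=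
      mul_le_mul_of_nonneg_left (by linarith) (by positivity)
    refine le_trans (le_of_eq ?_) this
    field_simp
  calc wNorm τ g ≤ (1 + ε) * wNorm τb g := h.t_le g
    _ ≤ (1 + ε) * (α / 10 * (γ - ‖g‖)) := mul_le_mul_of_nonneg_left h4 (by linarith)
    _ = _ := by ring

lemma norm_g_le (h : StepBounds α ε γ P τ τb g dp dc) : ‖g‖ ≤ γ :=
  (norm_le_mixedNorm h.α_pos g).trans h.g_norm

lemma g_w' (h : StepBounds α ε γ P τ τb g dp dc) : wNorm τ g ≤ α / 10 * ((1 + ε) * γ) := by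
  have h1 := h.g_w
  have h2 := h.α_pos
  have h3 := h.ε_pos
  refine h1.trans (mul_le_mul_of_nonneg_left (mul_le_mul_of_nonneg_left ?_ ?_) (by positivity))
  · linarith [norm_nonneg g]
  · linarith

/-- The contraction: the part of the drift of `w / τ` that is not `g`. -/
lemma mixedNorm_main_le (h : StepBounds α ε γ P τ τb g dp dc) :
    mixedNorm α τb ((2 * α) • (g - (2 : ℝ) • dp)
      - (1 - 4 * α ^ 2) • opL P τ (g - (2 : ℝ) • dp)) ≤ (1 - 3 / 2 * α) * γ := by
  have hα := h.α_pos
  have hα' := h.α_le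
  have hε := h.ε_pos
  have hε' := h.ε_le
  have hγ := h.γ_pos
  set u := g - (2 : ℝ) • dp with hu
  -- The multiplier 2α - (1 - 4α²)t, for t in [0,1], has the end values 2α and -K, and K is the
  -- larger in absolute value because α ≤ 1/5.
  set K := 1 - 2 * α - 4 * α ^ 2 with hK
  have hK0 : 0 ≤ K := by rw [hK]; nlinarith
  have hK1 : K ≤ 1 - 2 * α := by rw [hK]; nlinarith
  have hKα : 2 * α ≤ K := by rw [hK]; nlinarith
  have hG := h.g_w
  have hg0 := wNorm_nonneg τ g
  have hy : 0 ≤ γ - ‖g‖ := by linarith [h.norm_g_le]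
  set y := γ - ‖g‖ with hy'
  have hw := h.proj.wNorm_sub_opL_le (a := 2 * α) (b := 1 - 4 * α ^ 2) (K := K) hK0
    (by nlinarith) (by rw [hK]; apply le_of_eq; ring) u
  -- The sup norm of g contracts by K. The Euclidean norm pays about 3 for δ_p and 1 for the
  -- off-diagonal part of `opL`. Four times α/10 times the Euclidean share gives the 0.402, well
  -- below the gain 2α on that share.
  have hsup : ‖(2 * α) • u - (1 - 4 * α ^ 2) • opL P τ u‖ ≤ K * ‖g‖ + 402 / 1000 * α * y := by
    have hb : 0 ≤ 1 - 4 * α ^ 2 := by nlinarith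
    refine pi_norm_le (by positivity) fun i => ?_
    have h1 := h.proj.abs_sub_opL_le (a := 2 * α) (b := 1 - 4 * α ^ 2) (K := K) hb
      (by rw [abs_of_pos (by positivity)]; exact hKα)
      (by rw [abs_le]; constructor <;> rw [hK] <;> nlinarith) u i
    have h2 : |u i| ≤ ‖g‖ + 2 * ‖dp‖ := by
      refine (abs_apply_le_norm u i).trans ((norm_sub_le _ _).trans ?_)
      rw [norm_smul]; simp
    have h3 := h.dp_sup
    have h4 := h.refl_w
    have h5 : (1 - 4 * α ^ 2) * wNorm τ u ≤ 101 / 100 * wNorm τ g := by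
      have := wNorm_nonneg τ u
      nlinarith
    have h6 : K * |u i| ≤ K * ‖g‖ + 3 * wNorm τ g := by
      have : K * |u i| ≤ K * (‖g‖ + 2 * ‖dp‖) := mul_le_mul_of_nonneg_left h2 hK0
      have : K * ‖dp‖ ≤ 1 * (3 / 2 * wNorm τ g) :=
        mul_le_mul (by linarith) h3 (norm_nonneg _) (by norm_num)
      nlinarith
    have h7 : wNorm τ g ≤ 1002 / 10000 * α * y := by
      refine hG.trans ?_
      have : α / 10 * ((1 + ε) * y) = (1 + ε) / 10 * (α * y) := by ring
      rw [this, mul_assoc]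
      exact mul_le_mul_of_nonneg_right (by linarith) (by positivity)
    simp only [Pi.sub_apply, Pi.smul_apply, smul_eq_mul]
    have h8 : 0 ≤ α * y := by positivity
    linarith
  have hB : wNorm τ ((2 * α) • u - (1 - 4 * α ^ 2) • opL P τ u)
      ≤ α / 10 * (K * ((1 + 10 * ε) * (1 + ε)) * y) := by
    refine hw.trans ?_
    have := mul_le_mul_of_nonneg_left (h.refl_w.trans (mul_le_mul_of_nonneg_left hG
      (by linarith : 0 ≤ 1 + 10 * ε))) hK0
    refine this.trans (le_of_eq ?_); ring
  refine (h.mixedNorm_le hsup hB).trans ?_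
  have h9 : (1 + ε) * ((1 + 10 * ε) * (1 + ε)) ≤ 1 + 13 * ε := by nlinarith [sq_nonneg ε]
  have h10 : K * ‖g‖ ≤ (1 - 3 / 2 * α) * ‖g‖ :=
    mul_le_mul_of_nonneg_right (by linarith) (norm_nonneg _)
  have h11 : (1 + ε) * (K * ((1 + 10 * ε) * (1 + ε)) * y) ≤ K * (1 + 13 * ε) * y := by
    have := mul_le_mul_of_nonneg_left h9 (mul_nonneg hK0 hy)
    linarith
  have h12 : K * (1 + 13 * ε) ≤ 1 - 198 / 100 * α := by nlinarith
  have h13 := mul_le_mul_of_nonneg_right h12 hy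
  have h14 : γ = ‖g‖ + y := by rw [hy']; ring
  have : 0 ≤ α * y := by positivity
  rw [h14]
  nlinarith

lemma mixedNorm_dc_part_le (h : StepBounds α ε γ P τ τb g dp dc) :
    mixedNorm α τb ((-1 : ℝ) • ((1 : ℝ) • dc - (1 - 2 * α) • opL P τ dc)) ≤ 6 / 100 * α * γ := by
  have hα := h.α_pos
  have hα' := h.α_le
  have hε := h.ε_pos
  have hε' := h.ε_le
  have hγ := h.γ_pos
  rw [mixedNorm_smul, abs_neg, abs_one, one_mul]
  have hdw := h.dc_w
  have hεγ : 0 ≤ ε * γ := by positivity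
  have hdw2 : wNorm τ dc ≤ 101 / 100 * (ε * γ) := by nlinarith
  have hw := h.proj.wNorm_sub_opL_le (a := 1) (b := 1 - 2 * α) (K := 1) (by norm_num)
    (by norm_num) (by nlinarith) dc
  have hsup : ‖(1 : ℝ) • dc - (1 - 2 * α) • opL P τ dc‖ ≤ 3 * (ε * γ) := by
    refine pi_norm_le (by positivity) fun i => ?_
    have h1 := h.proj.abs_sub_opL_le (a := 1) (b := 1 - 2 * α) (K := 1) (by linarith)
      (by norm_num) (by rw [abs_le]; constructor <;> linarith) dc i
    have h2 := (abs_apply_le_norm dc i).trans h.dc_sup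
    have h3 : (1 - 2 * α) * wNorm τ dc ≤ 1 * (101 / 100 * (ε * γ)) :=
      mul_le_mul (by linarith) hdw2 (wNorm_nonneg _ _) (by norm_num)
    simp only [Pi.sub_apply, Pi.smul_apply, smul_eq_mul]
    linarith
  -- The definition of ε enters: after multiplication by 10/α, an infeasibility of size εγ costs
  -- only α/24 of γ, a small part of the contraction gain.
  have e : ε * γ = α / 10 * (α / 24 * γ) := by rw [h.ε_eq]; ring
  have hB : wNorm τ ((1 : ℝ) • dc - (1 - 2 * α) • opL P τ dc)
      ≤ α / 10 * (101 / 100 * (α / 24 * γ)) := by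
    refine hw.trans ?_
    rw [one_mul]
    refine hdw2.trans (le_of_eq ?_)
    rw [e]; ring
  refine (h.mixedNorm_le hsup hB).trans ?_
  have h5 : 0 ≤ α * γ := by positivity
  have h6 : ε * γ ≤ α / 1200 * γ := mul_le_mul_of_nonneg_right hε' hγ.le
  nlinarith

lemma mixedNorm_dp_le (h : StepBounds α ε γ P τ τb g dp dc) :
    mixedNorm α τb dp ≤ 11 / 10 * γ := by
  have hα := h.α_pos
  have hα' := h.α_le
  have hε := h.ε_pos
  have hε' := h.ε_le
  have hγ := h.γ_pos
  have hG := h.g_w'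
  have hB : wNorm τ dp ≤ α / 10 * ((1 + 10 * ε) * ((1 + ε) * γ)) := by
    refine h.dp_w.trans ((mul_le_mul_of_nonneg_left hG (by linarith)).trans (le_of_eq ?_)); ring
  refine (h.mixedNorm_le h.dp_sup hB).trans ?_
  have h9 : (1 + ε) * ((1 + 10 * ε) * (1 + ε)) ≤ 1 + 13 * ε := by nlinarith [sq_nonneg ε]
  have h10 := mul_le_mul_of_nonneg_right h9 hγ.le
  have h11 : wNorm τ g ≤ 21 / 1000 * γ := by
    refine hG.trans ?_
    rw [← mul_assoc]
    exact mul_le_mul_of_nonneg_right (by nlinarith) hγ.le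
  nlinarith

lemma mixedNorm_dc_le (h : StepBounds α ε γ P τ τb g dp dc) :
    mixedNorm α τb dc ≤ 2 / 100 * γ := by
  have hα := h.α_pos
  have hα' := h.α_le
  have hε := h.ε_pos
  have hε' := h.ε_le
  have hγ := h.γ_pos
  have e : ε * γ = α / 10 * (α / 24 * γ) := by rw [h.ε_eq]; ring
  have hB : wNorm τ dc ≤ α / 10 * ((1 + 10 * ε) * (α / 24 * γ)) := by
    refine h.dc_w.trans (le_of_eq ?_)
    rw [e]; ring
  refine (h.mixedNorm_le h.dc_sup hB).trans ?_
  have h9 : (1 + ε) * ((1 + 10 * ε) * (α / 24)) ≤ 1 / 100 := by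
    have : (1 + ε) * (1 + 10 * ε) ≤ 101 / 100 := by nlinarith
    nlinarith
  have h10 := mul_le_mul_of_nonneg_right h9 hγ.le
  nlinarith

lemma mixedNorm_dr_le (h : StepBounds α ε γ P τ τb g dp dc) :
    mixedNorm α τb ((1 + 2 * α) • dp + dc) ≤ 8 / 5 * γ := by
  have hα := h.α_pos
  have hα' := h.α_le
  have h1 := mixedNorm_add_le hα h.tb_nonneg ((1 + 2 * α) • dp) dc
  rw [mixedNorm_smul, abs_of_pos (by linarith : 0 < 1 + 2 * α)] at h1
  have h2 := mul_le_mul (by linarith : 1 + 2 * α ≤ 7 / 5) h.mixedNorm_dp_le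
    (mixedNorm_nonneg hα _) (by norm_num)
  have := h.mixedNorm_dc_le
  have := h.γ_pos
  linarith

lemma wNorm_dr_le (h : StepBounds α ε γ P τ τb g dp dc) :
    wNorm τ ((1 + 2 * α) • dp + dc) ≤ 15 / 100 * α * γ := by
  have hα := h.α_pos
  have hα' := h.α_le
  have hε := h.ε_pos
  have hε' := h.ε_le
  have hγ := h.γ_pos
  have h1 := wNorm_add_le (fun i => (h.proj.pos i).le) ((1 + 2 * α) • dp) dc
  rw [wNorm_smul, abs_of_pos (by linarith : 0 < 1 + 2 * α)] at h1
  have h2 : wNorm τ dp ≤ 102 / 1000 * (α * γ) := by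
    refine h.dp_w.trans ((mul_le_mul_of_nonneg_left h.g_w' (by linarith)).trans ?_)
    have e : (1 + 10 * ε) * (α / 10 * ((1 + ε) * γ))
      = (1 + 10 * ε) * (1 + ε) / 10 * (α * γ) := by ring
    rw [e]
    exact mul_le_mul_of_nonneg_right (by nlinarith) (by positivity)
  have h3 : wNorm τ dc ≤ 2 / 1000 * (α * γ) := by
    refine h.dc_w.trans ?_
    rw [← mul_assoc, ← mul_assoc]
    exact mul_le_mul_of_nonneg_right (by nlinarith) hγ.le
  have h4 := mul_le_mul (by linarith : 1 + 2 * α ≤ 7 / 5) h2 (wNorm_nonneg _ _) (by norm_num)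
  have : 0 ≤ α * γ := by positivity
  linarith

/-- In sup norm `opL` adds a Euclidean norm, which is small compared with 10/α ≥ 50 times that norm.
The Euclidean part itself is contracted, up to the change of weights. -/
lemma mixedNorm_opL_le (h : StepBounds α ε γ P τ τb g dp dc) (v : Fin m → ℝ) :
    mixedNorm α τb (opL P τ v) ≤ 2 * mixedNorm α τb v := by
  have hα := h.α_pos
  have hε := h.ε_pos
  have hα' := h.α_le
  have hε' := h.ε_le
  have h1 := h.proj.norm_opL_le v
  have h2 := h.tb_le (opL P τ v)
  have h3 := h.proj.wNorm_opL_le v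
  have h4 := h.t_le v
  have h5 : wNorm τb (opL P τ v) ≤ 101 / 100 * wNorm τb v := by
    have : (1 + ε) * wNorm τ (opL P τ v) ≤ (1 + ε) * ((1 + ε) * wNorm τb v) :=
      mul_le_mul_of_nonneg_left (h3.trans h4) (by linarith)
    have h6 : (1 + ε) * (1 + ε) ≤ 101 / 100 := by nlinarith
    have := mul_le_mul_of_nonneg_right h6 (wNorm_nonneg τb v)
    linarith
  have h7 : 50 ≤ 10 / α := by rw [le_div_iff₀ hα]; linarith
  have h8 := mul_le_mul_of_nonneg_left h5 (by linarith : 0 ≤ 10 / α)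
  have h9 := mul_le_mul_of_nonneg_right h7 (wNorm_nonneg τb v)
  have h10 : (1 + ε) * wNorm τb v ≤ 2 * wNorm τb v :=
    mul_le_mul_of_nonneg_right (by linarith) (wNorm_nonneg τb v)
  rw [mixedNorm_eq, mixedNorm_eq]
  have := norm_nonneg v
  have := wNorm_nonneg τb v
  linarith

lemma mixedNorm_opB_le (h : StepBounds α ε γ P τ τb g dp dc) (v : Fin m → ℝ) :
    mixedNorm α τb (opB P τ v) ≤ 201 / 100 * mixedNorm α τb v := by
  have hα := h.α_pos
  have hε := h.ε_pos
  have hα' := h.α_le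
  have hε' := h.ε_le
  have h1 := h.proj.norm_opB_le v
  have h2 := h.tb_le (opB P τ v)
  have h3 := h.proj.wNorm_opB_le v
  have h4 := h.t_le v
  have h5 : wNorm τb (opB P τ v) ≤ 201 / 100 * wNorm τb v := by
    have : (1 + ε) * wNorm τ (opB P τ v) ≤ (1 + ε) * (2 * ((1 + ε) * wNorm τb v)) :=
      mul_le_mul_of_nonneg_left (by linarith) (by linarith)
    have h6 : (1 + ε) * (1 + ε) ≤ 1005 / 1000 := by nlinarith
    have := mul_le_mul_of_nonneg_right h6 (wNorm_nonneg τb v)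
    linarith
  have h8 := mul_le_mul_of_nonneg_left h5 (by positivity : 0 ≤ 10 / α)
  rw [mixedNorm_eq, mixedNorm_eq]
  have := norm_nonneg v
  linarith

/-- The expected first order change of `w / τ` is close to `g`. -/
lemma mixedNorm_drift_le (h : StepBounds α ε γ P τ τb g dp dc) {v hx hs : Fin m → ℝ} {ρ sn : ℝ}
    (hv : ∀ i, |v i - 1| ≤ 2 * ε) (hhx : ∀ i, |hx i - 1| ≤ 2 * ε) (hhs : ∀ i, |hs i - 1| ≤ 2 * ε)
    (hone : mixedNorm α τb (fun _ => 1) ≤ 15 * sn / α) (hρ : |ρ| * sn ≤ ε * γ)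
    {ξ ζ lin : Fin m → ℝ} (hξ : ξ = hx * ((1 + 2 * α) • g - ((1 + 2 * α) • dp + dc)))
    (hζ : ζ = hs * ((1 - 2 * α) • dp))
    (hlin : lin = ξ + ζ - opL P τ ((1 - 2 * α) • ξ - (1 + 2 * α) • ζ) - fun _ => ρ) :
    mixedNorm α τb lin ≤ 2 * γ ∧ mixedNorm α τb (v * lin - g) ≤ (1 - α) * γ := by
  have hα := h.α_pos
  have hα' := h.α_le
  have hε := h.ε_pos
  have hε' := h.ε_le
  have hγ := h.γ_pos
  have htb := h.tb_nonneg
  have hαγ : 0 < α * γ := by positivity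
  have hεγ : ε * γ ≤ 1 / 240 * (α / 5 * γ) := by
    rw [h.ε_eq]; nlinarith
  set ex := (hx - 1) * ((1 + 2 * α) • g - ((1 + 2 * α) • dp + dc)) with hex
  set es := (hs - 1) * ((1 - 2 * α) • dp) with hes
  have nx : mixedNorm α τb ex ≤ 6 * (ε * γ) := by
    have h1 : ‖hx - 1‖ ≤ 2 * ε := pi_norm_le (by positivity) hhx
    refine (mixedNorm_mul_le hα htb _ _).trans ?_
    have h2 : mixedNorm α τb ((1 + 2 * α) • g - ((1 + 2 * α) • dp + dc)) ≤ 3 * γ := by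
      have := mixedNorm_add_le hα htb ((1 + 2 * α) • g) ((-1 : ℝ) • ((1 + 2 * α) • dp + dc))
      rw [neg_one_smul, ← sub_eq_add_neg, ← neg_one_smul ℝ, mixedNorm_smul, mixedNorm_smul,
        abs_neg, abs_one, one_mul, abs_of_pos (by linarith : 0 < 1 + 2 * α)] at this
      have h3 := h.mixedNorm_dr_le
      have h4 := mul_le_mul (by linarith : 1 + 2 * α ≤ 7 / 5) h.g_norm
        (mixedNorm_nonneg hα _) (by norm_num)
      linarith
    have := mul_le_mul h1 h2 (mixedNorm_nonneg hα _) (by positivity)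
    linarith
  have ns : mixedNorm α τb es ≤ 3 * (ε * γ) := by
    have h1 : ‖hs - 1‖ ≤ 2 * ε := pi_norm_le (by positivity) hhs
    refine (mixedNorm_mul_le hα htb _ _).trans ?_
    rw [mixedNorm_smul, abs_of_pos (by linarith : 0 < 1 - 2 * α)]
    have h2 := mul_le_mul (by linarith : 1 - 2 * α ≤ 1) h.mixedNorm_dp_le
      (mixedNorm_nonneg hα _) (by norm_num)
    have := mul_le_mul h1 h2 (mul_nonneg (by linarith) (mixedNorm_nonneg hα _)) (by positivity)
    nlinarith
  set η := (1 - 2 * α) • ex - (1 + 2 * α) • es with hη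
  have nη : mixedNorm α τb η ≤ 11 * (ε * γ) := by
    have := mixedNorm_add_le hα htb ((1 - 2 * α) • ex) ((-(1 + 2 * α)) • es)
    rw [neg_smul, ← sub_eq_add_neg, ← neg_smul, mixedNorm_smul, mixedNorm_smul, abs_neg,
      abs_of_pos (by linarith : 0 < 1 + 2 * α), abs_of_pos (by linarith : 0 < 1 - 2 * α)] at this
    have h4 := mul_le_mul (by linarith : 1 + 2 * α ≤ 7 / 5) ns
        (mixedNorm_nonneg hα _) (by norm_num)
    have h5 := mul_le_mul (by linarith : 1 - 2 * α ≤ 1) nx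
        (mixedNorm_nonneg hα _) (by norm_num)
    have : 0 ≤ ε * γ := by positivity
    linarith
  have nLη := (h.mixedNorm_opL_le η).trans (mul_le_mul_of_nonneg_left nη (by norm_num))
  set u := g - (2 : ℝ) • dp with hu
  -- The coefficients 1 + 2α in the x-step and 1 - 2α in the s-step make g and δ_p enter the weight
  -- change only through the reflection `u`; `η` collects the errors from the approximations of x
  -- and s.
  have hβ : (1 - 2 * α) • ξ - (1 + 2 * α) • ζ
      = (1 - 4 * α ^ 2) • u + ((-(1 - 2 * α)) • dc + η) := by
    rw [hη, hex, hes, hξ, hζ, hu]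
    ext i
    simp only [Pi.sub_apply, Pi.add_apply, Pi.smul_apply, Pi.mul_apply, Pi.one_apply, smul_eq_mul]
    ring
  set M := (2 * α) • u - (1 - 4 * α ^ 2) • opL P τ u with hM
  set D := (-1 : ℝ) • ((1 : ℝ) • dc - (1 - 2 * α) • opL P τ dc) with hD
  set O : Fin m → ℝ := fun _ => 1
  have hsplit : lin - g = M + (D + (ex + (es + ((-1 : ℝ) • opL P τ η + (-ρ) • O)))) := by
    rw [hlin, hβ, ProjWeights.opL_add, ProjWeights.opL_smul, ProjWeights.opL_add,
      ProjWeights.opL_smul, hM, hD, hex, hes, hξ, hζ, hu]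
    ext i
    simp only [Pi.sub_apply, Pi.add_apply, Pi.smul_apply, Pi.mul_apply, Pi.one_apply,
      smul_eq_mul, O]
    ring
  -- The change of μ moves every coordinate alike. The all-ones vector has norm of order √n/α (`sn`
  -- stands for √n) and |ρ|√n ≤ εγ, so the cost is (15/240)αγ.
  have nρ : mixedNorm α τb ((-ρ) • O) ≤ 7 / 100 * (α * γ) := by
    rw [mixedNorm_smul, abs_neg]
    have h1 := mul_le_mul_of_nonneg_left hone (abs_nonneg ρ)
    have h2 : |ρ| * (15 * sn / α) = 15 / α * (|ρ| * sn) := by ring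
    have h3 : 15 / α * (|ρ| * sn) ≤ 15 / α * (ε * γ) :=
      mul_le_mul_of_nonneg_left hρ (by positivity)
    have h4 : 15 / α * (ε * γ) = 15 / 240 * (α * γ) := by rw [h.ε_eq]; field_simp
    linarith
  -- Of the gain 1.5α in the main term, the perturbations use 0.06α for δ_c, 0.07α for ρ and 31ε,
  -- below 0.03α, for the approximations.
  have nlg : mixedNorm α τb (lin - g) ≤ (1 - 13 / 10 * α) * γ := by
    rw [hsplit]
    have a1 := mixedNorm_add_le hα htb M (D + (ex + (es + ((-1 : ℝ) • opL P τ η + (-ρ) • O))))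
    have a2 := mixedNorm_add_le hα htb D (ex + (es + ((-1 : ℝ) • opL P τ η + (-ρ) • O)))
    have a3 := mixedNorm_add_le hα htb ex (es + ((-1 : ℝ) • opL P τ η + (-ρ) • O))
    have a4 := mixedNorm_add_le hα htb es ((-1 : ℝ) • opL P τ η + (-ρ) • O)
    have a5 := mixedNorm_add_le hα htb ((-1 : ℝ) • opL P τ η) ((-ρ) • O)
    rw [mixedNorm_smul (-1), abs_neg, abs_one, one_mul] at a5
    have b1 := h.mixedNorm_main_le
    have b2 := h.mixedNorm_dc_part_le
    linarith
  have nlin : mixedNorm α τb lin ≤ 2 * γ := by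
    have := mixedNorm_add_le hα htb (lin - g) g
    rw [sub_add_cancel] at this
    have := h.g_norm
    linarith
  refine ⟨nlin, ?_⟩
  have e : v * lin - g = (v - 1) * lin + (lin - g) := by
    rw [sub_mul, one_mul]; abel
  rw [e]
  refine (mixedNorm_add_le hα htb _ _).trans ?_
  have h1 := mixedNorm_mul_le hα htb (v - 1) lin
  have h2 : ‖v - 1‖ ≤ 2 * ε := pi_norm_le (by positivity) hv
  have h3 := mul_le_mul h2 nlin (mixedNorm_nonneg hα _) (by positivity)
  linarith

/-- The expected second order terms are of order `γ²` in the mixed norm. -/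
lemma mixedNorm_second_moment_le (h : StepBounds α ε γ P τ τb g dp dc) {ρ sn k : ℝ}
    (hsn : 1 ≤ sn) (hone : mixedNorm α τb (fun _ => 1) ≤ 15 * sn / α) (hρ : |ρ| * sn ≤ ε * γ)
    (hk0 : 0 ≤ k) (hk : k * sn ≤ wNorm τ ((1 + 2 * α) • dp + dc) ^ 2) {ES : Fin m → ℝ}
    (hES0 : ∀ i, 0 ≤ ES i)
    (hES : ∀ i, ES i ≤ 4 * g i ^ 2 + 21 / 10 * (((1 + 2 * α) • dp + dc) i ^ 2 + k)
      + 11 / 10 * dp i ^ 2) :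
    mixedNorm α τb (ES + opB P τ ES + fun _ => ρ ^ 2) ≤ 40 * γ ^ 2 := by
  have hα := h.α_pos
  have hα' := h.α_le
  have hε := h.ε_pos
  have hε' := h.ε_le
  have hγ := h.γ_pos
  have htb := h.tb_nonneg
  set dr := (1 + 2 * α) • dp + dc with hdr
  set O : Fin m → ℝ := fun _ => 1
  -- For an entrywise square, one factor is measured in sup norm and the other in mixed norm.
  have sq_le : ∀ (w : Fin m → ℝ) (K : ℝ), mixedNorm α τb w ≤ K * γ → 0 ≤ K →
      mixedNorm α τb (w * w) ≤ K ^ 2 * γ ^ 2 := fun w K hw hK => by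
    refine (mixedNorm_mul_le hα htb w w).trans ?_
    have := mul_le_mul ((norm_le_mixedNorm hα w).trans hw) hw (mixedNorm_nonneg hα _)
      (by positivity)
    linarith
  have n1 := sq_le g 1 (by linarith [h.g_norm]) (by norm_num)
  have n2 := sq_le dr (8 / 5) h.mixedNorm_dr_le (by norm_num)
  have n3 := sq_le dp (11 / 10) h.mixedNorm_dp_le (by norm_num)
  -- The constant variance term has `k` of order W²/√n, where W is the τ-norm of δ_r. Its √n cancels
  -- that of the all-ones vector, and W² = O(α²γ²) beats the 1/α.
  have nk : mixedNorm α τb (k • O) ≤ 7 / 100 * γ ^ 2 := by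
    rw [mixedNorm_smul, abs_of_nonneg hk0]
    have h1 := mul_le_mul_of_nonneg_left hone hk0
    have h2 : k * (15 * sn / α) = 15 / α * (k * sn) := by ring
    have h3 : wNorm τ dr ^ 2 ≤ (15 / 100 * α * γ) ^ 2 :=
      pow_le_pow_left₀ (wNorm_nonneg _ _) h.wNorm_dr_le 2
    have h4 : 15 / α * (k * sn) ≤ 15 / α * (15 / 100 * α * γ) ^ 2 :=
      mul_le_mul_of_nonneg_left (hk.trans h3) (by positivity)
    have h5 : 15 / α * (15 / 100 * α * γ) ^ 2 = 15 * (15 / 100) ^ 2 * α * γ ^ 2 := by field_simp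
    have h6 : 0 ≤ γ ^ 2 := by positivity
    nlinarith
  have nES : mixedNorm α τb ES ≤ 12 * γ ^ 2 := by
    have hle : mixedNorm α τb ES ≤ mixedNorm α τb ((4 : ℝ) • (g * g) + ((21 / 10 : ℝ) • (dr * dr)
        + ((21 / 10 : ℝ) • (k • O) + (11 / 10 : ℝ) • (dp * dp)))) := by
      refine mixedNorm_mono hα htb fun i => ?_
      rw [abs_of_nonneg (hES0 i)]
      refine le_trans ?_ (le_abs_self _)
      refine (hES i).trans (le_of_eq ?_)
      simp only [Pi.add_apply, Pi.smul_apply, Pi.mul_apply, smul_eq_mul, O]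
      ring
    refine hle.trans ?_
    have a1 := mixedNorm_add_le hα htb ((4 : ℝ) • (g * g)) ((21 / 10 : ℝ) • (dr * dr)
        + ((21 / 10 : ℝ) • (k • O) + (11 / 10 : ℝ) • (dp * dp)))
    have a2 := mixedNorm_add_le hα htb ((21 / 10 : ℝ) • (dr * dr))
        ((21 / 10 : ℝ) • (k • O) + (11 / 10 : ℝ) • (dp * dp))
    have a3 := mixedNorm_add_le hα htb ((21 / 10 : ℝ) • (k • O)) ((11 / 10 : ℝ) • (dp * dp))
    rw [mixedNorm_smul 4] at a1
    rw [mixedNorm_smul (21 / 10) (dr * dr)] at a2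
    rw [mixedNorm_smul (21 / 10) (k • O), mixedNorm_smul (11 / 10)] at a3
    norm_num [abs_of_pos] at a1 a2 a3
    have : 0 ≤ γ ^ 2 := by positivity
    linarith
  have nB := (h.mixedNorm_opB_le ES).trans (mul_le_mul_of_nonneg_left nES (by norm_num))
  have nρ : mixedNorm α τb (fun _ => ρ ^ 2) ≤ 1 / 10 * γ ^ 2 := by
    have e : (fun _ => ρ ^ 2 : Fin m → ℝ) = (ρ ^ 2) • O := by ext; simp [O]
    rw [e, mixedNorm_smul, abs_of_nonneg (sq_nonneg ρ)]
    have h1 := mul_le_mul_of_nonneg_left hone (sq_nonneg ρ)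
    have h2 : ρ ^ 2 * (15 * sn / α) = 15 / α * (|ρ| * (|ρ| * sn)) := by
      rw [← sq_abs]; ring
    have hρ1 : |ρ| ≤ ε * γ := by
      refine le_trans ?_ hρ
      exact le_mul_of_one_le_right (abs_nonneg _) hsn
    have h3 : |ρ| * (|ρ| * sn) ≤ (ε * γ) * (ε * γ) :=
      mul_le_mul hρ1 hρ (by positivity) (by positivity)
    have h4 := mul_le_mul_of_nonneg_left h3 (by positivity : 0 ≤ 15 / α)
    have h5 : 15 / α * ((ε * γ) * (ε * γ)) = 15 / 240 * α * ε * γ ^ 2 := by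
      nth_rw 1 [h.ε_eq]; field_simp
    have h6 : 15 / 240 * α * ε ≤ 1 / 10 := by nlinarith
    have := mul_le_mul_of_nonneg_right h6 (sq_nonneg γ)
    linarith
  have a1 := mixedNorm_add_le hα htb (ES + opB P τ ES) (fun _ => ρ ^ 2)
  have a2 := mixedNorm_add_le hα htb ES (opB P τ ES)
  have : 0 ≤ γ ^ 2 := by positivity
  linarith

end StepBounds

end Drift

/-! ### The potential -/

section Potential

variable {m : ℕ}

lemma phi_eq_cosh (lam t : ℝ) : phi lam t = 2 * Real.cosh (lam * (t - 1)) := by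
  rw [phi, Real.cosh_eq, neg_mul]; ring

lemma phi_pos (lam t : ℝ) : 0 < phi lam t := by
  rw [phi_eq_cosh]; have := Real.cosh_pos (lam * (t - 1)); positivity

lemma potentialGrad_eq (lam : ℝ) (v : Fin m → ℝ) (i : Fin m) :
    potentialGrad lam v i = 2 * lam * Real.sinh (lam * (v i - 1)) := by
  have h : phi lam = fun t => 2 * Real.cosh (lam * (t - 1)) := funext (phi_eq_cosh lam)
  have h1 : HasDerivAt (fun t : ℝ => lam * (t - 1)) lam (v i) := by
    simpa using ((hasDerivAt_id (v i)).sub_const 1).const_mul lam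
  have h2 := (h1.cosh).const_mul 2
  rw [potentialGrad, h, h2.deriv]; ring

lemma cosh_add_sub_le (a : ℝ) {x : ℝ} (hx : |x| ≤ 1) :
    Real.cosh (a + x) ≤ Real.cosh a + Real.sinh a * x + Real.cosh a * x ^ 2 := by
  have key : ∀ y, |y| ≤ 1 → Real.exp y ≤ 1 + y + y ^ 2 := fun y hy => by
    have := (abs_le.1 (abs_exp_sub_one_sub_le hy)).2; linarith
  have h1 := key x hx
  have h2 := key (-x) (by rwa [abs_neg])
  have e1 : Real.cosh (a + x) = (Real.exp a * Real.exp x + Real.exp (-a) * Real.exp (-x)) / 2 := by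
    rw [Real.cosh_eq, neg_add, Real.exp_add, Real.exp_add]
  have h3 := mul_le_mul_of_nonneg_left h1 (Real.exp_pos a).le
  have h4 := mul_le_mul_of_nonneg_left h2 (Real.exp_pos (-a)).le
  rw [e1, Real.cosh_eq, Real.sinh_eq]
  nlinarith

lemma abs_sinh_le_cosh (a : ℝ) : |Real.sinh a| ≤ Real.cosh a := by
  rw [abs_le]
  refine ⟨?_, (Real.sinh_lt_cosh a).le⟩
  have := Real.sinh_lt_cosh (-a)
  rw [Real.sinh_neg, Real.cosh_neg] at this
  linarith

lemma cosh_le_abs_sinh_add_one (a : ℝ) : Real.cosh a ≤ |Real.sinh a| + 1 := by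
  refine abs_le_of_sq_le_sq' ?_ (by positivity) |>.2
  have := Real.cosh_sq a
  nlinarith [sq_abs (Real.sinh a), abs_nonneg (Real.sinh a)]

lemma cosh_add_le (a : ℝ) {x : ℝ} (hx : |x| ≤ 1 / 100) :
    Real.cosh (a + x) ≤ 101 / 100 * (101 / 100) * Real.cosh a := by
  have h := cosh_add_sub_le a (hx.trans (by norm_num))
  have h1 := abs_sinh_le_cosh a
  have h2 : Real.sinh a * x ≤ Real.cosh a * (1 / 100) := by
    refine (le_abs_self _).trans ?_
    rw [abs_mul]
    exact mul_le_mul h1 hx (abs_nonneg _) (Real.cosh_pos a).le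
  have h3 : x ^ 2 ≤ 1 / 10000 := by
    rw [← sq_abs]; nlinarith [abs_nonneg x]
  have := Real.cosh_pos a
  nlinarith

lemma abs_sinh_add_sub_le (a : ℝ) {x : ℝ} (hx : |x| ≤ 1 / 100) :
    |Real.sinh (a + x) - Real.sinh a| ≤ 2 * |x| * Real.cosh a := by
  have key : ∀ y, |y| ≤ 1 / 100 → |Real.exp y - 1| ≤ 2 * |y| := fun y hy => by
    exact Real.abs_exp_sub_one_le (hy.trans (by norm_num))
  have h1 := key x hx
  have h2 := key (-x) (by rwa [abs_neg])
  rw [abs_neg] at h2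
  have e : Real.sinh (a + x) - Real.sinh a
      = (Real.exp a * (Real.exp x - 1) - Real.exp (-a) * (Real.exp (-x) - 1)) / 2 := by
    rw [Real.sinh_eq, Real.sinh_eq, neg_add, Real.exp_add, Real.exp_add]; ring
  rw [e, Real.cosh_eq, abs_div, abs_two]
  have h3 := abs_sub (Real.exp a * (Real.exp x - 1)) (Real.exp (-a) * (Real.exp (-x) - 1))
  rw [abs_mul, abs_mul, Real.abs_exp, Real.abs_exp] at h3
  have h4 := mul_le_mul_of_nonneg_left h1 (Real.exp_pos a).le
  have h5 := mul_le_mul_of_nonneg_left h2 (Real.exp_pos (-a)).le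
  linarith

lemma cubeExp_opL (p : Fin m → ℝ) (P : Matrix (Fin m) (Fin m) ℝ) (τ : Fin m → ℝ)
    (u : (Fin m → Bool) → Fin m → ℝ) (i : Fin m) :
    cubeExp p (fun c => opL P τ (u c) i) = opL P τ (fun j => cubeExp p fun c => u c j) i := by
  have e : ∀ c, opL P τ (u c) i = (τ i)⁻¹ * (P i i * u c i - ∑ j, P i j ^ 2 * u c j) := fun c => by
    rw [opL]; ring
  simp only [e]
  rw [cubeExp_const_mul, cubeExp_sub, cubeExp_const_mul, cubeExp_sum, opL]
  simp only [cubeExp_const_mul]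
  ring

lemma cubeExp_opB (p : Fin m → ℝ) (P : Matrix (Fin m) (Fin m) ℝ) (τ : Fin m → ℝ)
    (u : (Fin m → Bool) → Fin m → ℝ) (i : Fin m) :
    cubeExp p (fun c => opB P τ (u c) i) = opB P τ (fun j => cubeExp p fun c => u c j) i := by
  have e : ∀ c, opB P τ (u c) i = (τ i)⁻¹ * (P i i * u c i + ∑ j, P i j ^ 2 * u c j) := fun c => by
    rw [opB]; ring
  simp only [e]
  rw [cubeExp_const_mul, cubeExp_add, cubeExp_const_mul, cubeExp_sum, opB]
  simp only [cubeExp_const_mul]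
  ring

/-- The expected potential of one coordinate. -/
lemma cubeExp_phi_le {p : Fin m → ℝ} (h0 : ∀ i, 0 ≤ p i) (h1 : ∀ i, p i ≤ 1)
    {lam ε γ v vb f l q : ℝ} {d lin Q : (Fin m → Bool) → ℝ} (hε : 0 ≤ ε) (hε' : ε ≤ 1 / 6000)
    (hγ : 0 < γ) (hlam : 1000 ≤ lam) (hlg : lam * γ = ε / 100) (hv : |v - 1| ≤ 2 * ε)
    (hvb : |v - vb| ≤ γ) (hf : f = 2 * lam * Real.sinh (lam * (vb - 1)))
    (hl : l = cubeExp p lin) (hq : q = cubeExp p Q) (hd1 : ∀ c, |d c - lin c| ≤ 210 * Q c)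
    (hd2 : ∀ c, d c ^ 2 ≤ 120 * Q c) (hd3 : ∀ c, |d c| ≤ 60 * γ) :
    cubeExp p (fun c => phi lam (v * (1 + d c))) ≤ phi lam v + f * (v * l)
      + (|f| + 2 * lam) * (3 / 100 * ε * |l| + 125 * lam * q) := by
  have hlam0 : 0 < lam := by linarith
  have hv' := abs_le.1 hv
  have hv0 : 0 ≤ v := by linarith
  have hv1 : v ≤ 1001 / 1000 := by linarith
  have hq0 : 0 ≤ q := by
    rw [hq]; exact cubeExp_nonneg h0 h1 fun c => by have := hd2 c; nlinarith [sq_nonneg (d c)]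
  set a := lam * (v - 1) with ha
  set ab := lam * (vb - 1) with hab
  -- This is the reason for γ = ε/(100λ): the accuracy of `vb` changes the argument of the potential
  -- by at most ε/100, so derivatives at `v` and at `vb` agree up to a relative error of order ε.
  have hx : |lam * (v - vb)| ≤ ε / 100 := by
    rw [abs_mul, abs_of_pos hlam0, ← hlg]
    exact mul_le_mul_of_nonneg_left hvb hlam0.le
  have hx1 : |lam * (v - vb)| ≤ 1 / 100 := hx.trans (by linarith)
  have ea : a = ab + lam * (v - vb) := by rw [ha, hab]; ring
  -- As cosh ≤ |sinh| + 1, the quantity `|f| + 2 * lam` dominates 2λ cosh at `vb`, and at `v` up to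
  -- a constant. It thus controls the second derivative through the gradient.
  have hcab : 2 * lam * Real.cosh ab ≤ |f| + 2 * lam := by
    rw [hf, abs_mul, abs_of_pos (by positivity : 0 < 2 * lam)]
    have := mul_le_mul_of_nonneg_left (cosh_le_abs_sinh_add_one ab)
      (by positivity : 0 ≤ 2 * lam)
    linarith
  have hca : 2 * lam * Real.cosh a ≤ 101 / 100 * (101 / 100) * (|f| + 2 * lam) := by
    have h := cosh_add_le ab hx1
    rw [← ea] at h
    have := mul_le_mul_of_nonneg_left h (by positivity : 0 ≤ 2 * lam)
    linarith
  have hsa : |2 * lam * Real.sinh a - f| ≤ ε / 50 * (|f| + 2 * lam) := by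
    have h := abs_sinh_add_sub_le ab hx1
    rw [← ea] at h
    have e : 2 * lam * Real.sinh a - f = 2 * lam * (Real.sinh a - Real.sinh ab) := by
      rw [hf]; ring
    rw [e, abs_mul, abs_of_pos (by positivity : 0 < 2 * lam)]
    have h2 := mul_le_mul_of_nonneg_left h (by positivity : 0 ≤ 2 * lam)
    have h3 : 2 * |lam * (v - vb)| ≤ ε / 50 := by linarith
    have h4 := mul_le_mul h3 hcab (mul_nonneg (by positivity) (Real.cosh_pos ab).le)
      (by positivity)
    linarith
  have hpt : ∀ c, phi lam (v * (1 + d c)) ≤ phi lam v + 2 * lam * Real.sinh a * v * d c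
      + 122 * lam * (101 / 100 * (101 / 100) * (|f| + 2 * lam)) * Q c := fun c => by
    have hxd : |lam * (v * d c)| ≤ 1 := by
      rw [abs_mul, abs_mul, abs_of_pos hlam0, abs_of_nonneg hv0]
      have : v * |d c| ≤ 1001 / 1000 * (60 * γ) :=
        mul_le_mul hv1 (hd3 c) (abs_nonneg _) (by norm_num)
      have := mul_le_mul_of_nonneg_left this hlam0.le
      nlinarith
    have h := cosh_add_sub_le a hxd
    have e : a + lam * (v * d c) = lam * (v * (1 + d c) - 1) := by rw [ha]; ring
    rw [e] at h
    rw [phi_eq_cosh, phi_eq_cosh, ← ha]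
    have h2 : 2 * Real.cosh a * (lam * (v * d c)) ^ 2
        ≤ 122 * lam * (101 / 100 * (101 / 100) * (|f| + 2 * lam)) * Q c := by
      have e2 : 2 * Real.cosh a * (lam * (v * d c)) ^ 2
        = (2 * lam * Real.cosh a) * (lam * (v ^ 2 * d c ^ 2)) := by ring
      have h3 : v ^ 2 * d c ^ 2 ≤ 122 * Q c := by
        have : v ^ 2 ≤ 101 / 100 := by nlinarith
        have := mul_le_mul this (hd2 c) (sq_nonneg _) (by norm_num)
        nlinarith [sq_nonneg (d c), hd2 c]
      rw [e2]
      have := mul_le_mul hca (mul_le_mul_of_nonneg_left h3 hlam0.le) (by positivity)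
        (by positivity)
      linarith
    linarith
  have hE := cubeExp_mono h0 h1 hpt
  rw [cubeExp_add, cubeExp_add, cubeExp_const, cubeExp_const_mul, cubeExp_const_mul, ← hq] at hE
  have hdl : |cubeExp p d - l| ≤ 210 * q := by
    rw [hl, hq, ← cubeExp_sub, ← cubeExp_const_mul]
    exact abs_cubeExp_le h0 h1 hd1
  set D := cubeExp p d
  have hD : |D| ≤ |l| + 210 * q := by
    have e : D = (D - l) + l := by ring
    rw [e]; exact (abs_add_le _ _).trans (by linarith)
  have t1 : 2 * lam * Real.sinh a * v * D ≤ f * (v * l) + |f| * (212 * q)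
      + (|f| + 2 * lam) * (ε / 50 * (1001 / 1000) * (|l| + 210 * q)) := by
    have e : 2 * lam * Real.sinh a * v * D = f * (v * l) + f * (v * (D - l))
        + (2 * lam * Real.sinh a - f) * (v * D) := by ring
    rw [e]
    have s1 : f * (v * (D - l)) ≤ |f| * (212 * q) := by
      refine (le_abs_self _).trans ?_
      rw [abs_mul, abs_mul, abs_of_nonneg hv0]
      refine mul_le_mul_of_nonneg_left ?_ (abs_nonneg _)
      have := mul_le_mul hv1 hdl (abs_nonneg _) (by norm_num)
      linarith
    have s2 : (2 * lam * Real.sinh a - f) * (v * D)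
        ≤ (|f| + 2 * lam) * (ε / 50 * (1001 / 1000) * (|l| + 210 * q)) := by
      refine (le_abs_self _).trans ?_
      rw [abs_mul, abs_mul, abs_of_nonneg hv0]
      have := mul_le_mul hsa (mul_le_mul hv1 hD (abs_nonneg _) (by norm_num)) (by positivity)
        (by positivity)
      linarith
    linarith
  have hfl : 0 ≤ |f| + 2 * lam := by positivity
  have t2 : |f| * (212 * q) ≤ (|f| + 2 * lam) * (212 * q) :=
    mul_le_mul_of_nonneg_right (by linarith) (by positivity)
  have t3 : (|f| + 2 * lam) * (212 * q)
      + (|f| + 2 * lam) * (ε / 50 * (1001 / 1000) * (|l| + 210 * q))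
      + 122 * lam * (101 / 100 * (101 / 100) * (|f| + 2 * lam)) * q
      ≤ (|f| + 2 * lam) * (3 / 100 * ε * |l| + 125 * lam * q) := by
    have e : (|f| + 2 * lam) * (212 * q)
      + (|f| + 2 * lam) * (ε / 50 * (1001 / 1000) * (|l| + 210 * q))
      + 122 * lam * (101 / 100 * (101 / 100) * (|f| + 2 * lam)) * q
      = (|f| + 2 * lam) * (212 * q + ε / 50 * (1001 / 1000) * (|l| + 210 * q)
        + 122 * (101 / 100 * (101 / 100)) * lam * q) := by ring
    rw [e]
    refine mul_le_mul_of_nonneg_left ?_ hfl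
    have u1 : 0 ≤ ε * |l| := by positivity
    have u2 : ε * q ≤ 1 / 6000 * q := mul_le_mul_of_nonneg_right hε' hq0
    have u3 : 1000 * q ≤ lam * q := mul_le_mul_of_nonneg_right hlam hq0
    linarith
  linarith

variable {α ε γ : ℝ} {P : Matrix (Fin m) (Fin m) ℝ} {τ τb g dp dc : Fin m → ℝ}

/-- The expected potential after a step. -/
lemma StepBounds.sum_cubeExp_phi_le (h : StepBounds α ε γ P τ τb g dp dc)
    {p : Fin m → ℝ} (h0 : ∀ i, 0 ≤ p i) (h1 : ∀ i, p i ≤ 1) {lam r sn : ℝ} (hlam : 1000 ≤ lam)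
    (hlg : lam * γ = ε / 100) (hsn : 1 ≤ sn) (hr : r * sn = ε * γ)
    (hone : mixedNorm α τb (fun _ => 1) ≤ 15 * sn / α)
    {v vb flat : Fin m → ℝ} (hv : ∀ i, |v i - 1| ≤ 2 * ε) (hvb : ∀ i, |v i - vb i| ≤ γ)
    (hflat : IsDualVector α τb (potentialGrad lam vb) flat) (hg : g = -γ • flat)
    {d lin Q : (Fin m → Bool) → Fin m → ℝ}
    (hd1 : ∀ c i, |d c i - lin c i| ≤ 210 * Q c i) (hd2 : ∀ c i, d c i ^ 2 ≤ 120 * Q c i)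
    (hd3 : ∀ c i, |d c i| ≤ 60 * γ)
    (hlin : mixedNorm α τb (fun i => cubeExp p fun c => lin c i) ≤ 2 * γ)
    (hlin2 : mixedNorm α τb (v * (fun i => cubeExp p fun c => lin c i) - g) ≤ (1 - α) * γ)
    (hQ : mixedNorm α τb (fun i => cubeExp p fun c => Q c i) ≤ 40 * γ ^ 2) :
    cubeExp p (fun c => ∑ i, phi lam (v i * (1 + d c i))) ≤
      (1 - lam * r) * ∑ i, phi lam (v i) + 2 * m := by
  have hα := h.α_pos
  have hα' := h.α_le
  have hε := h.ε_pos
  have hε' := h.ε_le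
  have hγ := h.γ_pos
  have htb := h.tb_nonneg
  have hlam0 : 0 < lam := by linarith
  set f := potentialGrad lam vb with hf
  set l : Fin m → ℝ := fun i => cubeExp p fun c => lin c i with hl
  set q : Fin m → ℝ := fun i => cubeExp p fun c => Q c i with hq
  set F := f ⬝ᵥ flat with hF
  have hF0 : 0 ≤ F := hflat.dotProduct_nonneg
  have hq0 : ∀ i, 0 ≤ q i := fun i => cubeExp_nonneg h0 h1 fun c => by
    have := hd2 c i; nlinarith [sq_nonneg (d c i)]
  set X : Fin m → ℝ := (3 / 100 * ε) • (fun i => |l i|) + (125 * lam) • q with hX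
  have hX0 : ∀ i, 0 ≤ X i := fun i => by
    have := hq0 i
    simp only [hX, Pi.add_apply, Pi.smul_apply, smul_eq_mul]; positivity
  have nX : mixedNorm α τb X ≤ 51 * (ε * γ) := by
    refine (mixedNorm_add_le hα htb _ _).trans ?_
    rw [mixedNorm_smul, mixedNorm_smul, abs_of_pos (by positivity), abs_of_pos (by positivity)]
    have e1 : mixedNorm α τb (fun i => |l i|) ≤ 2 * γ :=
      (mixedNorm_mono hα htb fun i => by rw [abs_abs]).trans hlin
    have e2 := mul_le_mul_of_nonneg_left e1 (by positivity : 0 ≤ 3 / 100 * ε)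
    have e3 := mul_le_mul_of_nonneg_left hQ (by positivity : 0 ≤ 125 * lam)
    have e4 : 125 * lam * (40 * γ ^ 2) = 50 * (ε * γ) := by
      have : 125 * lam * (40 * γ ^ 2) = 5000 * (lam * γ) * γ := by ring
      rw [this, hlg]; ring
    have : 0 ≤ ε * γ := by positivity
    linarith
  have hcoord : ∀ i, cubeExp p (fun c => phi lam (v i * (1 + d c i))) ≤
      phi lam (v i) + f i * (v i * l i) + (|f i| + 2 * lam) * X i := fun i => by
    refine (cubeExp_phi_le h0 h1 hε.le (by linarith) hγ hlam hlg (hv i) (hvb i)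
      (potentialGrad_eq lam vb i) rfl rfl (fun c => hd1 c i) (fun c => hd2 c i)
      (fun c => hd3 c i)).trans (le_of_eq ?_)
    simp only [hX, Pi.add_apply, Pi.smul_apply, smul_eq_mul, hl, hq, hf]
  rw [cubeExp_sum]
  have hsum := Finset.sum_le_sum fun i (_ : i ∈ Finset.univ) => hcoord i
  simp only [Finset.sum_add_distrib, add_mul] at hsum
  -- The pairing with g contributes -γF, and the deviation of the drift from g at most (1 - α)γF.
  have s1 : ∑ i, f i * (v i * l i) ≤ -(α * γ) * F := by
    have e1 : ∑ i, f i * (v i * l i) = f ⬝ᵥ g + f ⬝ᵥ (v * l - g) := by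
      rw [← dotProduct_add, add_sub_cancel]; rfl
    have e2 : f ⬝ᵥ g = -γ * F := by rw [hg, dotProduct_smul, smul_eq_mul]
    have e3 := hflat.dotProduct_le hα (v * l - g)
    have e4 := mul_le_mul_of_nonneg_left hlin2 hF0
    rw [e1, e2]
    linarith
  have s2 : ∑ i, |f i| * X i ≤ F * (51 * (ε * γ)) := by
    have := hflat.sum_abs_mul_le hα htb X
    simp only [abs_of_nonneg (hX0 _)] at this
    exact this.trans (mul_le_mul_of_nonneg_left nX hF0)
  have hlr : lam * r ≤ ε ^ 2 / 100 := by
    have : lam * r * sn = ε ^ 2 / 100 := by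
      have : lam * r * sn = lam * (r * sn) := by ring
      rw [this, hr]
      have : lam * (ε * γ) = ε * (lam * γ) := by ring
      rw [this, hlg]; ring
    rw [← this]
    refine le_mul_of_one_le_right ?_ hsn
    have hr0 : 0 ≤ r := by
      by_contra! hc
      have : 0 < ε * γ := by positivity
      nlinarith
    positivity
  have hlr0 : 0 ≤ lam * r := by
    have hr0 : 0 ≤ r := by
      by_contra! hc
      have : 0 < ε * γ := by positivity
      nlinarith
    positivity
  have hε2 : ε ^ 2 ≤ 1 / 10000 := by nlinarith
  -- The part of the error not proportional to |f| is bounded coordinatewise and goes into the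
  -- additive 2m.
  have s3 : ∑ i, 2 * lam * X i ≤ 11 / 10 * m / 100 := by
    have : ∀ i ∈ (Finset.univ : Finset (Fin m)), 2 * lam * X i ≤ 11 / 1000 := fun i _ => by
      have h1 : X i ≤ 51 * (ε * γ) := (le_abs_self _).trans
        ((abs_apply_le_norm X i).trans ((norm_le_mixedNorm hα X).trans nX))
      have h2 := mul_le_mul_of_nonneg_left h1 (by positivity : 0 ≤ 2 * lam)
      have h3 : 2 * lam * (51 * (ε * γ)) = 102 * ε * (lam * γ) := by ring
      rw [h3, hlg] at h2
      nlinarith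
    have := Finset.sum_le_sum this
    simp only [Finset.sum_const, Finset.card_univ, Fintype.card_fin, nsmul_eq_mul] at this
    linarith
  -- lower bound on the dual norm of the gradient
  have s4 : lam * (98 / 100 * ∑ i, phi lam (v i) - 2 * m) ≤ F * (15 * sn / α) := by
    have e1 := hflat.sum_abs_mul_le hα htb (fun _ => 1)
    simp only [abs_one, mul_one] at e1
    have e2 := mul_le_mul_of_nonneg_left hone hF0
    refine le_trans ?_ (e1.trans e2)
    have e3 : ∀ i ∈ (Finset.univ : Finset (Fin m)),
        lam * (98 / 100 * phi lam (v i)) - lam * 2 ≤ |f i| := fun i _ => by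
      have hx1 : |lam * (v i - vb i)| ≤ 1 / 100 := by
        rw [abs_mul, abs_of_pos hlam0]
        have := mul_le_mul_of_nonneg_left (hvb i) hlam0.le
        linarith
      have a1 := cosh_add_le (lam * (vb i - 1)) hx1
      have ea : lam * (vb i - 1) + lam * (v i - vb i) = lam * (v i - 1) := by ring
      rw [ea] at a1
      have a2 := cosh_le_abs_sinh_add_one (lam * (vb i - 1))
      rw [hf, potentialGrad_eq, abs_mul, abs_of_pos (by positivity : 0 < 2 * lam), phi_eq_cosh]
      have a3 : 98 / 100 * (2 * Real.cosh (lam * (v i - 1))) - 2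
          ≤ 2 * |Real.sinh (lam * (vb i - 1))| := by
        have := Real.cosh_pos (lam * (vb i - 1))
        linarith
      have := mul_le_mul_of_nonneg_left a3 hlam0.le
      linarith
    have e4 := Finset.sum_le_sum e3
    rw [Finset.sum_sub_distrib, ← Finset.mul_sum, ← Finset.mul_sum] at e4
    simp only [Finset.sum_const, Finset.card_univ, Fintype.card_fin, nsmul_eq_mul] at e4
    linarith
  set Φ := ∑ i, phi lam (v i) with hΦ
  have hΦ0 : 0 ≤ Φ := Finset.sum_nonneg fun i _ => (phi_pos lam (v i)).le
  have hm0 : (0 : ℝ) ≤ m := Nat.cast_nonneg m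
  have hsn0 : 0 < sn := by linarith
  have s5 : F * (51 * (ε * γ)) ≤ α / 2 * γ * F := by
    have : 51 * ε ≤ α / 2 := by linarith
    have := mul_le_mul_of_nonneg_right this (mul_nonneg hγ.le hF0)
    linarith
  -- Half of the gain αγF remains. Inserting the lower bound for F and r = α²γ/(240√n) gives the
  -- factor 8 = 240/30, more than the decrease λrΦ requires.
  have s6 : 8 * (lam * r) * (98 / 100 * Φ - 2 * m) ≤ α / 2 * γ * F := by
    have e1 : r = α ^ 2 / 240 * γ / sn := by
      rw [eq_div_iff hsn0.ne', hr, h.ε_eq]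
    have e2 := mul_le_mul_of_nonneg_left s4 (by positivity : 0 ≤ α ^ 2 * γ / (30 * sn))
    have e3 : α ^ 2 * γ / (30 * sn) * (F * (15 * sn / α)) = α / 2 * γ * F := by
      field_simp; ring
    have e4 : α ^ 2 * γ / (30 * sn) * (lam * (98 / 100 * Φ - 2 * m))
        = 8 * (lam * r) * (98 / 100 * Φ - 2 * m) := by
      rw [e1]; field_simp; ring
    linarith
  have s7 : lam * r * m ≤ 1 / 1000000 * m := mul_le_mul_of_nonneg_right (by linarith) hm0
  have s8 : 0 ≤ lam * r * Φ := by positivity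
  linarith

end Potential

/-! ### The parameters -/

section Params

variable {m n : ℕ}

lemma log_four_ge : (5 / 4 : ℝ) ≤ Real.log 4 := by
  have : (4 : ℝ) = 2 ^ 2 := by norm_num
  rw [this, Real.log_pow]
  have := Real.log_two_gt_d9
  push_cast; linarith

lemma log_ratio_ge (hn : 0 < n) (hnm : n ≤ m) : 5 / 4 ≤ Real.log (4 * m / n) := by
  refine log_four_ge.trans (Real.log_le_log (by norm_num) ?_)
  have h1 : (0 : ℝ) < n := by exact_mod_cast hn
  have h2 : (n : ℝ) ≤ m := by exact_mod_cast hnm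
  rw [le_div_iff₀ h1]; linarith

lemma lsAlpha_pos (hn : 0 < n) (hnm : n ≤ m) : 0 < lsAlpha m n := by
  have := log_ratio_ge hn hnm
  rw [lsAlpha]; positivity

lemma lsAlpha_le (hn : 0 < n) (hnm : n ≤ m) : lsAlpha m n ≤ 1 / 5 := by
  have := log_ratio_ge hn hnm
  rw [lsAlpha, div_le_div_iff₀ (by positivity) (by norm_num)]
  linarith

lemma lsEps_pos (hn : 0 < n) (hnm : n ≤ m) : 0 < lsEps m n := by
  have := lsAlpha_pos hn hnm
  rw [lsEps]; positivity

lemma lsEps_le (hn : 0 < n) (hnm : n ≤ m) : lsEps m n ≤ 1 / 6000 := by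
  have := lsAlpha_pos hn hnm
  have := lsAlpha_le hn hnm
  rw [lsEps]; nlinarith

lemma one_le_cast (hn : 0 < n) (hnm : n ≤ m) : (1 : ℝ) ≤ m := by
  exact_mod_cast hn.trans_le hnm

lemma lsArg_ge (hn : 0 < n) (hnm : n ≤ m) : 400 * m ≤ 400 * m / lsEps m n ^ 2 := by
  have h1 := lsEps_pos hn hnm
  have h2 := lsEps_le hn hnm
  have h3 := one_le_cast hn hnm
  rw [le_div_iff₀ (by positivity)]
  exact mul_le_of_le_one_right (by positivity) (by nlinarith)

lemma lsLog_ge (hn : 0 < n) (hnm : n ≤ m) : 1 ≤ Real.log (400 * m / lsEps m n ^ 2) := by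
  have h3 := one_le_cast hn hnm
  have h4 := lsArg_ge hn hnm
  rw [Real.le_log_iff_exp_le (by linarith)]
  have := Real.exp_one_lt_d9
  linarith

lemma lsLam_mul_eps (hn : 0 < n) (hnm : n ≤ m) :
    lsLam m n * lsEps m n = 36 * Real.log (400 * m / lsEps m n ^ 2) := by
  have h1 := lsEps_pos hn hnm
  rw [lsLam]; field_simp

lemma lsLam_ge (hn : 0 < n) (hnm : n ≤ m) : 1000 ≤ lsLam m n := by
  have h1 := lsEps_pos hn hnm
  have h2 := lsEps_le hn hnm
  have h3 := lsLog_ge hn hnm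
  have h4 := lsLam_mul_eps hn hnm
  by_contra! hc
  nlinarith

lemma lsLam_mul_gamma (hn : 0 < n) (hnm : n ≤ m) :
    lsLam m n * lsGamma m n = lsEps m n / 100 := by
  have := lsLam_ge hn hnm
  have : lsLam m n ≠ 0 := by linarith
  rw [lsGamma]; field_simp

lemma lsGamma_pos (hn : 0 < n) (hnm : n ≤ m) : 0 < lsGamma m n := by
  have := lsLam_ge hn hnm
  have := lsEps_pos hn hnm
  rw [lsGamma]; positivity

lemma lsGamma_le (hn : 0 < n) (hnm : n ≤ m) : lsGamma m n ≤ lsEps m n / 1000 := by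
  have h1 := lsLam_ge hn hnm
  have h2 := lsEps_pos hn hnm
  rw [lsGamma]
  exact div_le_div_of_nonneg_left h2.le (by norm_num) (by linarith)

lemma one_le_sqrt (hn : 0 < n) : 1 ≤ √(n : ℝ) := by
  rw [Real.one_le_sqrt]; exact_mod_cast hn

lemma lsR_mul_sqrt (hn : 0 < n) :
    lsR m n * √n = lsEps m n * lsGamma m n := by
  have := one_le_sqrt hn
  rw [lsR, div_mul_cancel₀]; linarith

lemma lsR_pos (hn : 0 < n) (hnm : n ≤ m) : 0 < lsR m n := by
  have := one_le_sqrt hn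
  have := lsEps_pos hn hnm
  have := lsGamma_pos hn hnm
  rw [lsR]; positivity

lemma lsR_le (hn : 0 < n) (hnm : n ≤ m) : lsR m n ≤ lsEps m n * lsGamma m n := by
  rw [← lsR_mul_sqrt hn]
  exact le_mul_of_one_le_right (lsR_pos hn hnm).le (one_le_sqrt hn)

lemma lsR_lt (hn : 0 < n) (hnm : n ≤ m) : lsR m n < 1 / 2 := by
  have := lsR_le hn hnm
  have := lsEps_pos hn hnm
  have := lsEps_le hn hnm
  have := lsGamma_pos hn hnm
  have := lsGamma_le hn hnm
  nlinarith

/-- Absorbs the additive 2m into the exponential: λε/6 is six times a logarithm whose argument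
already exceeds 2m. -/
lemma two_mul_le_exp (hn : 0 < n) (hnm : n ≤ m) :
    2 * (m : ℝ) ≤ Real.exp (lsLam m n * lsEps m n / 6) := by
  have h1 := one_le_cast hn hnm
  have h2 := lsArg_ge hn hnm
  have h3 : 0 < 400 * m / lsEps m n ^ 2 := by linarith
  rw [lsLam_mul_eps hn hnm]
  have h4 := lsLog_ge hn hnm
  calc 2 * (m : ℝ) ≤ 400 * m / lsEps m n ^ 2 := by linarith
    _ = Real.exp (Real.log (400 * m / lsEps m n ^ 2)) := (Real.exp_log h3).symm
    _ ≤ _ := Real.exp_le_exp.2 (by linarith)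

/-- Let a = 400m/ε². Since 1/r = 100λ√n/ε² and λε = 36 log a ≤ 36a, one finds 16m/r ≤ a³, and the 36
in λ is 12 times this exponent 3. -/
lemma lsLam_ge_log (hn : 0 < n) (hnm : n ≤ m) :
    12 * Real.log (16 * m / lsR m n) / lsEps m n ≤ lsLam m n := by
  have hε := lsEps_pos hn hnm
  have hε' := lsEps_le hn hnm
  have hm := one_le_cast hn hnm
  have hr := lsR_pos hn hnm
  have hlam := lsLam_ge hn hnm
  have hsn := one_le_sqrt hn
  rw [div_le_iff₀ hε, lsLam_mul_eps hn hnm]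
  set a := 400 * m / lsEps m n ^ 2 with ha
  have ha0 : 0 < a := by have := lsArg_ge hn hnm; linarith
  have hlog : Real.log a ≤ a := (Real.log_le_sub_one_of_pos ha0).trans (by linarith)
  have key : 16 * m / lsR m n ≤ a ^ 3 := by
    rw [div_le_iff₀ hr]
    have e1 : lsR m n = lsEps m n ^ 2 / (100 * lsLam m n * √n) := by
      rw [lsR, lsGamma]
      have : lsLam m n ≠ 0 := by linarith
      field_simp
    have hle : lsLam m n * lsEps m n ≤ 36 * a := by
      rw [lsLam_mul_eps hn hnm]; linarith
    have hsm : √(n : ℝ) ≤ m := by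
      have h2 : (n : ℝ) ≤ m := by exact_mod_cast hnm
      rw [Real.sqrt_le_left (by linarith)]
      nlinarith
    have hlam0 : 0 < lsLam m n := by linarith
    have hsn0 : 0 < √(n : ℝ) := by linarith
    rw [e1, ← mul_div_assoc, le_div_iff₀ (by positivity)]
    have e2 : a ^ 2 * lsEps m n ^ 4 = 160000 * m ^ 2 := by
      rw [ha]; field_simp; ring
    have h5 : 16 * m * (100 * lsLam m n * √n) * lsEps m n ≤ 57600 * m ^ 2 * a := by
      have := mul_le_mul hle hsm (by positivity) (by positivity)
      have := mul_le_mul_of_nonneg_left this (by positivity : 0 ≤ 1600 * (m : ℝ))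
      calc _ = 1600 * (m : ℝ) * (lsLam m n * lsEps m n * √n) := by ring
        _ ≤ _ := this
        _ = _ := by ring
    have h6 : 57600 * m ^ 2 * a ≤ a ^ 3 * lsEps m n ^ 2 * lsEps m n := by
      have e3 : a ^ 3 * lsEps m n ^ 2 * lsEps m n * lsEps m n = 160000 * m ^ 2 * a := by
        rw [← e2]; ring
      have h7 : 57600 * m ^ 2 * a * lsEps m n ≤ 160000 * m ^ 2 * a := by
        have : 0 ≤ m ^ 2 * a := by positivity
        nlinarith
      exact le_of_mul_le_mul_right (h7.trans e3.ge) hε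
    exact le_of_mul_le_mul_right (h5.trans h6) hε
  have h1 : Real.log (16 * m / lsR m n) ≤ 3 * Real.log a := by
    have := Real.log_le_log (by positivity) key
    rwa [Real.log_pow] at this
  linarith

/-- The reason for the logarithm in α: ratios of weights as large as 4m/n become an absolute
constant when raised to 2α. -/
lemma rpow_lsAlpha (hn : 0 < n) (hnm : n ≤ m) :
    (4 * m / n : ℝ) ^ (2 * lsAlpha m n) = Real.exp (1 / 2) := by
  have h := log_ratio_ge hn hnm
  have h1 := one_le_cast hn hnm
  have h2 : (0 : ℝ) < n := by exact_mod_cast hn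
  rw [Real.rpow_def_of_pos (by positivity), lsAlpha]
  congr 1
  field_simp
  ring

lemma NonDegenerate.le {A : Matrix (Fin m) (Fin n) ℝ} (hA : NonDegenerate A) : n ≤ m := by
  have := A.rank_le_height
  rwa [hA.2] at this

lemma exp_le_quadratic {t : ℝ} (h0 : 0 ≤ t) (h1 : t ≤ 1) : Real.exp t ≤ 1 + t + t ^ 2 := by
  have := exp_sub_one_sub_le_sq h0 h1; linarith

end Params

/-! ### Approximate projections -/

section ApproxProj

variable {m n : ℕ}

lemma ApproxMat.posDef {δ : ℝ} {H G : Matrix (Fin n) (Fin n) ℝ} (h : ApproxMat δ H G)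
    (hG : G.PosDef) : H.PosDef := by
  have h1 : (Real.exp (-δ) • G).PosDef := hG.smul (Real.exp_pos _)
  have := h1.add_posSemidef h.1
  simpa using this

lemma ApproxMat.form_le {δ : ℝ} {H G : Matrix (Fin n) (Fin n) ℝ} (h : ApproxMat δ H G)
    (z : Fin n → ℝ) : z ⬝ᵥ H *ᵥ z ≤ Real.exp δ * (z ⬝ᵥ G *ᵥ z) := by
  have := posSemidef_form_nonneg h.2 z
  rw [sub_mulVec, dotProduct_sub, smul_mulVec, dotProduct_smul, smul_eq_mul] at this
  linarith

lemma ApproxMat.le_form {δ : ℝ} {H G : Matrix (Fin n) (Fin n) ℝ} (h : ApproxMat δ H G)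
    (z : Fin n → ℝ) : z ⬝ᵥ G *ᵥ z ≤ Real.exp δ * (z ⬝ᵥ H *ᵥ z) := by
  have := posSemidef_form_nonneg h.1 z
  rw [sub_mulVec, dotProduct_sub, smul_mulVec, dotProduct_smul, smul_eq_mul] at this
  have h2 := mul_le_mul_of_nonneg_left (sub_nonneg.1 this) (Real.exp_pos δ).le
  rw [← mul_assoc, ← Real.exp_add, add_neg_cancel, Real.exp_zero, one_mul] at h2
  exact h2

variable {M : Matrix (Fin m) (Fin n) ℝ} {H : Matrix (Fin n) (Fin n) ℝ} {δ : ℝ}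

lemma approxProj_form (h : ApproxMat δ H (Mᵀ * M)) (hM : Function.Injective M.mulVec)
    (k : Fin m → ℝ) :
    (H⁻¹ *ᵥ (Mᵀ *ᵥ k)) ⬝ᵥ H *ᵥ (H⁻¹ *ᵥ (Mᵀ *ᵥ k))
      = ∑ i, k i * (M *ᵥ (H⁻¹ *ᵥ (Mᵀ *ᵥ k))) i := by
  have hH := h.posDef (gram_posDef hM)
  rw [mulVec_inv_mulVec hH, dotProduct_mulVec, vecMul_transpose, dotProduct_comm]
  rfl

/-- Cauchy-Schwarz, followed by MᵀM ≼ exp(δ) H, bounds the square of the form by a multiple of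
itself; one factor cancels. -/
lemma approxProj_form_le (h : ApproxMat δ H (Mᵀ * M)) (hM : Function.Injective M.mulVec)
    (k : Fin m → ℝ) :
    (H⁻¹ *ᵥ (Mᵀ *ᵥ k)) ⬝ᵥ H *ᵥ (H⁻¹ *ᵥ (Mᵀ *ᵥ k)) ≤ Real.exp δ * ∑ i, k i ^ 2 := by
  have hH := h.posDef (gram_posDef hM)
  set z := H⁻¹ *ᵥ (Mᵀ *ᵥ k) with hz
  have e := approxProj_form h hM k
  rw [← hz] at e
  have h1 := h.le_form z
  rw [gram_form] at h1
  have h0 := posSemidef_form_nonneg hH.posSemidef z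
  have cs := Finset.sum_mul_sq_le_sq_mul_sq Finset.univ k (fun i => (M *ᵥ z) i)
  rw [← e] at cs
  have hk : 0 ≤ ∑ i, k i ^ 2 := by positivity
  set q := z ⬝ᵥ H *ᵥ z
  have h2 := cs.trans (mul_le_mul_of_nonneg_left h1 hk)
  rcases h0.eq_or_lt with h3 | h3
  · rw [← h3]; positivity
  · nlinarith

lemma approxProj_sq_le (h : ApproxMat δ H (Mᵀ * M)) (hM : Function.Injective M.mulVec)
    (k : Fin m → ℝ) :
    ∑ i, (M *ᵥ (H⁻¹ *ᵥ (Mᵀ *ᵥ k))) i ^ 2 ≤ Real.exp (2 * δ) * ∑ i, k i ^ 2 := by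
  have h1 := h.le_form (H⁻¹ *ᵥ (Mᵀ *ᵥ k))
  rw [gram_form] at h1
  have h2 := mul_le_mul_of_nonneg_left (approxProj_form_le h hM k) (Real.exp_pos δ).le
  refine h1.trans (h2.trans (le_of_eq ?_))
  rw [← mul_assoc, ← Real.exp_add]; congr 2; ring

/-- Reflection through an approximate projection almost preserves norms. -/
lemma approxProj_reflection_le (h : ApproxMat δ H (Mᵀ * M)) (hδ : 0 ≤ δ)
    (hM : Function.Injective M.mulVec) (k : Fin m → ℝ) :
    ∑ i, (k i - 2 * (M *ᵥ (H⁻¹ *ᵥ (Mᵀ *ᵥ k))) i) ^ 2 ≤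
      (1 + 4 * (Real.exp δ - 1) * Real.exp δ) * ∑ i, k i ^ 2 := by
  have e := approxProj_form h hM k
  have h1 := h.le_form (H⁻¹ *ᵥ (Mᵀ *ᵥ k))
  have h2 := approxProj_form_le h hM k
  rw [gram_form] at h1
  set z := H⁻¹ *ᵥ (Mᵀ *ᵥ k) with hz
  -- For an exact projection the last two sums cancel. Here their difference is at most 4(exp δ - 1)
  -- times the form.
  have e2 : ∑ i, (k i - 2 * (M *ᵥ z) i) ^ 2
      = ∑ i, k i ^ 2 - 4 * ∑ i, k i * (M *ᵥ z) i + 4 * ∑ i, (M *ᵥ z) i ^ 2 := by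
    rw [Finset.mul_sum, Finset.mul_sum, ← Finset.sum_sub_distrib, ← Finset.sum_add_distrib]
    exact Finset.sum_congr rfl fun i _ => by ring
  rw [e2, ← e]
  have h3 : 0 ≤ Real.exp δ - 1 := by linarith [Real.one_le_exp hδ]
  have h4 := mul_le_mul_of_nonneg_left h2 h3
  linarith

end ApproxProj

/-! ### The Lee–Sidford weights and the quantities of a step -/

section Weights

variable {m n : ℕ}

/-- The rescaled constraint matrix `X^(1/2 - α) S^(-1/2 - α) A`. -/
noncomputable def scaledMat (A : Matrix (Fin m) (Fin n) ℝ) (x s : Fin m → ℝ) :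
    Matrix (Fin m) (Fin n) ℝ :=
  diagonal (fun j => x j ^ (1 / 2 - lsAlpha m n) * s j ^ (-(1 / 2) - lsAlpha m n)) * A

lemma lsWeight_eq (A : Matrix (Fin m) (Fin n) ℝ) (x s : Fin m → ℝ) (i : Fin m) :
    lsWeight A x s i = leverage (scaledMat A x s) i + n / m := rfl

variable {A : Matrix (Fin m) (Fin n) ℝ} {x s : Fin m → ℝ}

lemma scaledMat_injective (hA : NonDegenerate A) (hx : Pos x) (hs : Pos s) :
    Function.Injective (scaledMat A x s).mulVec :=
  diagonal_mul_injective hA.injective fun i =>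
    (mul_pos (Real.rpow_pos_of_pos (hx i) _) (Real.rpow_pos_of_pos (hs i) _)).ne'

lemma projWeights_lsWeight (hn : 0 < n) (hA : NonDegenerate A) (hx : Pos x) (hs : Pos s) :
    ProjWeights (colProj (scaledMat A x s)) (lsWeight A x s) := by
  have hinj := scaledMat_injective hA hx hs
  have hm := one_le_cast hn hA.le
  have hn' : (0 : ℝ) < n := by exact_mod_cast hn
  have h0 := fun i => proj_diag_nonneg (colProj_transpose (scaledMat A x s))
    (colProj_mul_self hinj) i
  refine ⟨colProj_transpose _, colProj_mul_self hinj, fun i => ?_, fun i => ?_⟩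
  · rw [lsWeight_eq, leverage_eq_colProj]; have := h0 i; positivity
  · rw [lsWeight_eq, leverage_eq_colProj]
    exact le_add_of_nonneg_right (by positivity)

lemma sum_lsWeight (hn : 0 < n) (hA : NonDegenerate A) (hx : Pos x) (hs : Pos s) :
    ∑ i, lsWeight A x s i = 2 * n := by
  have hm := one_le_cast hn hA.le
  simp only [lsWeight_eq, leverage_eq_colProj, Finset.sum_add_distrib]
  rw [colProj_trace (scaledMat_injective hA hx hs)]
  simp only [Finset.sum_const, Finset.card_univ, Fintype.card_fin, nsmul_eq_mul]
  field_simp; ring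

lemma lsWeight_le_two (hn : 0 < n) (hA : NonDegenerate A) (hx : Pos x) (hs : Pos s) (i : Fin m) :
    lsWeight A x s i ≤ 2 := by
  have hm := one_le_cast hn hA.le
  have h1 := proj_diag_le_one (colProj_transpose (scaledMat A x s))
    (colProj_mul_self (scaledMat_injective hA hx hs)) i
  have h2 : (n : ℝ) / m ≤ 1 := by
    rw [div_le_one (by linarith)]; exact_mod_cast hA.le
  rw [lsWeight_eq, leverage_eq_colProj]; linarith

lemma le_lsWeight (hA : NonDegenerate A) (hx : Pos x) (hs : Pos s) (i : Fin m) :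
    (n : ℝ) / m ≤ lsWeight A x s i := by
  have h1 := proj_diag_nonneg (colProj_transpose (scaledMat A x s))
    (colProj_mul_self (scaledMat_injective hA hx hs)) i
  rw [lsWeight_eq, leverage_eq_colProj]; linarith

end Weights

/-! ### Estimates for g, δ_p and δ_c on a valid input. -/

section Input

variable {m n : ℕ}

/-- A valid input of the short step, with an admissible choice of approximations. -/
structure LSInput (A : Matrix (Fin m) (Fin n) ℝ) (b : Fin n → ℝ) (c x s : Fin m → ℝ) (μ C : ℝ)
    (ch : LSChoice m n) : Prop where
  n_pos : 0 < n
  nondeg : NonDegenerate A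
  centered : IsCentered A b c (lsEps m n) (lsGamma m n) (lsWeight A) x s μ
  adm : ch.Admissible A b x s μ C

namespace LSInput

variable {A : Matrix (Fin m) (Fin n) ℝ} {b : Fin n → ℝ} {c x s : Fin m → ℝ} {μ C : ℝ}
  {ch : LSChoice m n}

local notation "ε" => lsEps m n
local notation "γ" => lsGamma m n

lemma le (h : LSInput A b c x s μ C ch) : n ≤ m := h.nondeg.le

lemma eps_pos (h : LSInput A b c x s μ C ch) : 0 < ε := lsEps_pos h.n_pos h.le

lemma eps_le (h : LSInput A b c x s μ C ch) : ε ≤ 1 / 6000 := lsEps_le h.n_pos h.le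

lemma pos_xbar (h : LSInput A b c x s μ C ch) (i : Fin m) : 0 < ch.xbar i :=
  (mul_pos (Real.exp_pos _) (h.centered.pos_x i)).trans_le (h.adm.xbar_approx i).1

lemma pos_sbar (h : LSInput A b c x s μ C ch) (i : Fin m) : 0 < ch.sbar i :=
  (mul_pos (Real.exp_pos _) (h.centered.pos_s i)).trans_le (h.adm.sbar_approx i).1

lemma projWeights (h : LSInput A b c x s μ C ch) :
    ProjWeights (colProj (scaledMat A x s)) (lsWeight A x s) :=
  projWeights_lsWeight h.n_pos h.nondeg h.centered.pos_x h.centered.pos_s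

lemma pos_taubar (h : LSInput A b c x s μ C ch) (i : Fin m) : 0 < ch.taubar i :=
  (mul_pos (Real.exp_pos _) (h.projWeights.pos i)).trans_le (h.adm.taubar_approx i).1

lemma wbar_pos (h : LSInput A b c x s μ C ch) (i : Fin m) : 0 < wVec ch.xbar ch.sbar μ i :=
  div_pos (mul_pos (h.pos_xbar i) (h.pos_sbar i)) h.centered.pos_mu

lemma sqrtWbar_pos (h : LSInput A b c x s μ C ch) (i : Fin m) : 0 < ch.sqrtWbar μ i :=
  Real.sqrt_pos.2 (h.wbar_pos i)

lemma sqrtWbar_sq (h : LSInput A b c x s μ C ch) (i : Fin m) :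
    ch.sqrtWbar μ i ^ 2 = wVec ch.xbar ch.sbar μ i :=
  Real.sq_sqrt (h.wbar_pos i).le

/-- One factor exp ε each from the approximation of x, the approximation of s and the centrality of
the input. -/
lemma wbar_bounds (h : LSInput A b c x s μ C ch) (i : Fin m) :
    Real.exp (-(3 * ε)) * lsWeight A x s i ≤ wVec ch.xbar ch.sbar μ i ∧
      wVec ch.xbar ch.sbar μ i ≤ Real.exp (3 * ε) * lsWeight A x s i := by
  have hx := h.adm.xbar_approx i
  have hs := h.adm.sbar_approx i
  have hc := h.centered.centrality i
  have px := h.centered.pos_x i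
  have ps := h.centered.pos_s i
  have pμ := h.centered.pos_mu
  have e1 : Real.exp (-(3 * ε)) = Real.exp (-ε) * Real.exp (-ε) * Real.exp (-ε) := by
    rw [← Real.exp_add, ← Real.exp_add]; congr 1; ring
  have e2 : Real.exp (3 * ε) = Real.exp ε * Real.exp ε * Real.exp ε := by
    rw [← Real.exp_add, ← Real.exp_add]; congr 1; ring
  have p1 := Real.exp_pos (-ε)
  have p2 := Real.exp_pos ε
  have m1 : Real.exp (-ε) * Real.exp (-ε) * wVec x s μ i ≤ wVec ch.xbar ch.sbar μ i := by
    rw [wVec, wVec, ← mul_div_assoc]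
    refine div_le_div_of_nonneg_right ?_ pμ.le
    have := mul_le_mul hx.1 hs.1 (by positivity) (h.pos_xbar i).le
    linarith
  have m2 : wVec ch.xbar ch.sbar μ i ≤ Real.exp ε * Real.exp ε * wVec x s μ i := by
    rw [wVec, wVec, ← mul_div_assoc]
    refine div_le_div_of_nonneg_right ?_ pμ.le
    have := mul_le_mul hx.2 hs.2 (h.pos_sbar i).le (by positivity)
    linarith
  constructor
  · rw [e1]
    have := mul_le_mul_of_nonneg_left hc.1 (by positivity : 0 ≤ Real.exp (-ε) * Real.exp (-ε))
    linarith
  · rw [e2]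
    have := mul_le_mul_of_nonneg_left hc.2 (by positivity : 0 ≤ Real.exp ε * Real.exp ε)
    linarith

lemma exp_three_le (h : LSInput A b c x s μ C ch) : Real.exp (3 * ε) ≤ (1 + 2 * ε) ^ 2 := by
  have h1 := h.eps_pos
  have h2 := h.eps_le
  refine (exp_le_quadratic (by positivity) (by linarith)).trans ?_
  nlinarith

lemma wNorm_wbar_le (h : LSInput A b c x s μ C ch) (v : Fin m → ℝ) :
    wNorm (wVec ch.xbar ch.sbar μ) v ≤ (1 + 2 * ε) * wNorm (lsWeight A x s) v := by
  have h1 := h.eps_pos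
  refine wNorm_le_of_weight_le (by positivity) (fun i => ?_) v
  exact (h.wbar_bounds i).2.trans
    (mul_le_mul_of_nonneg_right h.exp_three_le (h.projWeights.pos i).le)

lemma weight_le_wbar (h : LSInput A b c x s μ C ch) (i : Fin m) :
    lsWeight A x s i ≤ Real.exp (3 * ε) * wVec ch.xbar ch.sbar μ i := by
  have := mul_le_mul_of_nonneg_left (h.wbar_bounds i).1 (Real.exp_pos (3 * ε)).le
  rwa [← mul_assoc, ← Real.exp_add, add_neg_cancel, Real.exp_zero, one_mul] at this

lemma wNorm_le_wbar (h : LSInput A b c x s μ C ch) (v : Fin m → ℝ) :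
    wNorm (lsWeight A x s) v ≤ (1 + 2 * ε) * wNorm (wVec ch.xbar ch.sbar μ) v := by
  have h1 := h.eps_pos
  refine wNorm_le_of_weight_le (by positivity) (fun i => ?_) v
  exact (h.weight_le_wbar i).trans
    (mul_le_mul_of_nonneg_right h.exp_three_le (h.wbar_pos i).le)

lemma wNorm_taubar_le (h : LSInput A b c x s μ C ch) (v : Fin m → ℝ) :
    wNorm ch.taubar v ≤ (1 + ε) * wNorm (lsWeight A x s) v := by
  have h1 := h.eps_pos
  have h2 := h.eps_le
  refine wNorm_le_of_weight_le (by positivity) (fun i => ?_) v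
  refine (h.adm.taubar_approx i).2.trans
    (mul_le_mul_of_nonneg_right ?_ (h.projWeights.pos i).le)
  refine (exp_le_quadratic (by positivity) (by linarith)).trans ?_
  nlinarith

lemma wNorm_le_taubar (h : LSInput A b c x s μ C ch) (v : Fin m → ℝ) :
    wNorm (lsWeight A x s) v ≤ (1 + ε) * wNorm ch.taubar v := by
  have h1 := h.eps_pos
  have h2 := h.eps_le
  refine wNorm_le_of_weight_le (by positivity) (fun i => ?_) v
  have := mul_le_mul_of_nonneg_left (h.adm.taubar_approx i).1 (Real.exp_pos ε).le
  rw [← mul_assoc, ← Real.exp_add, add_neg_cancel, Real.exp_zero, one_mul] at this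
  refine this.trans (mul_le_mul_of_nonneg_right ?_ (h.pos_taubar i).le)
  refine (exp_le_quadratic (by positivity) (by linarith)).trans ?_
  nlinarith

lemma Abar_injective (h : LSInput A b c x s μ C ch) : Function.Injective (ch.Abar A).mulVec :=
  diagonal_mul_injective h.nondeg.injective fun i =>
    (div_pos (Real.sqrt_pos.2 (h.pos_xbar i)) (Real.sqrt_pos.2 (h.pos_sbar i))).ne'

lemma sqrt_scale_sq (h : LSInput A b c x s μ C ch) (i : Fin m) :
    (√(ch.xbar i) / √(ch.sbar i)) ^ 2 = ch.xbar i / ch.sbar i := by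
  rw [div_pow, Real.sq_sqrt (h.pos_xbar i).le, Real.sq_sqrt (h.pos_sbar i).le]

/-- Leverage scores of `Abar` are at most twice the Lee–Sidford weights. -/
lemma leverage_Abar_le (h : LSInput A b c x s μ C ch) (i : Fin m) :
    leverage (ch.Abar A) i ≤ 2 * lsWeight A x s i := by
  have hε := h.eps_pos
  have hε' := h.eps_le
  have hα := lsAlpha_pos h.n_pos h.le
  have hm := one_le_cast h.n_pos h.le
  have hn : (0 : ℝ) < n := by exact_mod_cast h.n_pos
  have pμ := h.centered.pos_mu
  have hM := scaledMat_injective h.nondeg h.centered.pos_x h.centered.pos_s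
  set α := lsAlpha m n with hαd
  set D : Fin m → ℝ := fun j => x j ^ (1 / 2 - α) * s j ^ (-(1 / 2) - α) with hD
  have pD : ∀ j, 0 < D j := fun j =>
    mul_pos (Real.rpow_pos_of_pos (h.centered.pos_x j) _)
      (Real.rpow_pos_of_pos (h.centered.pos_s j) _)
  set e : Fin m → ℝ := fun j => (√(ch.xbar j) / √(ch.sbar j)) / D j with he
  have hAbar : ch.Abar A = diagonal e * scaledMat A x s := by
    rw [LSChoice.Abar, scaledMat, ← Matrix.mul_assoc, diagonal_mul_diagonal]
    congr 2
    funext j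
    rw [he]
    exact (div_mul_cancel₀ _ (pD j).ne').symm
  have pe : ∀ j, 0 < e j := fun j =>
    div_pos (div_pos (Real.sqrt_pos.2 (h.pos_xbar j)) (Real.sqrt_pos.2 (h.pos_sbar j))) (pD j)
  -- Up to the approximation errors, Ā differs from the matrix in the Lee–Sidford weight only by the
  -- row scaling (xs)^α = (μw)^α.
  have esq : ∀ j, e j ^ 2 = (ch.xbar j / x j) * (s j / ch.sbar j)
      * (μ * wVec x s μ j) ^ (2 * α) := fun j => by
    have px := h.centered.pos_x j
    have ps := h.centered.pos_s j
    have e1 : D j ^ 2 * (x j * s j) ^ (2 * α) = x j / s j := by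
      rw [hD, Real.mul_rpow px.le ps.le]
      simp only
      rw [mul_pow, ← Real.rpow_natCast, ← Real.rpow_natCast, ← Real.rpow_mul px.le,
        ← Real.rpow_mul ps.le, mul_mul_mul_comm, ← Real.rpow_add px, ← Real.rpow_add ps]
      have : (1 / 2 - α) * ((2 : ℕ) : ℝ) + 2 * α = 1 := by push_cast; ring
      rw [this]
      have : (-(1 / 2) - α) * ((2 : ℕ) : ℝ) + 2 * α = -1 := by push_cast; ring
      rw [this, Real.rpow_one, Real.rpow_neg_one]; rfl
    have e2 : μ * wVec x s μ j = x j * s j := by rw [wVec]; field_simp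
    rw [e2, he]
    simp only
    rw [div_pow, h.sqrt_scale_sq]
    have p2 := pD j
    have p3 := h.pos_sbar j
    rw [div_eq_iff (by positivity), mul_assoc, mul_comm _ (D j ^ 2), e1]
    field_simp
  have rx : ∀ j, Real.exp (-ε) ≤ ch.xbar j / x j ∧ ch.xbar j / x j ≤ Real.exp ε := fun j => by
    rw [le_div_iff₀ (h.centered.pos_x j), div_le_iff₀ (h.centered.pos_x j)]
    exact h.adm.xbar_approx j
  have rs : ∀ j, Real.exp (-ε) ≤ s j / ch.sbar j ∧ s j / ch.sbar j ≤ Real.exp ε := fun j => by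
    rw [le_div_iff₀ (h.pos_sbar j), div_le_iff₀ (h.pos_sbar j)]
    have := h.adm.sbar_approx j
    constructor
    · have := mul_le_mul_of_nonneg_left this.2 (Real.exp_pos (-ε)).le
      rwa [← mul_assoc, ← Real.exp_add, neg_add_cancel, Real.exp_zero, one_mul] at this
    · have := mul_le_mul_of_nonneg_left this.1 (Real.exp_pos ε).le
      rwa [← mul_assoc, ← Real.exp_add, add_neg_cancel, Real.exp_zero, one_mul] at this
  have rw1 : ∀ j, Real.exp (-ε) * (n / m) ≤ wVec x s μ j := fun j =>
    (mul_le_mul_of_nonneg_left (le_lsWeight h.nondeg h.centered.pos_x h.centered.pos_s j)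
      (Real.exp_pos _).le).trans (h.centered.centrality j).1
  have rw2 : ∀ j, wVec x s μ j ≤ Real.exp ε * 2 := fun j =>
    (h.centered.centrality j).2.trans (mul_le_mul_of_nonneg_left
      (lsWeight_le_two h.n_pos h.nondeg h.centered.pos_x h.centered.pos_s j) (Real.exp_pos _).le)
  set l := Real.exp (-ε) * Real.exp (-ε) * (μ * (Real.exp (-ε) * (n / m))) ^ (2 * α) with hl
  set u := Real.exp ε * Real.exp ε * (μ * (Real.exp ε * 2)) ^ (2 * α) with hu
  have pl : 0 < l := by rw [hl]; positivity
  have hle : ∀ j, l ≤ e j ^ 2 := fun j => by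
    rw [esq, hl]
    refine mul_le_mul (mul_le_mul (rx j).1 (rs j).1 (by positivity) ?_)
      (Real.rpow_le_rpow (by positivity) (mul_le_mul_of_nonneg_left (rw1 j) pμ.le)
        (by positivity)) (by positivity) ?_
    · exact (Real.exp_pos _).le.trans (rx j).1
    · exact mul_nonneg ((Real.exp_pos _).le.trans (rx j).1) ((Real.exp_pos _).le.trans (rs j).1)
  have hue : ∀ j, e j ^ 2 ≤ u := fun j => by
    rw [esq, hu]
    have pw : 0 ≤ wVec x s μ j := le_trans (by positivity) (rw1 j)
    refine mul_le_mul (mul_le_mul (rx j).2 (rs j).2 ?_ (by positivity))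
      (Real.rpow_le_rpow (by positivity) (mul_le_mul_of_nonneg_left (rw2 j) pμ.le)
        (by positivity)) (by positivity) (by positivity)
    exact (Real.exp_pos _).le.trans (rs j).1
  have hlev := leverage_diagonal_le hM pl (fun j => (pe j).ne') hle hue i
  rw [← hAbar] at hlev
  have hul : u / l ≤ 2 := by
    rw [div_le_iff₀ pl]
    have e4 : Real.exp ε * Real.exp ε
        = Real.exp (4 * ε) * (Real.exp (-ε) * Real.exp (-ε)) := by
      rw [← Real.exp_add, ← Real.exp_add, ← Real.exp_add]; congr 1; ring
    -- By centrality w lies between exp(-ε)n/m and 2 exp ε. The ratio of these bounds is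
    -- 2(m/n)exp(2ε) ≤ 4m/n, whose power 2α is exp(1/2), and μ cancels.
    have e5 : (μ * (Real.exp ε * 2)) ^ (2 * α)
        ≤ Real.exp (1 / 2) * (μ * (Real.exp (-ε) * (n / m))) ^ (2 * α) := by
      rw [← rpow_lsAlpha h.n_pos h.le, ← Real.mul_rpow (by positivity) (by positivity)]
      refine Real.rpow_le_rpow (by positivity) ?_ (by positivity)
      have e6 : Real.exp ε ≤ 2 * Real.exp (-ε) := by
        have : Real.exp ε = Real.exp (2 * ε) * Real.exp (-ε) := by
          rw [← Real.exp_add]; congr 1; ring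
        rw [this]
        refine mul_le_mul_of_nonneg_right ?_ (Real.exp_pos _).le
        refine (exp_le_quadratic (by positivity) (by linarith)).trans ?_
        nlinarith
      have e7 : 4 * (m : ℝ) / n * (μ * (Real.exp (-ε) * (n / m)))
          = μ * (2 * (2 * Real.exp (-ε))) := by field_simp; ring
      rw [e7]
      exact mul_le_mul_of_nonneg_left (by linarith) pμ.le
    have e8 : Real.exp (4 * ε) * Real.exp (1 / 2) ≤ 2 := by
      have a1 : Real.exp (4 * ε) ≤ 1001 / 1000 :=
        (exp_le_quadratic (by positivity) (by linarith)).trans (by nlinarith)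
      have a2 : Real.exp (1 / 2) ≤ 165 / 100 := by
        refine abs_le_of_sq_le_sq' ?_ (by norm_num) |>.2
        rw [← Real.exp_nat_mul]
        norm_num
        have := Real.exp_one_lt_d9
        linarith
      have := mul_le_mul a1 a2 (Real.exp_pos _).le (by norm_num)
      linarith
    have e9 : u ≤ (Real.exp (4 * ε) * Real.exp (1 / 2)) * l := by
      rw [hu, hl, e4]
      have := mul_le_mul_of_nonneg_left e5
        (by positivity : 0 ≤ Real.exp (4 * ε) * (Real.exp (-ε) * Real.exp (-ε)))
      linarith
    exact e9.trans (mul_le_mul_of_nonneg_right e8 pl.le)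
  have h0 := proj_diag_nonneg (colProj_transpose (scaledMat A x s)) (colProj_mul_self hM) i
  have h1 := h.projWeights.le i
  rw [← leverage_eq_colProj] at h0 h1
  have := mul_le_mul_of_nonneg_right hul h0
  linarith

lemma diagonal_inv_mulVec (h : LSInput A b c x s μ C ch) (v : Fin m → ℝ) (i : Fin m) :
    ((diagonal (ch.sqrtWbar μ))⁻¹ *ᵥ v) i = (ch.sqrtWbar μ i)⁻¹ * v i := by
  have e : (diagonal (ch.sqrtWbar μ))⁻¹ = diagonal (fun i => (ch.sqrtWbar μ i)⁻¹) := by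
    refine Matrix.inv_eq_right_inv ?_
    rw [diagonal_mul_diagonal, ← diagonal_one]
    congr 1
    funext i
    exact mul_inv_cancel₀ (h.sqrtWbar_pos i).ne'
  rw [e, mulVec_diagonal]

/-- `‖W^(-1/2) y‖_W = ‖y‖₂`. -/
lemma wNorm_wbar_eq (h : LSInput A b c x s μ C ch) {v y : Fin m → ℝ}
    (hv : ∀ i, v i = (ch.sqrtWbar μ i)⁻¹ * y i) :
    wNorm (wVec ch.xbar ch.sbar μ) v = √(∑ i, y i ^ 2) := by
  rw [wNorm]
  congr 1
  refine Finset.sum_congr rfl fun i _ => ?_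
  rw [hv, ← h.sqrtWbar_sq, ← mul_pow, mul_inv_cancel_left₀ (h.sqrtWbar_pos i).ne']

/-- Vectors in the range of `W^(-1/2) Abar` have small entries. -/
lemma norm_le_wNorm (h : LSInput A b c x s μ C ch) {v : Fin m → ℝ} {z : Fin n → ℝ}
    (hv : ∀ i, v i = (ch.sqrtWbar μ i)⁻¹ * (ch.Abar A *ᵥ z) i) :
    ‖v‖ ≤ 145 / 100 * wNorm (wVec ch.xbar ch.sbar μ) v := by
  have hε := h.eps_pos
  have hε' := h.eps_le
  have hw := wNorm_nonneg (wVec ch.xbar ch.sbar μ) v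
  refine pi_norm_le (by positivity) fun i => ?_
  refine abs_le_of_sq_le_sq ?_ (by positivity)
  rw [mul_pow, h.wNorm_wbar_eq hv, Real.sq_sqrt (by positivity), hv, mul_pow, inv_pow,
    h.sqrtWbar_sq, inv_mul_le_iff₀ (h.wbar_pos i)]
  refine (mulVec_apply_sq_le h.Abar_injective z i).trans ?_
  rw [← mul_assoc]
  refine mul_le_mul_of_nonneg_right ?_ (by positivity)
  refine (h.leverage_Abar_le i).trans ?_
  have h1 := h.weight_le_wbar i
  have h2 : Real.exp (3 * ε) ≤ 1001 / 1000 := h.exp_three_le.trans (by nlinarith)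
  have h3 := mul_le_mul_of_nonneg_right h2 (h.wbar_pos i).le
  have := h.wbar_pos i
  linarith

lemma deltaP_eq (h : LSInput A b c x s μ C ch) (i : Fin m) :
    ch.deltaP A μ i = (ch.sqrtWbar μ i)⁻¹ * (ch.Abar A *ᵥ (ch.H⁻¹ *ᵥ ((ch.Abar A)ᵀ *ᵥ
      (diagonal (ch.sqrtWbar μ) *ᵥ ch.g)))) i := h.diagonal_inv_mulVec _ i

lemma deltaC_eq (h : LSInput A b c x s μ C ch) (i : Fin m) :
    ch.deltaC A b x μ i = (ch.sqrtWbar μ i)⁻¹ * (ch.Abar A *ᵥ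
      ((√μ)⁻¹ • (ch.H⁻¹ *ᵥ (Aᵀ *ᵥ x - b)))) i := by
  rw [LSChoice.deltaC, Pi.smul_apply, h.diagonal_inv_mulVec, mulVec_smul, Pi.smul_apply,
    smul_eq_mul, smul_eq_mul]
  ring

lemma gamma_le (h : LSInput A b c x s μ C ch) : γ ≤ ε / 1000 := lsGamma_le h.n_pos h.le

lemma gamma_pos (h : LSInput A b c x s μ C ch) : 0 < γ := lsGamma_pos h.n_pos h.le

lemma wNorm_diag_g (h : LSInput A b c x s μ C ch) :
    wNorm (wVec ch.xbar ch.sbar μ) ch.g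
      = √(∑ i, (diagonal (ch.sqrtWbar μ) *ᵥ ch.g) i ^ 2) :=
  h.wNorm_wbar_eq fun i => by
    rw [mulVec_diagonal, inv_mul_cancel_left₀ (h.sqrtWbar_pos i).ne']

lemma exp_two_gamma_le (h : LSInput A b c x s μ C ch) : Real.exp (2 * γ) ≤ (1 + ε) ^ 2 := by
  have h1 := h.gamma_pos
  have h2 := h.gamma_le
  have h3 := h.eps_pos
  have h4 := h.eps_le
  refine (exp_le_quadratic (by positivity) (by linarith)).trans ?_
  nlinarith

lemma wNorm_wbar_deltaP_le (h : LSInput A b c x s μ C ch) :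
    wNorm (wVec ch.xbar ch.sbar μ) (ch.deltaP A μ)
      ≤ (1 + ε) * wNorm (wVec ch.xbar ch.sbar μ) ch.g := by
  have h3 := h.eps_pos
  rw [h.wNorm_wbar_eq h.deltaP_eq, h.wNorm_diag_g, ← Real.sqrt_sq (by linarith : 0 ≤ 1 + ε),
    ← Real.sqrt_mul (sq_nonneg _)]
  refine Real.sqrt_le_sqrt ((approxProj_sq_le h.adm.H_approx h.Abar_injective _).trans ?_)
  exact mul_le_mul_of_nonneg_right h.exp_two_gamma_le (by positivity)

lemma wNorm_wbar_reflection_le (h : LSInput A b c x s μ C ch) :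
    wNorm (wVec ch.xbar ch.sbar μ) (ch.g - (2 : ℝ) • ch.deltaP A μ)
      ≤ (1 + ε) * wNorm (wVec ch.xbar ch.sbar μ) ch.g := by
  have h1 := h.gamma_pos
  have h2 := h.gamma_le
  have h3 := h.eps_pos
  have h4 := h.eps_le
  rw [h.wNorm_wbar_eq (y := fun i => (diagonal (ch.sqrtWbar μ) *ᵥ ch.g) i
      - 2 * (ch.Abar A *ᵥ (ch.H⁻¹ *ᵥ ((ch.Abar A)ᵀ *ᵥ
        (diagonal (ch.sqrtWbar μ) *ᵥ ch.g)))) i) (fun i => ?_), h.wNorm_diag_g,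
    ← Real.sqrt_sq (by linarith : 0 ≤ 1 + ε), ← Real.sqrt_mul (sq_nonneg _)]
  · refine Real.sqrt_le_sqrt
      ((approxProj_reflection_le h.adm.H_approx h1.le h.Abar_injective _).trans ?_)
    refine mul_le_mul_of_nonneg_right ?_ (by positivity)
    have := exp_le_quadratic h1.le (by linarith)
    have h5 : Real.exp γ - 1 ≤ 11 / 10 * γ := by nlinarith
    have h6 : Real.exp γ ≤ 11 / 10 := by nlinarith
    have h7 := mul_le_mul h5 h6 (Real.exp_pos _).le (by positivity)
    nlinarith
  · rw [Pi.sub_apply, Pi.smul_apply, smul_eq_mul, h.deltaP_eq, mul_sub, mulVec_diagonal,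
      inv_mul_cancel_left₀ (h.sqrtWbar_pos i).ne']
    ring

lemma Abar_gram (h : LSInput A b c x s μ C ch) :
    (ch.Abar A)ᵀ * ch.Abar A = Aᵀ * diagonal (fun i => ch.xbar i / ch.sbar i) * A := by
  rw [LSChoice.Abar, diagonal_gram]
  simp only [h.sqrt_scale_sq]

lemma scale_le (h : LSInput A b c x s μ C ch) (i : Fin m) :
    x i / s i ≤ Real.exp (2 * ε) * (ch.xbar i / ch.sbar i) := by
  have px := h.pos_xbar i
  have ps := h.centered.pos_s i
  have ps' := h.pos_sbar i
  have h1 := mul_le_mul_of_nonneg_left (h.adm.xbar_approx i).1 (Real.exp_pos ε).le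
  rw [← mul_assoc, ← Real.exp_add, add_neg_cancel, Real.exp_zero, one_mul] at h1
  have h2 := (h.adm.sbar_approx i).2
  rw [← mul_div_assoc, div_le_div_iff₀ ps ps']
  have := mul_le_mul h1 h2 ps'.le (by positivity)
  have e : Real.exp (2 * ε) = Real.exp ε * Real.exp ε := by
    rw [← Real.exp_add]; congr 1; ring
  rw [e]; linarith

lemma posDef_H (h : LSInput A b c x s μ C ch) : ch.H.PosDef :=
  h.adm.H_approx.posDef (gram_posDef h.Abar_injective)

/-- AᵀXS⁻¹A is at most exp(2ε + γ) times H, so the H⁻¹-norm of the residual is bounded by the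
infeasibility of the input. The factor 1/√μ in δ_c removes the √μ there. -/
lemma wNorm_wbar_deltaC_le (h : LSInput A b c x s μ C ch) :
    wNorm (wVec ch.xbar ch.sbar μ) (ch.deltaC A b x μ) ≤ (1 + 2 * ε) * (ε * γ) := by
  have h1 := h.gamma_pos
  have h2 := h.gamma_le
  have h3 := h.eps_pos
  have h4 := h.eps_le
  have pμ := h.centered.pos_mu
  set y := Aᵀ *ᵥ x - b with hy
  set z := ch.H⁻¹ *ᵥ y with hz
  set G₀ := Aᵀ * diagonal (fun i => x i / s i) * A with hG₀
  have pG₀ : G₀.PosDef := weighted_gram_posDef h.nondeg.injective fun i =>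
    div_pos (h.centered.pos_x i) (h.centered.pos_s i)
  have hle : ∀ w, w ⬝ᵥ G₀ *ᵥ w ≤ (Real.exp (2 * ε) * Real.exp γ) * (w ⬝ᵥ ch.H *ᵥ w) := by
    intro w
    have a1 := h.adm.H_approx.le_form w
    have a2 : w ⬝ᵥ G₀ *ᵥ w ≤ Real.exp (2 * ε) * (w ⬝ᵥ ((ch.Abar A)ᵀ * ch.Abar A) *ᵥ w) := by
      rw [h.Abar_gram, hG₀, weighted_gram_form, weighted_gram_form, Finset.mul_sum]
      refine Finset.sum_le_sum fun i _ => ?_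
      rw [← mul_assoc (Real.exp _)]
      exact mul_le_mul_of_nonneg_right (h.scale_le i) (mul_self_nonneg _)
    have := mul_le_mul_of_nonneg_left a1 (Real.exp_pos (2 * ε)).le
    linarith
  have h5 := inv_form_le pG₀ h.posDef_H hle y
  have h6 : z ⬝ᵥ ch.H *ᵥ z = y ⬝ᵥ ch.H⁻¹ *ᵥ y := by
    rw [hz, mulVec_inv_mulVec h.posDef_H, dotProduct_comm]
  have h7 := h.adm.H_approx.le_form z
  rw [gram_form, h6] at h7
  have h8 : y ⬝ᵥ G₀⁻¹ *ᵥ y ≤ (ε * γ) ^ 2 * μ := by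
    have := h.centered.primal_feasible
    rw [infeasibility, matNorm, Real.sqrt_le_left (by positivity), mul_pow,
      Real.sq_sqrt pμ.le] at this
    exact this
  have h9 : ∑ i, (ch.Abar A *ᵥ z) i ^ 2
      ≤ Real.exp (2 * γ) * Real.exp (2 * ε) * ((ε * γ) ^ 2 * μ) := by
    refine h7.trans ?_
    have a1 := h5.trans (mul_le_mul_of_nonneg_left h8 (by positivity))
    refine (mul_le_mul_of_nonneg_left a1 (Real.exp_pos γ).le).trans (le_of_eq ?_)
    have : Real.exp (2 * γ) = Real.exp γ * Real.exp γ := by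
      rw [← Real.exp_add]; congr 1; ring
    rw [this]; ring
  rw [h.wNorm_wbar_eq h.deltaC_eq, Real.sqrt_le_left (by positivity)]
  have e : ∑ i, (ch.Abar A *ᵥ ((√μ)⁻¹ • z)) i ^ 2 = μ⁻¹ * ∑ i, (ch.Abar A *ᵥ z) i ^ 2 := by
    rw [Finset.mul_sum]
    refine Finset.sum_congr rfl fun i _ => ?_
    rw [mulVec_smul, Pi.smul_apply, smul_eq_mul, mul_pow, inv_pow, Real.sq_sqrt pμ.le]
  rw [e, inv_mul_le_iff₀ pμ]
  refine h9.trans ?_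
  have h10 : Real.exp (2 * γ) * Real.exp (2 * ε) ≤ (1 + 2 * ε) ^ 2 := by
    rw [← Real.exp_add]
    refine (exp_le_quadratic (by positivity) (by linarith)).trans ?_
    nlinarith
  have := mul_le_mul_of_nonneg_right h10 (by positivity : 0 ≤ (ε * γ) ^ 2 * μ)
  refine this.trans (le_of_eq ?_)
  ring

/-- The projection estimates are natural in the w̄-norm. Passing from τ to w̄ and back costs two
factors 1 + 2ε, which together with 1 + ε stay below 1 + 10ε. -/
lemma stepBounds (h : LSInput A b c x s μ C ch) :
    StepBounds (lsAlpha m n) ε γ (colProj (scaledMat A x s)) (lsWeight A x s) ch.taubar ch.g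
      (ch.deltaP A μ) (ch.deltaC A b x μ) := by
  have h1 := h.gamma_pos
  have h3 := h.eps_pos
  have h4 := h.eps_le
  have hg := h.wNorm_wbar_le ch.g
  have hg0 := wNorm_nonneg (lsWeight A x s) ch.g
  have hp := h.wNorm_wbar_deltaP_le
  have hr := h.wNorm_wbar_reflection_le
  have hc := h.wNorm_wbar_deltaC_le
  have k : (1 + 2 * ε) * ((1 + ε) * (1 + 2 * ε)) ≤ 1 + 10 * ε := by nlinarith [sq_nonneg ε]
  have key : ∀ v, wNorm (wVec ch.xbar ch.sbar μ) v
      ≤ (1 + ε) * wNorm (wVec ch.xbar ch.sbar μ) ch.g →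
      wNorm (lsWeight A x s) v ≤ (1 + 10 * ε) * wNorm (lsWeight A x s) ch.g := fun v hv => by
    have a1 := hv.trans (mul_le_mul_of_nonneg_left hg (by linarith : 0 ≤ 1 + ε))
    have a2 := (h.wNorm_le_wbar v).trans
      (mul_le_mul_of_nonneg_left a1 (by linarith : 0 ≤ 1 + 2 * ε))
    have := mul_le_mul_of_nonneg_right k hg0
    linarith
  refine
    { proj := h.projWeights
      α_pos := lsAlpha_pos h.n_pos h.le
      α_le := lsAlpha_le h.n_pos h.le
      ε_eq := rfl
      γ_pos := h1
      tb_nonneg := fun i => (h.pos_taubar i).le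
      tb_le := h.wNorm_taubar_le
      t_le := h.wNorm_le_taubar
      g_norm := ?_
      dp_w := key _ hp
      dp_sup := ?_
      refl_w := key _ hr
      dc_w := ?_
      dc_sup := ?_ }
  · rw [LSChoice.g, mixedNorm_smul, h.adm.flat_dual.1, abs_neg, abs_of_pos h1, mul_one]
  · have a1 := h.norm_le_wNorm h.deltaP_eq
    have a2 := hp.trans (mul_le_mul_of_nonneg_left hg (by linarith : 0 ≤ 1 + ε))
    have a3 : (1 + ε) * (1 + 2 * ε) ≤ 103 / 100 := by nlinarith
    have := mul_le_mul_of_nonneg_right a3 hg0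
    linarith
  · have a2 := (h.wNorm_le_wbar _).trans
      (mul_le_mul_of_nonneg_left hc (by linarith : 0 ≤ 1 + 2 * ε))
    have a3 : (1 + 2 * ε) * (1 + 2 * ε) ≤ 1 + 10 * ε := by nlinarith
    have := mul_le_mul_of_nonneg_right a3 (by positivity : 0 ≤ ε * γ)
    linarith
  · have a1 := h.norm_le_wNorm h.deltaC_eq
    have : 0 ≤ ε * γ := by positivity
    nlinarith

/-- The mixed norm of the all-ones vector. -/
lemma mixedNorm_one_le (h : LSInput A b c x s μ C ch) :
    mixedNorm (lsAlpha m n) ch.taubar (fun _ => 1) ≤ 15 * √n / lsAlpha m n := by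
  have hα := lsAlpha_pos h.n_pos h.le
  have hα' := lsAlpha_le h.n_pos h.le
  have h3 := h.eps_pos
  have h4 := h.eps_le
  have hsn := one_le_sqrt h.n_pos
  have h1 : ‖(fun _ => 1 : Fin m → ℝ)‖ ≤ 1 := pi_norm_le (by norm_num) fun i => by simp
  have h2 : wNorm (lsWeight A x s) (fun _ => 1) ≤ 1415 / 1000 * √n := by
    rw [wNorm]
    simp only [one_pow, mul_one]
    rw [sum_lsWeight h.n_pos h.nondeg h.centered.pos_x h.centered.pos_s,
      Real.sqrt_le_left (by positivity), mul_pow, Real.sq_sqrt (Nat.cast_nonneg n)]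
    have : (0 : ℝ) ≤ n := Nat.cast_nonneg n
    linarith
  have h5 : wNorm ch.taubar (fun _ => 1) ≤ 142 / 100 * √n := by
    refine (h.wNorm_taubar_le _).trans ?_
    have := mul_le_mul_of_nonneg_left h2 (by linarith : 0 ≤ 1 + ε)
    nlinarith
  rw [mixedNorm_eq, le_div_iff₀ hα, add_mul]
  have h6 : 10 / lsAlpha m n * wNorm ch.taubar (fun _ => 1) * lsAlpha m n
      = 10 * wNorm ch.taubar (fun _ => 1) := by field_simp
  rw [h6]
  have h7 : ‖(fun _ => 1 : Fin m → ℝ)‖ * lsAlpha m n ≤ 1 * (1 / 5) :=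
    mul_le_mul h1 hα' hα.le (by norm_num)
  linarith

end LSInput

end Input

/-! ### Outcomes of the short step -/

section Perturb

variable {m n : ℕ}

/-- The Lee–Sidford weights after a relative change of `x` and `s`. -/
lemma lsWeight_perturb {A : Matrix (Fin m) (Fin n) ℝ} {x s ξ ζ E x' s' : Fin m → ℝ} (hn : 0 < n)
    (hA : NonDegenerate A) (hx : Pos x) (hs : Pos s) (hξ : ∀ i, |ξ i| ≤ 1 / 100)
    (hζ : ∀ i, |ζ i| ≤ 1 / 100)
    (hE : ∀ i, E i = (1 + ξ i) ^ (1 - 2 * lsAlpha m n) * (1 + ζ i) ^ (-1 - 2 * lsAlpha m n) - 1)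
    (hx' : ∀ i, x' i = x i * (1 + ξ i)) (hs' : ∀ i, s' i = s i * (1 + ζ i)) (i : Fin m) :
    |(lsWeight A x' s' i - lsWeight A x s i) / lsWeight A x s i
        - opL (colProj (scaledMat A x s)) (lsWeight A x s) E i|
      ≤ 4 * opB (colProj (scaledMat A x s)) (lsWeight A x s) (fun j => E j ^ 2) i := by
  have hα := lsAlpha_pos hn hA.le
  have hα' := lsAlpha_le hn hA.le
  have hW := projWeights_lsWeight hn hA hx hs
  have hinj := scaledMat_injective hA hx hs
  have pξ : ∀ j, 0 < 1 + ξ j := fun j => by linarith [(abs_le.1 (hξ j)).1]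
  have pζ : ∀ j, 0 < 1 + ζ j := fun j => by linarith [(abs_le.1 (hζ j)).1]
  set α := lsAlpha m n with hαd
  set e : Fin m → ℝ := fun j => (1 + ξ j) ^ (1 / 2 - α) * (1 + ζ j) ^ (-(1 / 2) - α) with he
  have hmat : scaledMat A x' s' = diagonal e * scaledMat A x s := by
    rw [scaledMat, scaledMat, ← Matrix.mul_assoc, diagonal_mul_diagonal]
    congr 2
    funext j
    rw [hx', hs', Real.mul_rpow (hx j).le (pξ j).le, Real.mul_rpow (hs j).le (pζ j).le, he]
    ring
  have hesq : ∀ j, e j ^ 2 = 1 + E j := fun j => by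
    rw [hE, he]
    simp only
    rw [mul_pow, ← Real.rpow_natCast, ← Real.rpow_natCast, ← Real.rpow_mul (pξ j).le,
      ← Real.rpow_mul (pζ j).le]
    have e1 : (1 / 2 - α) * ((2 : ℕ) : ℝ) = 1 - 2 * α := by push_cast; ring
    have e2 : (-(1 / 2) - α) * ((2 : ℕ) : ℝ) = -1 - 2 * α := by push_cast; ring
    rw [e1, e2]; ring
  have hE1 : ∀ j, |E j| ≤ 1 / 2 := fun j => by
    have h1 := abs_rpow_mul_rpow_sub_le hα hα' (hξ j) (hζ j)
    rw [← hE j] at h1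
    have a1 := abs_le.1 (hξ j)
    have a2 := abs_le.1 (hζ j)
    have a3 := abs_le.1 h1
    rw [abs_le]
    constructor <;> nlinarith
  have hexp := leverage_diagonal_expansion hinj hesq hE1 i
  rw [← hmat, leverage_eq_colProj (scaledMat A x s)] at hexp
  have hpos := hW.pos i
  have e1 : lsWeight A x' s' i - lsWeight A x s i
      = leverage (scaledMat A x' s') i - colProj (scaledMat A x s) i i := by
    rw [lsWeight_eq, lsWeight_eq, leverage_eq_colProj (scaledMat A x s)]; ring
  rw [e1, opL, opB, ← sub_div, abs_div, abs_of_pos hpos, ← mul_div_assoc]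
  exact div_le_div_of_nonneg_right hexp hpos.le

end Perturb

/-! ### Bounds for every outcome of the sampling, and the expected potential. -/

section Outcome

variable {m n : ℕ}

namespace LSChoice

/-- The sampling probabilities. -/
noncomputable def prob (ch : LSChoice m n) (i : Fin m) : ℝ := min (ch.q i) 1

/-- The relative change of `x` when the sampled diagonal is `R`. -/
noncomputable def relX (ch : LSChoice m n) (A : Matrix (Fin m) (Fin n) ℝ) (b : Fin n → ℝ)
    (x : Fin m → ℝ) (μ : ℝ) (R : Fin m → ℝ) (i : Fin m) : ℝ :=
  ch.xbar i / x i * ((1 + 2 * lsAlpha m n) * ch.g i - R i * ch.deltaR A b x μ i)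

/-- The relative change of `s`. -/
noncomputable def relS (ch : LSChoice m n) (A : Matrix (Fin m) (Fin n) ℝ) (s : Fin m → ℝ) (μ : ℝ)
    (i : Fin m) : ℝ :=
  ch.sbar i / s i * ((1 - 2 * lsAlpha m n) * ch.deltaP A μ i)

end LSChoice

namespace LSInput

variable {A : Matrix (Fin m) (Fin n) ℝ} {b : Fin n → ℝ} {c x s : Fin m → ℝ} {μ C : ℝ}
  {ch : LSChoice m n}

lemma output_fst (h : LSInput A b c x s μ C ch) (R : Fin m → ℝ) (i : Fin m) :
    (ch.output A b x s μ R).1 i = x i * (1 + ch.relX A b x μ R i) := by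
  have := (h.centered.pos_x i).ne'
  simp only [LSChoice.output, LSChoice.relX, Pi.add_apply, Pi.mul_apply, Pi.sub_apply,
    Pi.smul_apply, smul_eq_mul]
  field_simp

lemma output_snd (h : LSInput A b c x s μ C ch) (R : Fin m → ℝ) (i : Fin m) :
    (ch.output A b x s μ R).2 i = s i * (1 + ch.relS A s μ i) := by
  have := (h.centered.pos_s i).ne'
  simp only [LSChoice.output, LSChoice.relS, Pi.add_apply, Pi.mul_apply,
    Pi.smul_apply, smul_eq_mul]
  field_simp

lemma prob_pos (h : LSInput A b c x s μ C ch) (i : Fin m) : 0 < ch.prob i :=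
  lt_min (h.adm.q_pos i) one_pos

lemma prob_le_one (i : Fin m) : ch.prob i ≤ 1 := min_le_right _ _

lemma log_pos (h : LSInput A b c x s μ C ch) :
    0 < Real.log (m / (lsEps m n * lsR m n)) := by
  have h1 := h.eps_pos
  have h2 := h.eps_le
  have h3 := lsR_pos h.n_pos h.le
  have h4 := lsR_lt h.n_pos h.le
  have h5 := one_le_cast h.n_pos h.le
  refine Real.log_pos ?_
  rw [lt_div_iff₀ (by positivity)]
  nlinarith

lemma leverage_Abar_nonneg (h : LSInput A b c x s μ C ch) (i : Fin m) :
    0 ≤ leverage (ch.Abar A) i :=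
  proj_diag_nonneg (colProj_transpose _) (colProj_mul_self h.Abar_injective) i

lemma q_ge_deltaR (h : LSInput A b c x s μ C ch) (hC : 0 ≤ C) (i : Fin m) :
    m / √n * (ch.deltaR A b x μ i ^ 2 / (∑ j, ch.deltaR A b x μ j ^ 2) + 1 / m) ≤ ch.q i := by
  have h1 := h.adm.q_ge i
  have h2 := h.log_pos
  have h3 := h.leverage_Abar_nonneg i
  have h4 : 0 ≤ C * leverage (ch.Abar A) i * Real.log (m / (lsEps m n * lsR m n))
      / lsGamma m n ^ 2 := by positivity
  linarith

/-- Sampling weights control the sampled step. -/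
lemma deltaR_le_q (h : LSInput A b c x s μ C ch) (hC : 0 ≤ C) (i : Fin m) :
    ch.deltaR A b x μ i ^ 2
        ≤ ch.q i * (wNorm (lsWeight A x s) (ch.deltaR A b x μ) ^ 2 / √n) ∧
      2 * |ch.deltaR A b x μ i| ≤ ch.q i * wNorm (lsWeight A x s) (ch.deltaR A b x μ) := by
  have hq := h.q_ge_deltaR hC i
  have hq0 := h.adm.q_pos i
  set dr := ch.deltaR A b x μ with hdr
  set W := wNorm (lsWeight A x s) dr with hW
  have hW0 : 0 ≤ W := wNorm_nonneg _ _
  have hm := one_le_cast h.n_pos h.le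
  have hn : (0 : ℝ) < n := by exact_mod_cast h.n_pos
  have hsn := one_le_sqrt h.n_pos
  have hsn2 : √(n : ℝ) ^ 2 = n := Real.sq_sqrt hn.le
  -- The summand n/m in τ is what makes the τ-norm control the unweighted norm of δ_r.
  have hWD : n / m * (∑ j, dr j ^ 2) ≤ W ^ 2 := by
    rw [hW, wNorm_sq fun i => (h.projWeights.pos i).le, Finset.mul_sum]
    exact Finset.sum_le_sum fun j _ => mul_le_mul_of_nonneg_right
      (le_lsWeight h.nondeg h.centered.pos_x h.centered.pos_s j) (sq_nonneg _)
  have hD0 : 0 ≤ ∑ j, dr j ^ 2 := by positivity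
  have hi : dr i ^ 2 ≤ ∑ j, dr j ^ 2 :=
    Finset.single_le_sum (f := fun j => dr j ^ 2) (fun j _ => sq_nonneg _) (Finset.mem_univ i)
  set D := ∑ j, dr j ^ 2 with hD
  rcases hD0.eq_or_lt with h0 | h0
  · have : dr i ^ 2 = 0 := le_antisymm (by linarith) (sq_nonneg _)
    have h1 : dr i = 0 := by simpa using this
    rw [h1]
    constructor
    · have : 0 ≤ ch.q i * (W ^ 2 / √n) := by positivity
      simpa using this
    · simpa using mul_nonneg hq0.le hW0
  have hm0 : (0 : ℝ) < m := by linarith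
  have hsn0 : 0 < √(n : ℝ) := by linarith
  constructor
  · have h1 : m / √n * (dr i ^ 2 / D) ≤ ch.q i := by
      refine le_trans ?_ hq
      exact mul_le_mul_of_nonneg_left (by simp) (by positivity)
    have h2 := mul_le_mul h1 (div_le_div_of_nonneg_right hWD hsn0.le) (by positivity) hq0.le
    refine le_trans (le_of_eq ?_) h2
    field_simp
    rw [hsn2]
  · refine abs_le_of_sq_le_sq' ?_ (by positivity) |>.2
    have h1 : 4 * (m / n * (dr i ^ 2 / D)) ≤ ch.q i ^ 2 := by
      have h3 : (m / √n * (dr i ^ 2 / D + 1 / m)) ^ 2 ≤ ch.q i ^ 2 :=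
        pow_le_pow_left₀ (by positivity) hq 2
      refine le_trans ?_ h3
      rw [mul_pow, div_pow, hsn2]
      -- AM-GM on the two summands in the lower bound for q. The uniform summand 1/m therefore gives
      -- a bound linear in |δ_r|.
      have h4 : 4 * (dr i ^ 2 / D * (1 / m)) ≤ (dr i ^ 2 / D + 1 / m) ^ 2 := by
        nlinarith [sq_nonneg (dr i ^ 2 / D - 1 / m)]
      refine le_trans (le_of_eq ?_) (mul_le_mul_of_nonneg_left h4 (by positivity))
      field_simp
    have h2 := mul_le_mul h1 hWD (by positivity) (sq_nonneg _)
    rw [mul_pow, mul_pow, sq_abs]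
    refine le_trans (le_of_eq ?_) h2
    field_simp
    ring

lemma inv_prob_le (h : LSInput A b c x s μ C ch) (i : Fin m) :
    (ch.prob i)⁻¹ ≤ 1 + (ch.q i)⁻¹ := by
  have hq := h.adm.q_pos i
  rw [LSChoice.prob]
  rcases le_total (ch.q i) 1 with h1 | h1
  · rw [min_eq_left h1]; linarith
  · rw [min_eq_right h1, inv_one]
    have := inv_pos.2 hq
    linarith

lemma deltaR_sq_div_prob_le (h : LSInput A b c x s μ C ch) (hC : 0 ≤ C) (i : Fin m) :
    (ch.prob i)⁻¹ * ch.deltaR A b x μ i ^ 2 ≤ ch.deltaR A b x μ i ^ 2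
      + wNorm (lsWeight A x s) (ch.deltaR A b x μ) ^ 2 / √n := by
  have hq := h.adm.q_pos i
  have h1 := mul_le_mul_of_nonneg_right (h.inv_prob_le i) (sq_nonneg (ch.deltaR A b x μ i))
  have h2 := mul_le_mul_of_nonneg_left (h.deltaR_le_q hC i).1 (inv_pos.2 hq).le
  rw [inv_mul_cancel_left₀ hq.ne'] at h2
  linarith

lemma wNorm_deltaR_le (h : LSInput A b c x s μ C ch) :
    wNorm (lsWeight A x s) (ch.deltaR A b x μ) ≤ 15 / 100 * lsAlpha m n * lsGamma m n :=
  h.stepBounds.wNorm_dr_le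

lemma mixedNorm_deltaR_le (h : LSInput A b c x s μ C ch) :
    mixedNorm (lsAlpha m n) ch.taubar (ch.deltaR A b x μ) ≤ 8 / 5 * lsGamma m n :=
  h.stepBounds.mixedNorm_dr_le

/-- Sampling may enlarge an entry by 1/q, but |δ_r|/q is at most half the τ-norm of δ_r. The bound
holds for every outcome, which gives positivity and keeps the expansions valid with probability one.
-/
lemma abs_sample_mul_deltaR_le (h : LSInput A b c x s μ C ch) (hC : 0 ≤ C)
    (e : Fin m → Bool) (i : Fin m) :
    |samplePoint ch.prob e i * ch.deltaR A b x μ i| ≤ 17 / 10 * lsGamma m n := by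
  have hα := lsAlpha_pos h.n_pos h.le
  have hα' := lsAlpha_le h.n_pos h.le
  have hγ := h.gamma_pos
  have hq := h.adm.q_pos i
  have hp := h.prob_pos i
  have h0 : |samplePoint ch.prob e i * ch.deltaR A b x μ i|
      ≤ (ch.prob i)⁻¹ * |ch.deltaR A b x μ i| := by
    rw [abs_mul]
    refine mul_le_mul_of_nonneg_right ?_ (abs_nonneg _)
    rw [samplePoint]
    split_ifs
    · rw [abs_of_pos (inv_pos.2 hp)]
    · simpa using hp.le
  have h1 := mul_le_mul_of_nonneg_right (h.inv_prob_le i) (abs_nonneg (ch.deltaR A b x μ i))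
  have h2 := mul_le_mul_of_nonneg_left (h.deltaR_le_q hC i).2 (inv_pos.2 hq).le
  rw [inv_mul_cancel_left₀ hq.ne'] at h2
  have h3 := h.wNorm_deltaR_le
  have h4 := (abs_apply_le_norm _ i).trans ((norm_le_mixedNorm hα _).trans h.mixedNorm_deltaR_le)
  have h5 : lsAlpha m n * lsGamma m n ≤ 1 / 5 * lsGamma m n :=
    mul_le_mul_of_nonneg_right hα' hγ.le
  linarith

lemma ratio_bound {δ a₁ a₂ : ℝ} (hδ : 0 ≤ δ) (hδ1 : δ ≤ 1 / 2) (ha : 0 < a₂)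
    (h1 : Real.exp (-δ) * a₂ ≤ a₁) (h2 : a₁ ≤ Real.exp δ * a₂) : |a₁ / a₂ - 1| ≤ 2 * δ := by
  rw [← le_div_iff₀ ha] at h1
  rw [← div_le_iff₀ ha] at h2
  have e1 := exp_le_quadratic hδ (by linarith)
  have e2 := Real.add_one_le_exp (-δ)
  rw [abs_le]
  constructor <;> nlinarith

lemma abs_xbar_div_sub_one_le (h : LSInput A b c x s μ C ch) (i : Fin m) :
    |ch.xbar i / x i - 1| ≤ 2 * lsEps m n :=
  ratio_bound h.eps_pos.le (by linarith [h.eps_le]) (h.centered.pos_x i)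
    (h.adm.xbar_approx i).1 (h.adm.xbar_approx i).2

lemma abs_sbar_div_sub_one_le (h : LSInput A b c x s μ C ch) (i : Fin m) :
    |ch.sbar i / s i - 1| ≤ 2 * lsEps m n :=
  ratio_bound h.eps_pos.le (by linarith [h.eps_le]) (h.centered.pos_s i)
    (h.adm.sbar_approx i).1 (h.adm.sbar_approx i).2

lemma abs_w_div_sub_one_le (h : LSInput A b c x s μ C ch) (i : Fin m) :
    |wVec x s μ i / lsWeight A x s i - 1| ≤ 2 * lsEps m n :=
  ratio_bound h.eps_pos.le (by linarith [h.eps_le]) (h.projWeights.pos i)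
    (h.centered.centrality i).1 (h.centered.centrality i).2

lemma abs_relX_le (h : LSInput A b c x s μ C ch) (hC : 0 ≤ C) (e : Fin m → Bool) (i : Fin m) :
    |ch.relX A b x μ (samplePoint ch.prob e) i| ≤ 4 * lsGamma m n := by
  have hα := lsAlpha_pos h.n_pos h.le
  have hα' := lsAlpha_le h.n_pos h.le
  have hγ := h.gamma_pos
  have h1 := h.abs_sample_mul_deltaR_le hC e i
  have h2 := (abs_apply_le_norm _ i).trans h.stepBounds.norm_g_le
  have h3 := h.abs_xbar_div_sub_one_le i
  have h4 := h.eps_le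
  have h5 : |ch.xbar i / x i| ≤ 1001 / 1000 := by
    have := abs_le.1 h3
    rw [abs_le]; constructor <;> linarith
  rw [LSChoice.relX, abs_mul]
  have h6 : |(1 + 2 * lsAlpha m n) * ch.g i
      - samplePoint ch.prob e i * ch.deltaR A b x μ i| ≤ 32 / 10 * lsGamma m n := by
    refine (abs_sub _ _).trans ?_
    rw [abs_mul, abs_of_pos (by linarith : 0 < 1 + 2 * lsAlpha m n)]
    have := mul_le_mul (by linarith : 1 + 2 * lsAlpha m n ≤ 7 / 5) h2 (abs_nonneg _) (by norm_num)
    linarith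
  have := mul_le_mul h5 h6 (abs_nonneg _) (by norm_num)
  linarith

lemma abs_relS_le (h : LSInput A b c x s μ C ch) (i : Fin m) :
    |ch.relS A s μ i| ≤ 4 * lsGamma m n := by
  have hα := lsAlpha_pos h.n_pos h.le
  have hα' := lsAlpha_le h.n_pos h.le
  have hγ := h.gamma_pos
  have h2 := (abs_apply_le_norm _ i).trans
    ((norm_le_mixedNorm hα _).trans h.stepBounds.mixedNorm_dp_le)
  have h3 := h.abs_sbar_div_sub_one_le i
  have h4 := h.eps_le
  have h5 : |ch.sbar i / s i| ≤ 1001 / 1000 := by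
    have := abs_le.1 h3
    rw [abs_le]; constructor <;> linarith
  rw [LSChoice.relS, abs_mul, abs_mul, abs_of_pos (by linarith : 0 < 1 - 2 * lsAlpha m n)]
  have h6 := mul_le_mul (by linarith : 1 - 2 * lsAlpha m n ≤ 1) h2 (abs_nonneg _) (by norm_num)
  have := mul_le_mul h5 h6 (mul_nonneg (by linarith) (abs_nonneg _)) (by norm_num)
  linarith

lemma gamma_small (h : LSInput A b c x s μ C ch) : 4 * lsGamma m n ≤ 1 / 1000 := by
  have := h.gamma_le; have := h.eps_le; linarith

lemma output_pos (h : LSInput A b c x s μ C ch) (hC : 0 ≤ C) (e : Fin m → Bool) :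
    Pos (ch.output A b x s μ (samplePoint ch.prob e)).1 ∧
      Pos (ch.output A b x s μ (samplePoint ch.prob e)).2 := by
  have hs := h.gamma_small
  refine ⟨fun i => ?_, fun i => ?_⟩
  · rw [h.output_fst]
    have := (abs_le.1 (h.abs_relX_le hC e i)).1
    exact mul_pos (h.centered.pos_x i) (by linarith)
  · rw [h.output_snd]
    have := (abs_le.1 (h.abs_relS_le i)).1
    exact mul_pos (h.centered.pos_s i) (by linarith)

lemma cubeExp_relX (h : LSInput A b c x s μ C ch) (i : Fin m) :
    cubeExp ch.prob (fun e => ch.relX A b x μ (samplePoint ch.prob e) i)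
      = ch.xbar i / x i * ((1 + 2 * lsAlpha m n) * ch.g i - ch.deltaR A b x μ i) := by
  have hp := (h.prob_pos i).ne'
  have := cubeExp_coord ch.prob i (fun t => ch.xbar i / x i * ((1 + 2 * lsAlpha m n) * ch.g i
    - (if t then (ch.prob i)⁻¹ else 0) * ch.deltaR A b x μ i))
  simp only [LSChoice.relX, samplePoint]
  rw [this]
  simp only [if_true, Bool.false_eq_true, if_false]
  field_simp
  ring

lemma cubeExp_relX_sq_le (h : LSInput A b c x s μ C ch) (hC : 0 ≤ C) (i : Fin m) :
    cubeExp ch.prob (fun e => ch.relX A b x μ (samplePoint ch.prob e) i ^ 2)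
      ≤ 4 * ch.g i ^ 2 + 21 / 10 * (ch.deltaR A b x μ i ^ 2
        + wNorm (lsWeight A x s) (ch.deltaR A b x μ) ^ 2 / √n) := by
  have hα := lsAlpha_pos h.n_pos h.le
  have hα' := lsAlpha_le h.n_pos h.le
  have hp := h.prob_pos i
  have hp1 := prob_le_one (ch := ch) i
  have h1 := cubeExp_coord ch.prob i (fun t => (ch.xbar i / x i *
    ((1 + 2 * lsAlpha m n) * ch.g i - (if t then (ch.prob i)⁻¹ else 0) * ch.deltaR A b x μ i)) ^ 2)
  simp only [LSChoice.relX, samplePoint]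
  rw [h1]
  simp only [if_true, Bool.false_eq_true, if_false]
  have h2 := h.deltaR_sq_div_prob_le hC i
  have h3 := h.abs_xbar_div_sub_one_le i
  have h4 := h.eps_le
  set y := ch.xbar i / x i
  set a := (1 + 2 * lsAlpha m n) * ch.g i with ha
  set d := ch.deltaR A b x μ i
  set p := ch.prob i
  have hy : y ^ 2 ≤ 1002 / 1000 := by
    have := abs_le.1 h3; nlinarith
  have ha2 : a ^ 2 ≤ 196 / 100 * ch.g i ^ 2 := by
    rw [ha, mul_pow]
    exact mul_le_mul_of_nonneg_right (by nlinarith) (sq_nonneg _)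
  have e : p * (y * (a - p⁻¹ * d)) ^ 2 + (1 - p) * (y * (a - 0 * d)) ^ 2
      = y ^ 2 * (a ^ 2 - 2 * a * d + p⁻¹ * d ^ 2) := by
    field_simp; ring
  rw [e]
  have hdp : d ^ 2 ≤ p⁻¹ * d ^ 2 :=
    le_mul_of_one_le_left (sq_nonneg _) ((one_le_inv₀ hp).2 hp1)
  have h5 : a ^ 2 - 2 * a * d + p⁻¹ * d ^ 2 ≤ 2 * a ^ 2 + 2 * (p⁻¹ * d ^ 2) := by
    nlinarith [sq_nonneg (a + d)]
  have h6 : y ^ 2 * (a ^ 2 - 2 * a * d + p⁻¹ * d ^ 2)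
      ≤ 1002 / 1000 * (2 * a ^ 2 + 2 * (p⁻¹ * d ^ 2)) :=
    (mul_le_mul_of_nonneg_left h5 (sq_nonneg y)).trans
      (mul_le_mul_of_nonneg_right hy (by positivity))
  have : 0 ≤ ch.g i ^ 2 := sq_nonneg _
  have : 0 ≤ d ^ 2 := sq_nonneg _
  linarith

lemma relS_sq_le (h : LSInput A b c x s μ C ch) (i : Fin m) :
    ch.relS A s μ i ^ 2 ≤ 11 / 10 * ch.deltaP A μ i ^ 2 := by
  have hα := lsAlpha_pos h.n_pos h.le
  have hα' := lsAlpha_le h.n_pos h.le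
  have h3 := abs_le.1 (h.abs_sbar_div_sub_one_le i)
  have h4 := h.eps_le
  rw [LSChoice.relS, mul_pow, mul_pow, ← mul_assoc]
  refine mul_le_mul_of_nonneg_right ?_ (sq_nonneg _)
  have a1 : (ch.sbar i / s i) ^ 2 ≤ 11 / 10 := by nlinarith
  have a2 : (1 - 2 * lsAlpha m n) ^ 2 ≤ 1 := by nlinarith
  have := mul_le_mul a1 a2 (sq_nonneg _) (by norm_num)
  linarith

/-- The expected potential after the short step. -/
theorem cubeExp_potential_le (h : LSInput A b c x s μ C ch) (hC : 0 ≤ C) {μnew : ℝ}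
    (hμ : |μnew - μ| ≤ lsR m n * μ) :
    cubeExp ch.prob (fun e => centralityPotential (lsLam m n) (lsWeight A)
        (ch.output A b x s μ (samplePoint ch.prob e)).1
        (ch.output A b x s μ (samplePoint ch.prob e)).2 μnew) ≤
      (1 - lsLam m n * lsR m n) * centralityPotential (lsLam m n) (lsWeight A) x s μ
        + 2 * m := by
  have hα := lsAlpha_pos h.n_pos h.le
  have hα' := lsAlpha_le h.n_pos h.le
  have hγ := h.gamma_pos
  have hε := h.eps_pos
  have hε' := h.eps_le
  have hγs := h.gamma_small
  have hsn := one_le_sqrt h.n_pos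
  have pμ := h.centered.pos_mu
  have hrs := lsR_mul_sqrt (m := m) h.n_pos
  have hrle := lsR_le h.n_pos h.le
  have hr0 := lsR_pos h.n_pos h.le
  have hW := h.projWeights
  have h0 : ∀ i, 0 ≤ ch.prob i := fun i => (h.prob_pos i).le
  have h1 : ∀ i, ch.prob i ≤ 1 := fun i => prob_le_one i
  set α := lsAlpha m n
  set P := colProj (scaledMat A x s)
  set τ := lsWeight A x s with hτ
  set ρ := μnew / μ - 1 with hρd
  have hρr : |ρ| ≤ lsR m n := by
    have e : ρ = (μnew - μ) / μ := by rw [hρd]; field_simp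
    rw [e, abs_div, abs_of_pos pμ, div_le_iff₀ pμ]; exact hμ
  have hρ : |ρ| ≤ 4 * lsGamma m n := by
    refine hρr.trans (hrle.trans ?_)
    nlinarith
  have hρs : |ρ| * √n ≤ lsEps m n * lsGamma m n := by
    rw [← hrs]; exact mul_le_mul_of_nonneg_right hρr (by linarith)
  have hμn : μnew = μ * (1 + ρ) := by rw [hρd]; field_simp; ring
  set ξ : (Fin m → Bool) → Fin m → ℝ := fun e => ch.relX A b x μ (samplePoint ch.prob e) with hξ
  set ζ : Fin m → ℝ := ch.relS A s μ with hζ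
  set E : (Fin m → Bool) → Fin m → ℝ := fun e i =>
    (1 + ξ e i) ^ (1 - 2 * α) * (1 + ζ i) ^ (-1 - 2 * α) - 1 with hE
  set S : (Fin m → Bool) → Fin m → ℝ := fun e i => ξ e i ^ 2 + ζ i ^ 2 with hS
  set θ : (Fin m → Bool) → Fin m → ℝ := fun e i =>
    (lsWeight A (ch.output A b x s μ (samplePoint ch.prob e)).1
      (ch.output A b x s μ (samplePoint ch.prob e)).2 i - τ i) / τ i with hθ
  set d : (Fin m → Bool) → Fin m → ℝ := fun e i =>
    (1 + ξ e i) * (1 + ζ i) / ((1 + ρ) * (1 + θ e i)) - 1 with hd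
  set lin : (Fin m → Bool) → Fin m → ℝ := fun e i =>
    ξ e i + ζ i - opL P τ ((1 - 2 * α) • ξ e - (1 + 2 * α) • ζ) i - ρ with hlin
  set Q : (Fin m → Bool) → Fin m → ℝ := fun e i => S e i + opB P τ (S e) i + ρ ^ 2 with hQ
  set v : Fin m → ℝ := fun i => wVec x s μ i / τ i with hv
  -- In every outcome 4γ bounds all relative changes of x, s and μ. Then |d| ≤ 60γ and λ·60γ = 0.6ε,
  -- well inside the range of the expansion of cosh.
  have hout : ∀ e i, |d e i - lin e i| ≤ 210 * Q e i ∧ d e i ^ 2 ≤ 120 * Q e i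
      ∧ |d e i| ≤ 15 * (4 * lsGamma m n) ∧ |θ e i| ≤ 10 * (4 * lsGamma m n) := fun e i =>
    ratio_change_bounds hW hγs hρ (h.abs_relX_le hC e) h.abs_relS_le (fun i => rfl) hα hα'
      (fun i => rfl) (fun i => lsWeight_perturb h.n_pos h.nondeg h.centered.pos_x
        h.centered.pos_s (fun i => (h.abs_relX_le hC e i).trans (by linarith))
        (fun i => (h.abs_relS_le i).trans (by linarith)) (fun i => rfl)
        (h.output_fst _) (h.output_snd _) i) i
  have hphi : ∀ e i, wVec (ch.output A b x s μ (samplePoint ch.prob e)).1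
      (ch.output A b x s μ (samplePoint ch.prob e)).2 μnew i
      / lsWeight A (ch.output A b x s μ (samplePoint ch.prob e)).1
        (ch.output A b x s μ (samplePoint ch.prob e)).2 i = v i * (1 + d e i) := fun e i => by
    have hτp := hW.pos i
    have t1 : lsWeight A (ch.output A b x s μ (samplePoint ch.prob e)).1
        (ch.output A b x s μ (samplePoint ch.prob e)).2 i = τ i * (1 + θ e i) := by
      rw [hθ]; field_simp; ring
    have t2 := (abs_le.1 (hout e i).2.2.2).1
    have t3 := (abs_le.1 hρ).1
    have t4 : 1 + θ e i ≠ 0 := by linarith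
    have t5 : 1 + ρ ≠ 0 := by linarith
    rw [t1]
    simp only [hd, hv, wVec, h.output_fst, h.output_snd, hμn, hξ, hζ]
    field_simp
    ring
  set xh : Fin m → ℝ := fun i => ch.xbar i / x i
  set sh : Fin m → ℝ := fun i => ch.sbar i / s i
  have hξE : ∀ i, cubeExp ch.prob (fun e => ξ e i)
      = (xh * ((1 + 2 * α) • ch.g - ((1 + 2 * α) • ch.deltaP A μ + ch.deltaC A b x μ))) i :=
    fun i => h.cubeExp_relX i
  set ξh := xh * ((1 + 2 * α) • ch.g - ((1 + 2 * α) • ch.deltaP A μ + ch.deltaC A b x μ))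
    with hξh
  have hζE : ζ = sh * ((1 - 2 * α) • ch.deltaP A μ) := rfl
  -- The sampling is unbiased and the linear part is affine in ξ, so its expectation replaces ξ by
  -- its mean.
  have hlinE : (fun i => cubeExp ch.prob fun e => lin e i)
      = ξh + ζ - opL P τ ((1 - 2 * α) • ξh - (1 + 2 * α) • ζ) - fun _ => ρ := by
    funext i
    simp only [hlin]
    rw [cubeExp_sub, cubeExp_sub, cubeExp_add, cubeExp_const, cubeExp_const, cubeExp_opL, hξE]
    simp only [Pi.sub_apply, Pi.add_apply]
    congr 3
    funext j
    simp only [Pi.sub_apply, Pi.smul_apply, smul_eq_mul]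
    rw [cubeExp_sub, cubeExp_const_mul, cubeExp_const, hξE]
  have hdrift := h.stepBounds.mixedNorm_drift_le (v := v) h.abs_w_div_sub_one_le
    h.abs_xbar_div_sub_one_le h.abs_sbar_div_sub_one_le h.mixedNorm_one_le hρs hξh hζE rfl
  rw [← hlinE] at hdrift
  set ES : Fin m → ℝ := fun i => cubeExp ch.prob (fun e => S e i) with hES
  have hQE : (fun i => cubeExp ch.prob fun e => Q e i) = ES + opB P τ ES + fun _ => ρ ^ 2 := by
    funext i
    simp only [hQ]
    rw [cubeExp_add, cubeExp_add, cubeExp_const, cubeExp_opB]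
    rfl
  have hES0 : ∀ i, 0 ≤ ES i := fun i => cubeExp_nonneg h0 h1 fun e => by
    simp only [hS]; positivity
  have hESle : ∀ i, ES i ≤ 4 * ch.g i ^ 2 + 21 / 10 * (((1 + 2 * α) • ch.deltaP A μ
      + ch.deltaC A b x μ) i ^ 2 + wNorm τ (ch.deltaR A b x μ) ^ 2 / √n)
      + 11 / 10 * ch.deltaP A μ i ^ 2 := fun i => by
    simp only [hES, hS]
    rw [cubeExp_add, cubeExp_const]
    exact add_le_add (h.cubeExp_relX_sq_le hC i) (h.relS_sq_le i)
  have hsecond := h.stepBounds.mixedNorm_second_moment_le hsn h.mixedNorm_one_le hρs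
    (by positivity) (le_of_eq (div_mul_cancel₀ _ (by linarith : √(n : ℝ) ≠ 0))) hES0 hESle
  rw [← hQE] at hsecond
  have hvb : ∀ i, |v i - ch.vbar i| ≤ lsGamma m n := fun i => by
    have := (abs_apply_le_norm _ i).trans h.adm.vbar_approx
    rwa [abs_sub_comm]
  have hfin := h.stepBounds.sum_cubeExp_phi_le h0 h1 (lsLam_ge h.n_pos h.le)
    (lsLam_mul_gamma h.n_pos h.le) hsn hrs h.mixedNorm_one_le (v := v) h.abs_w_div_sub_one_le hvb
    h.adm.flat_dual rfl (fun e i => (hout e i).1) (fun e i => (hout e i).2.1)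
    (fun e i => ((hout e i).2.2.1).trans (by linarith)) hdrift.1 hdrift.2 hsecond
  simp only [centralityPotential, hphi]
  exact hfin

end LSInput

end Outcome

/-! ### Primal feasibility after the short step -/

section Feasibility

variable {m n : ℕ}

/-- Outcomes in which a certain coin fails have weight zero and may be ignored. -/
lemma cubeExp_mono_of_weight {p : Fin m → ℝ} (h0 : ∀ i, 0 ≤ p i) (h1 : ∀ i, p i ≤ 1)
    {f g : (Fin m → Bool) → ℝ} (h : ∀ c, (∀ i, p i = 1 → c i = true) → f c ≤ g c) :
    cubeExp p f ≤ cubeExp p g := by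
  refine Finset.sum_le_sum fun c _ => ?_
  by_cases hc : ∀ i, p i = 1 → c i = true
  · exact mul_le_mul_of_nonneg_left (h c hc) (cubeWeight_nonneg h0 h1 c)
  · push Not at hc
    obtain ⟨i, hi, hci⟩ := hc
    have : cubeWeight p c = 0 :=
      Finset.prod_eq_zero (Finset.mem_univ i) (by simp [hci, hi])
    simp [this]

namespace LSChoice

/-- The vector `z` with `δ_r = Wbar^(-1/2) Abar z`. -/
noncomputable def stepDir (ch : LSChoice m n) (A : Matrix (Fin m) (Fin n) ℝ) (b : Fin n → ℝ)
    (x : Fin m → ℝ) (μ : ℝ) : Fin n → ℝ :=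
  (1 + 2 * lsAlpha m n) • (ch.H⁻¹ *ᵥ ((ch.Abar A)ᵀ *ᵥ (diagonal (ch.sqrtWbar μ) *ᵥ ch.g)))
    + (√μ)⁻¹ • (ch.H⁻¹ *ᵥ (Aᵀ *ᵥ x - b))

/-- The error of the sampled step. -/
noncomputable def sampleError (ch : LSChoice m n) (A : Matrix (Fin m) (Fin n) ℝ) (b : Fin n → ℝ)
    (x : Fin m → ℝ) (μ : ℝ) (R : Fin m → ℝ) : Fin m → ℝ :=
  fun i => (R i - 1) * (ch.Abar A *ᵥ ch.stepDir A b x μ) i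

end LSChoice

namespace LSInput

variable {A : Matrix (Fin m) (Fin n) ℝ} {b : Fin n → ℝ} {c x s : Fin m → ℝ} {μ C : ℝ}
  {ch : LSChoice m n}

lemma deltaR_eq (h : LSInput A b c x s μ C ch) (i : Fin m) :
    ch.deltaR A b x μ i
      = (ch.sqrtWbar μ i)⁻¹ * (ch.Abar A *ᵥ ch.stepDir A b x μ) i := by
  rw [LSChoice.deltaR, Pi.add_apply, Pi.smul_apply, h.deltaP_eq, h.deltaC_eq, LSChoice.stepDir,
    mulVec_add, mulVec_smul _ (1 + 2 * lsAlpha m n), Pi.add_apply, Pi.smul_apply, smul_eq_mul,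
    smul_eq_mul]
  ring

/-- The left side is the w̄-norm of δ_r, and 0.15α ≤ 0.03 leaves room below 1/25. -/
lemma sqrt_sum_Abar_stepDir_le (h : LSInput A b c x s μ C ch) :
    √(∑ i, (ch.Abar A *ᵥ ch.stepDir A b x μ) i ^ 2) ≤ lsGamma m n / 25 := by
  have hγ := h.gamma_pos
  have hε := h.eps_pos
  have hε' := h.eps_le
  have hα' := lsAlpha_le h.n_pos h.le
  rw [← h.wNorm_wbar_eq h.deltaR_eq]
  have h1 := h.wNorm_wbar_le (ch.deltaR A b x μ)
  have h2 := h.wNorm_deltaR_le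
  have h3 := mul_le_mul_of_nonneg_right hα' hγ.le
  have h4 := mul_le_mul_of_nonneg_left h2 (by linarith : 0 ≤ 1 + 2 * lsEps m n)
  nlinarith

lemma transpose_xbar_mulVec (h : LSInput A b c x s μ C ch) (u : Fin m → ℝ) :
    Aᵀ *ᵥ (ch.xbar * u) = √μ • ((ch.Abar A)ᵀ *ᵥ (fun i => ch.sqrtWbar μ i * u i)) := by
  rw [LSChoice.Abar, transpose_mul, diagonal_transpose, ← mulVec_mulVec, ← mulVec_smul]
  congr 1
  funext i
  have pμ := h.centered.pos_mu
  have px := h.pos_xbar i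
  have ps := h.pos_sbar i
  have e1 := Real.mul_self_sqrt px.le
  have e2 := Real.sqrt_pos.2 ps
  have e3 := Real.sqrt_pos.2 pμ
  rw [Pi.mul_apply, Pi.smul_apply, mulVec_diagonal, LSChoice.sqrtWbar, wVec,
    Real.sqrt_div (by positivity), Real.sqrt_mul px.le, smul_eq_mul]
  field_simp
  rw [sq, e1, mul_comm]

/-- Entrywise s̄ w̄^(-1/2) (x̄/s̄)^(1/2) = √μ. Hence S̄δ_p lies in the range of A, which is what
dual feasibility needs. -/
lemma sbar_mul_Abar (h : LSInput A b c x s μ C ch) (z : Fin n → ℝ) :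
    ch.sbar * (fun i => (ch.sqrtWbar μ i)⁻¹ * (ch.Abar A *ᵥ z) i) = √μ • (A *ᵥ z) := by
  funext i
  have pμ := h.centered.pos_mu
  have px := h.pos_xbar i
  have ps := h.pos_sbar i
  have e1 := Real.mul_self_sqrt ps.le
  have e2 := Real.sqrt_pos.2 ps
  have e3 := Real.sqrt_pos.2 pμ
  have e4 := Real.sqrt_pos.2 px
  rw [Pi.mul_apply, Pi.smul_apply, LSChoice.Abar, ← mulVec_mulVec, mulVec_diagonal,
    LSChoice.sqrtWbar, wVec, Real.sqrt_div (by positivity), Real.sqrt_mul px.le, smul_eq_mul]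
  field_simp
  rw [sq, e1]

/-- The primal residual of the output. -/
lemma residual_eq (h : LSInput A b c x s μ C ch) (R : Fin m → ℝ) :
    Aᵀ *ᵥ (ch.output A b x s μ R).1 - b
      = √μ • ((ch.H - (ch.Abar A)ᵀ * ch.Abar A) *ᵥ ch.stepDir A b x μ
        - (ch.Abar A)ᵀ *ᵥ ch.sampleError A b x μ R) := by
  have e3 := (Real.sqrt_pos.2 h.centered.pos_mu).ne'
  have h1 : ch.H *ᵥ ch.stepDir A b x μ
      = (1 + 2 * lsAlpha m n) • ((ch.Abar A)ᵀ *ᵥ (diagonal (ch.sqrtWbar μ) *ᵥ ch.g))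
        + (√μ)⁻¹ • (Aᵀ *ᵥ x - b) := by
    rw [LSChoice.stepDir, mulVec_add, mulVec_smul, mulVec_smul, mulVec_inv_mulVec h.posDef_H,
      mulVec_inv_mulVec h.posDef_H]
  have h2 : (fun i => ch.sqrtWbar μ i * ((1 + 2 * lsAlpha m n) • ch.g - R * ch.deltaR A b x μ) i)
      = (1 + 2 * lsAlpha m n) • (diagonal (ch.sqrtWbar μ) *ᵥ ch.g)
        - (ch.Abar A *ᵥ ch.stepDir A b x μ + ch.sampleError A b x μ R) := by
    funext i
    have := (h.sqrtWbar_pos i).ne'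
    simp only [Pi.sub_apply, Pi.smul_apply, Pi.mul_apply, Pi.add_apply, h.deltaR_eq,
      mulVec_diagonal, LSChoice.sampleError, smul_eq_mul]
    field_simp
    ring
  have h3 : (ch.output A b x s μ R).1
      = x + ch.xbar * ((1 + 2 * lsAlpha m n) • ch.g - R * ch.deltaR A b x μ) := rfl
  rw [h3, mulVec_add, h.transpose_xbar_mulVec, h2, sub_mulVec, h1, mulVec_sub, mulVec_add,
    mulVec_smul, mulVec_mulVec _ (ch.Abar A)ᵀ (ch.Abar A)]
  simp only [smul_sub, smul_add, smul_smul, mul_inv_cancel₀ e3, one_smul]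
  abel

lemma gram_le_output_gram (h : LSInput A b c x s μ C ch) (hC : 0 ≤ C) (e : Fin m → Bool)
    (z : Fin n → ℝ) :
    z ⬝ᵥ ((ch.Abar A)ᵀ * ch.Abar A) *ᵥ z ≤ 1001 / 1000 * (z ⬝ᵥ
      (Aᵀ * diagonal (fun i => (ch.output A b x s μ (samplePoint ch.prob e)).1 i
        / (ch.output A b x s μ (samplePoint ch.prob e)).2 i) * A) *ᵥ z) := by
  have hε := h.eps_pos
  have hε' := h.eps_le
  have hγ := h.gamma_le
  rw [h.Abar_gram, weighted_gram_form, weighted_gram_form, Finset.mul_sum]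
  refine Finset.sum_le_sum fun i _ => ?_
  rw [← mul_assoc (1001 / 1000 : ℝ)]
  refine mul_le_mul_of_nonneg_right ?_ (mul_self_nonneg _)
  have px := h.centered.pos_x i
  have ps := h.centered.pos_s i
  have h1 := abs_le.1 (h.abs_xbar_div_sub_one_le i)
  have h2 := abs_le.1 (h.abs_sbar_div_sub_one_le i)
  have h3 := abs_le.1 (h.abs_relX_le hC e i)
  have h4 := abs_le.1 (h.abs_relS_le i)
  have pb := h.pos_sbar i
  rw [h.output_fst, h.output_snd]
  set ξ := ch.relX A b x μ (samplePoint ch.prob e) i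
  set ζ := ch.relS A s μ i
  have hx : ch.xbar i ≤ (1 + 2 * lsEps m n) * x i := by
    rw [← div_le_iff₀ px]; linarith
  have hs : (1 - 2 * lsEps m n) * s i ≤ ch.sbar i := by
    rw [← le_div_iff₀ ps]; linarith
  have hζ : 0 < 1 + ζ := by linarith
  rw [← mul_div_assoc, div_le_div_iff₀ pb (by positivity)]
  have a1 : ch.xbar i * (s i * (1 + ζ)) ≤ ((1 + 2 * lsEps m n) * x i) * (s i * (1 + ζ)) :=
    mul_le_mul_of_nonneg_right hx (by positivity)
  have a2 : 1001 / 1000 * (x i * (1 + ξ)) * ((1 - 2 * lsEps m n) * s i)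
      ≤ 1001 / 1000 * (x i * (1 + ξ)) * ch.sbar i :=
    mul_le_mul_of_nonneg_left hs (mul_nonneg (by norm_num) (mul_nonneg px.le (by linarith)))
  have a3 : (1 + 2 * lsEps m n) * (1 + ζ) ≤ 1001 / 1000 * (1 + ξ) * (1 - 2 * lsEps m n) := by
    nlinarith
  have a4 := mul_le_mul_of_nonneg_left a3 (by positivity : 0 ≤ x i * s i)
  linarith

/-- In the G⁻¹-norm, with G = ĀᵀĀ, the part of the residual due to H is at most 1.1γ·γ/25,
negligible since γ ≤ ε/1000. The sampling part is the projected error, at most εγ/4 by hypothesis.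
The parallelogram bound and the small changes of metric and of μ still leave εγ/2. -/
lemma infeasibility_le (h : LSInput A b c x s μ C ch) (hC : 0 ≤ C) (e : Fin m → Bool) {μnew : ℝ}
    (hμ : |μnew - μ| ≤ lsR m n * μ)
    (he : ∑ i, (colProj (ch.Abar A) *ᵥ ch.sampleError A b x μ (samplePoint ch.prob e)) i ^ 2
      ≤ (lsEps m n * lsGamma m n / 4) ^ 2) :
    infeasibility A b (ch.output A b x s μ (samplePoint ch.prob e)).1
      (ch.output A b x s μ (samplePoint ch.prob e)).2
      ≤ lsEps m n / 2 * lsGamma m n * √μnew := by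
  have hε := h.eps_pos
  have hε' := h.eps_le
  have hγ := h.gamma_pos
  have hγ' := h.gamma_le
  have pμ := h.centered.pos_mu
  have hr := lsR_le h.n_pos h.le
  have hinj := h.Abar_injective
  set G := (ch.Abar A)ᵀ * ch.Abar A with hG
  have pG : G.PosDef := gram_posDef hinj
  obtain ⟨px', ps'⟩ := h.output_pos hC e
  have hK := inv_form_le pG (weighted_gram_posDef h.nondeg.injective
    fun i => div_pos (px' i) (ps' i)) (h.gram_le_output_gram hC e)
    (Aᵀ *ᵥ (ch.output A b x s μ (samplePoint ch.prob e)).1 - b)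
  set z := ch.stepDir A b x μ with hz
  set k := ch.sampleError A b x μ (samplePoint ch.prob e) with hk
  have hB := h.sqrt_sum_Abar_stepDir_le
  rw [Real.sqrt_le_left (by positivity)] at hB
  have hQ1 : ((ch.H - G) *ᵥ z) ⬝ᵥ G⁻¹ *ᵥ ((ch.H - G) *ᵥ z)
      ≤ (11 / 10 * lsGamma m n) ^ 2 * (lsGamma m n / 25) ^ 2 := by
    have h1 : (ch.H - G)ᵀ = ch.H - G := by
      rw [transpose_sub, posDef_symm h.posDef_H, posDef_symm pG]
    refine (form_inv_le_of_abs_le pG h1 (by positivity) (fun w => ?_) z).trans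
      (mul_le_mul_of_nonneg_left ?_ (by positivity))
    · have b1 := h.adm.H_approx.form_le w
      have b2 := h.adm.H_approx.le_form w
      have b3 := posSemidef_form_nonneg pG.posSemidef w
      have b5 := posSemidef_form_nonneg h.posDef_H.posSemidef w
      have b4 := exp_le_quadratic hγ.le (by linarith)
      rw [← hG] at b1 b2
      rw [sub_mulVec, dotProduct_sub, abs_le]
      have b6 : Real.exp (lsGamma m n) - 1 ≤ 101 / 100 * lsGamma m n := by nlinarith
      have b7 := mul_le_mul_of_nonneg_right b6 b3
      have b8 := mul_le_mul_of_nonneg_right b6 b5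
      constructor
      · have : 101 / 100 * lsGamma m n * (w ⬝ᵥ ch.H *ᵥ w)
            ≤ 101 / 100 * lsGamma m n * ((1 + 101 / 100 * lsGamma m n) * (w ⬝ᵥ G *ᵥ w)) :=
          mul_le_mul_of_nonneg_left (by linarith) (by positivity)
        have h9 : 101 / 100 * lsGamma m n * (1 + 101 / 100 * lsGamma m n)
            ≤ 11 / 10 * lsGamma m n := by nlinarith
        have := mul_le_mul_of_nonneg_right h9 b3
        linarith
      · have : 0 ≤ lsGamma m n * (w ⬝ᵥ G *ᵥ w) := by positivity
        linarith
    · rw [gram_form]; exact hB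
  have hQ2 : ((ch.Abar A)ᵀ *ᵥ k) ⬝ᵥ G⁻¹ *ᵥ ((ch.Abar A)ᵀ *ᵥ k)
      ≤ (lsEps m n * lsGamma m n / 4) ^ 2 := by
    rw [hG, ← colProj_mulVec_sq hinj]; exact he
  have hpar : ∀ u v : Fin n → ℝ, (u - v) ⬝ᵥ G⁻¹ *ᵥ (u - v)
      ≤ 2 * (u ⬝ᵥ G⁻¹ *ᵥ u) + 2 * (v ⬝ᵥ G⁻¹ *ᵥ v) := fun u v => by
    have := posSemidef_form_nonneg pG.inv.posSemidef (u + v)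
    simp only [mulVec_add, mulVec_sub, dotProduct_add, dotProduct_sub, add_dotProduct,
      sub_dotProduct] at this ⊢
    linarith
  have hQ := (hpar _ _).trans (add_le_add (mul_le_mul_of_nonneg_left hQ1 zero_le_two)
    (mul_le_mul_of_nonneg_left hQ2 zero_le_two))
  rw [h.residual_eq, mulVec_smul, dotProduct_smul, smul_dotProduct, smul_eq_mul, smul_eq_mul,
    mulVec_smul, dotProduct_smul, smul_dotProduct, smul_eq_mul, smul_eq_mul, ← mul_assoc (√μ),
    ← mul_assoc (√μ), Real.mul_self_sqrt pμ.le] at hK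
  have hμn : 999 / 1000 * μ ≤ μnew := by
    have := (abs_le.1 hμ).1
    have h2 : lsR m n ≤ 1 / 1000 := hr.trans (by nlinarith)
    have := mul_le_mul_of_nonneg_right h2 pμ.le
    linarith
  rw [infeasibility, matNorm, h.residual_eq, Real.sqrt_le_left (by positivity), mul_pow,
    Real.sq_sqrt (by linarith), mulVec_smul, dotProduct_smul, smul_dotProduct, smul_eq_mul,
    smul_eq_mul, ← mul_assoc (√μ), Real.mul_self_sqrt pμ.le]
  refine hK.trans ?_
  have hg2 : lsGamma m n ^ 2 * lsGamma m n ^ 2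
      ≤ (lsEps m n / 1000) ^ 2 * lsGamma m n ^ 2 :=
    mul_le_mul_of_nonneg_right (pow_le_pow_left₀ hγ.le hγ' 2) (sq_nonneg _)
  have hT : 2 * ((11 / 10 * lsGamma m n) ^ 2 * (lsGamma m n / 25) ^ 2)
      + 2 * (lsEps m n * lsGamma m n / 4) ^ 2 ≤ 2 / 10 * (lsEps m n * lsGamma m n) ^ 2 := by
    nlinarith [sq_nonneg (lsEps m n * lsGamma m n)]
  have h5 := mul_le_mul_of_nonneg_left (hQ.trans hT) pμ.le
  have h6 := mul_le_mul_of_nonneg_left hμn (sq_nonneg (lsEps m n * lsGamma m n))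
  have h7 : 0 ≤ (lsEps m n * lsGamma m n) ^ 2 * μ := by positivity
  nlinarith

/-- The two values of a centred sampling coefficient, `0` when the index is always sampled. -/
noncomputable def centredCoin (p : ℝ) (t : Bool) : ℝ :=
  if p = 1 then 0 else if t then p⁻¹ - 1 else -1

lemma centredCoin_mean {p : ℝ} (hp : 0 < p) :
    p * centredCoin p true + (1 - p) * centredCoin p false = 0 := by
  rcases eq_or_ne p 1 with rfl | h
  · simp [centredCoin]
  · simp only [centredCoin, h, if_false, if_true, Bool.false_eq_true]
    field_simp
    ring

lemma abs_centredCoin_le {q : ℝ} (hq : 0 < q) (t : Bool) : |centredCoin (min q 1) t| ≤ q⁻¹ := by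
  have hq' := inv_pos.2 hq
  -- For q above 1 the bound q⁻¹ can be smaller than 1, so the impossible value -1 of a certain coin
  -- would violate it. This is why `centredCoin` is zero there.
  rcases le_or_gt 1 q with h | h
  · simp [centredCoin, min_eq_right h, hq'.le]
  · have h1 := (one_le_inv₀ hq).2 h.le
    rw [centredCoin, min_eq_left h.le, if_neg h.ne]
    cases t
    · simpa using h1
    · simp only [if_true]
      rw [abs_le]
      constructor <;> linarith

lemma centredCoin_variance_le {q : ℝ} (hq : 0 < q) :
    min q 1 * centredCoin (min q 1) true ^ 2 + (1 - min q 1) * centredCoin (min q 1) false ^ 2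
      ≤ q⁻¹ := by
  have hq' := inv_pos.2 hq
  rcases le_or_gt 1 q with h | h
  · simp [centredCoin, min_eq_right h, hq'.le]
  · rw [min_eq_left h.le]
    simp only [centredCoin, h.ne, if_false, if_true, Bool.false_eq_true]
    have : q * (q⁻¹ - 1) ^ 2 + (1 - q) * (-1) ^ 2 = q⁻¹ - 1 := by
      field_simp; ring
    linarith

/-- The contribution of one index to the projected sampling error. -/
noncomputable def errorTerm (M : Matrix (Fin m) (Fin n) ℝ) (z : Fin n → ℝ) (i : Fin m) :
    EuclideanSpace ℝ (Fin m) :=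
  WithLp.toLp 2 fun j => colProj M j i * (M *ᵥ z) i

lemma norm_errorTerm_sq {M : Matrix (Fin m) (Fin n) ℝ} (hM : Function.Injective M.mulVec)
    (z : Fin n → ℝ) (i : Fin m) :
    ‖errorTerm M z i‖ ^ 2 = leverage M i * (M *ᵥ z) i ^ 2 := by
  rw [EuclideanSpace.norm_sq_eq, leverage_eq_colProj,
    ← sum_sq_eq_diag (colProj_transpose M) (colProj_mul_self hM), Finset.sum_mul]
  refine Finset.sum_congr rfl fun j _ => ?_
  have : colProj M j i = colProj M i j := congrFun (congrFun (colProj_transpose M) i) j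
  simp only [errorTerm]
  rw [Real.norm_eq_abs, sq_abs, mul_pow, this]

lemma norm_sum_errorTerm_sq (M : Matrix (Fin m) (Fin n) ℝ) (z : Fin n → ℝ) (a : Fin m → ℝ) :
    ‖∑ i, a i • errorTerm M z i‖ ^ 2
      = ∑ j, (colProj M *ᵥ fun i => a i * (M *ᵥ z) i) j ^ 2 := by
  rw [EuclideanSpace.norm_sq_eq]
  refine Finset.sum_congr rfl fun j _ => ?_
  rw [Real.norm_eq_abs, sq_abs]
  congr 1
  simp only [errorTerm, WithLp.ofLp_sum, WithLp.ofLp_smul, Finset.sum_apply, Pi.smul_apply,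
    smul_eq_mul, mulVec, dotProduct]
  exact Finset.sum_congr rfl fun i _ => by ring

/-- The place where the term with `C` in the sampling weights is used quantitatively; C ≥ 1 is
enough. -/
lemma leverage_le_q (h : LSInput A b c x s μ C ch) (hC : 1 ≤ C) (i : Fin m) :
    (ch.q i)⁻¹ * leverage (ch.Abar A) i
      ≤ lsGamma m n ^ 2 / Real.log (m / (lsEps m n * lsR m n)) := by
  have h1 := h.adm.q_ge i
  have hL := h.log_pos
  have hl := h.leverage_Abar_nonneg i
  have hq := h.adm.q_pos i
  have hγ := h.gamma_pos
  have hD : 0 ≤ ∑ j, ch.deltaR A b x μ j ^ 2 := by positivity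
  have h2 : 0 ≤ m / √n * (ch.deltaR A b x μ i ^ 2 / (∑ j, ch.deltaR A b x μ j ^ 2) + 1 / m) := by
    positivity
  have h3 := mul_le_mul_of_nonneg_right hC (mul_nonneg hl hL.le)
  have h4 : leverage (ch.Abar A) i * Real.log (m / (lsEps m n * lsR m n)) / lsGamma m n ^ 2
      ≤ ch.q i := by
    refine le_trans (div_le_div_of_nonneg_right ?_ (by positivity)) (by linarith : C *
      leverage (ch.Abar A) i * Real.log (m / (lsEps m n * lsR m n)) / lsGamma m n ^ 2 ≤ ch.q i)
    linarith
  rw [div_le_iff₀ (by positivity)] at h4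
  rw [inv_mul_le_iff₀ hq, ← mul_div_assoc, le_div_iff₀ hL]
  exact h4

/-- With high probability, the projected sampling error is small. -/
lemma cubeExp_error_tail_le (h : LSInput A b c x s μ C ch) (hC : 1 ≤ C) :
    cubeExp ch.prob (fun e => if lsEps m n * lsGamma m n / 4 < ‖∑ i,
      centredCoin (ch.prob i) (e i) • errorTerm (ch.Abar A) (ch.stepDir A b x μ) i‖
      then 1 else 0) ≤ lsR m n := by
  have hL := h.log_pos
  have hε := h.eps_pos
  have hε' := h.eps_le
  have hγ := h.gamma_pos
  have hγ' := h.gamma_le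
  have hr := lsR_pos h.n_pos h.le
  have hm := one_le_cast h.n_pos h.le
  have hinj := h.Abar_injective
  have hB := h.sqrt_sum_Abar_stepDir_le
  set L := Real.log (m / (lsEps m n * lsR m n)) with hLd
  set z := ch.stepDir A b x μ
  set t := lsEps m n * lsGamma m n / 4 with ht
  have pt : 0 < t := by positivity
  have hq := fun i => h.leverage_le_q hC i
  rw [Real.sqrt_le_left (by positivity)] at hB
  have hu : ∀ i, ‖errorTerm (ch.Abar A) z i‖ ≤ leverage (ch.Abar A) i * (lsGamma m n / 25) :=
    fun i => by
    have hl := h.leverage_Abar_nonneg i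
    refine abs_le_of_sq_le_sq' ?_ (by positivity) |>.2
    rw [norm_errorTerm_sq hinj, mul_pow, sq (leverage _ _), mul_assoc]
    refine mul_le_mul_of_nonneg_left ((mulVec_apply_sq_le hinj z i).trans ?_) hl
    exact mul_le_mul_of_nonneg_left hB hl
  -- The exponent 2L/t is chosen so that the linear term of the tail bound is -2L, while the
  -- variance term is at most L. Each summand stays in the admissible range because its size carries
  -- the factor γ³/L.
  have hbd : ∀ i β, 2 * L / t * (|centredCoin (ch.prob i) β| * ‖errorTerm (ch.Abar A) z i‖) ≤ 1 :=
    fun i β => by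
    have hl := h.leverage_Abar_nonneg i
    have b1 := mul_le_mul (abs_centredCoin_le (h.adm.q_pos i) β) (hu i) (norm_nonneg _)
      (inv_pos.2 (h.adm.q_pos i)).le
    have b2 := mul_le_mul_of_nonneg_right (hq i) (by positivity : 0 ≤ lsGamma m n / 25)
    have b3 : |centredCoin (ch.prob i) β| * ‖errorTerm (ch.Abar A) z i‖
        ≤ lsGamma m n ^ 2 / L * (lsGamma m n / 25) := by
      refine b1.trans (le_trans (le_of_eq ?_) b2); ring
    refine (mul_le_mul_of_nonneg_left b3 (by positivity)).trans ?_
    have b4 : 2 * L / t * (lsGamma m n ^ 2 / L * (lsGamma m n / 25))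
        = 8 * lsGamma m n ^ 2 / (25 * lsEps m n) := by
      rw [ht]; field_simp; ring
    rw [b4, div_le_one (by positivity)]
    nlinarith
  have hvar : ∑ i, (ch.prob i * centredCoin (ch.prob i) true ^ 2
      + (1 - ch.prob i) * centredCoin (ch.prob i) false ^ 2) * ‖errorTerm (ch.Abar A) z i‖ ^ 2
      ≤ lsGamma m n ^ 2 / L * (lsGamma m n / 25) ^ 2 := by
    refine le_trans ?_ (mul_le_mul_of_nonneg_left hB (by positivity))
    rw [Finset.mul_sum]
    refine Finset.sum_le_sum fun i _ => ?_
    refine (mul_le_mul_of_nonneg_right (centredCoin_variance_le (h.adm.q_pos i))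
      (sq_nonneg _)).trans ?_
    rw [norm_errorTerm_sq hinj, ← mul_assoc]
    exact mul_le_mul_of_nonneg_right (hq i) (sq_nonneg _)
  have htail := cubeExp_norm_tail_le ch.prob (fun i => (h.prob_pos i).le)
    (fun i => prob_le_one i) (fun i => centredCoin (ch.prob i)) (errorTerm (ch.Abar A) z)
    (t := t) (by positivity : 0 ≤ 2 * L / t) (fun i => centredCoin_mean (h.prob_pos i)) hbd hvar
  refine htail.trans ?_
  have c1 : 2 * L / t * t = 2 * L := by field_simp
  have c2 : (2 * L / t) ^ 2 * (lsGamma m n ^ 2 / L * (lsGamma m n / 25) ^ 2)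
      = L * (64 * lsGamma m n ^ 2 / (625 * lsEps m n ^ 2)) := by
    rw [ht]; field_simp; ring
  have c3 : 64 * lsGamma m n ^ 2 / (625 * lsEps m n ^ 2) ≤ 1 := by
    rw [div_le_one (by positivity)]
    nlinarith
  have c4 := mul_le_mul_of_nonneg_left c3 hL.le
  have c5 : Real.exp (-(2 * L / t * t)
      + (2 * L / t) ^ 2 * (lsGamma m n ^ 2 / L * (lsGamma m n / 25) ^ 2)) ≤ Real.exp (-L) := by
    rw [c1, c2]
    exact Real.exp_le_exp.2 (by linarith)
  have c6 : Real.exp (-L) = lsEps m n * lsR m n / m := by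
    rw [Real.exp_neg, hLd, Real.exp_log (by positivity), inv_div]
  rw [c6, le_div_iff₀ (by linarith)] at c5
  have c7 := Real.exp_pos (-(2 * L / t * t)
    + (2 * L / t) ^ 2 * (lsGamma m n ^ 2 / L * (lsGamma m n / 25) ^ 2))
  -- The failure probability is at most 2 exp(-L) = 2εr/m. Here m ≥ 1 removes the denominator and
  -- the small ε absorbs the factor 2.
  have c8 := le_mul_of_one_le_right c7.le hm
  nlinarith

/-- The output is nearly primal feasible with high probability. -/
lemma cubeExp_infeasible_le (h : LSInput A b c x s μ C ch) (hC : 1 ≤ C) {μnew : ℝ}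
    (hμ : |μnew - μ| ≤ lsR m n * μ) (S : (Fin m → Bool) → Prop) [DecidablePred S]
    (hS : ∀ e, infeasibility A b (ch.output A b x s μ (samplePoint ch.prob e)).1
      (ch.output A b x s μ (samplePoint ch.prob e)).2
      ≤ lsEps m n / 2 * lsGamma m n * √μnew → S e) :
    cubeExp ch.prob (fun e => if S e then 0 else 1) ≤ lsR m n := by
  refine le_trans (cubeExp_mono_of_weight (fun i => (h.prob_pos i).le) (fun i => prob_le_one i)
    fun e he => ?_) (h.cubeExp_error_tail_le hC)
  by_cases hS' : S e
  · rw [if_pos hS']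
    split_ifs <;> norm_num
  rw [if_neg hS', if_pos]
  by_contra! hle
  refine hS' (hS e (h.infeasibility_le (by linarith) e hμ ?_))
  have h1 := pow_le_pow_left₀ (norm_nonneg _) hle 2
  rw [norm_sum_errorTerm_sq] at h1
  -- The sampling error has coefficients R_i - 1. They agree with the centred coins, where for
  -- indices that are always sampled `he` excludes the outcomes of weight zero.
  have hk : ch.sampleError A b x μ (samplePoint ch.prob e)
      = fun i => centredCoin (ch.prob i) (e i) * (ch.Abar A *ᵥ ch.stepDir A b x μ) i := by
    funext i
    rw [LSChoice.sampleError, samplePoint, centredCoin]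
    by_cases hp : ch.prob i = 1
    · rw [if_pos (he i hp), if_pos hp, hp]; norm_num
    · rw [if_neg hp]
      split_ifs <;> ring
  rw [hk]
  exact h1

end LSInput

end Feasibility

/-! ### The guarantee of the short step -/

section Guarantee

variable {m n : ℕ}

lemma LSChoice.measurable_output (ch : LSChoice m n) (A : Matrix (Fin m) (Fin n) ℝ)
    (b : Fin n → ℝ) (x s : Fin m → ℝ) (μ : ℝ) : Measurable (ch.output A b x s μ) := by
  have : Continuous (ch.output A b x s μ) := by
    unfold LSChoice.output
    fun_prop
  exact this.measurable

namespace LSInput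

variable {A : Matrix (Fin m) (Fin n) ℝ} {b : Fin n → ℝ} {c x s : Fin m → ℝ} {μ C : ℝ}
  {ch : LSChoice m n}

/-- Holds for every outcome: the s-step contains no randomness, and it moves s within the range of
A. -/
lemma output_dual_feasible (h : LSInput A b c x s μ C ch) (R : Fin m → ℝ) :
    ∃ y : Fin n → ℝ, A *ᵥ y + (ch.output A b x s μ R).2 = c := by
  obtain ⟨y, hy⟩ := h.centered.dual_feasible
  set z := ch.H⁻¹ *ᵥ ((ch.Abar A)ᵀ *ᵥ (diagonal (ch.sqrtWbar μ) *ᵥ ch.g)) with hz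
  refine ⟨y - (1 - 2 * lsAlpha m n) • √μ • z, ?_⟩
  have h1 : ch.sbar * ch.deltaP A μ = √μ • (A *ᵥ z) := by
    rw [← h.sbar_mul_Abar]
    congr 1
    exact funext h.deltaP_eq
  have h2 : (ch.output A b x s μ R).2
      = s + (1 - 2 * lsAlpha m n) • (ch.sbar * ch.deltaP A μ) := rfl
  rw [h2, h1, mulVec_sub, mulVec_smul, mulVec_smul, ← hy]
  abel

/-- The guarantee of a single run of the short step. -/
theorem shortStepGuarantee (h : LSInput A b c x s μ C ch) (hC : 1 ≤ C) {μnew : ℝ}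
    (hμ : |μnew - μ| ≤ lsR m n * μ) :
    ShortStepGuarantee A b c (lsEps m n) (lsR m n) (lsLam m n) (lsGamma m n) (lsWeight A) x s μ
      μnew ((Measure.pi fun i => entryLaw (ch.q i)).map (ch.output A b x s μ)) := by
  classical
  have hC0 : 0 ≤ C := by linarith
  have h0 : ∀ i, 0 ≤ ch.prob i := fun i => (h.prob_pos i).le
  have h1 : ∀ i, ch.prob i ≤ 1 := fun i => prob_le_one i
  have hlaw : (Measure.pi fun i => entryLaw (ch.q i)).map (ch.output A b x s μ)
      = cubeLaw ch.prob (fun e => ch.output A b x s μ (samplePoint ch.prob e)) := by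
    rw [pi_entryLaw h.adm.q_pos, map_cubeLaw _ _ (ch.measurable_output A b x s μ)]
    rfl
  rw [hlaw]
  obtain ⟨hint, heq⟩ := integral_cubeLaw h0 h1
    (fun e => ch.output A b x s μ (samplePoint ch.prob e))
    (fun p => centralityPotential (lsLam m n) (lsWeight A) p.1 p.2 μnew)
  refine
    { isProbability := isProbabilityMeasure_cubeLaw h0 h1 _
      positive := ae_cubeLaw fun e => h.output_pos hC0 e
      dual_feasible := ae_cubeLaw fun e => h.output_dual_feasible _
      integrable := hint
      potential := ?_
      primal_feasible := ?_ }
  · rw [heq]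
    have := h.cubeExp_potential_le hC0 hμ
    have := two_mul_le_exp h.n_pos h.le
    linarith
  · rw [real_cubeLaw h0 h1]
    have := h.cubeExp_infeasible_le hC hμ (fun e =>
      infeasibility A b (ch.output A b x s μ (samplePoint ch.prob e)).1
        (ch.output A b x s μ (samplePoint ch.prob e)).2
      ≤ lsEps m n / 2 * lsGamma m n * √μnew) fun e he => he
    linarith

end LSInput

end Guarantee

end LSIPM

theorem mainTheorem6 :
    ∃ C₀ : ℝ, 0 < C₀ ∧ ∀ C : ℝ, C₀ ≤ C →
      ∀ (m n : ℕ), 0 < n →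
      ∀ (A : Matrix (Fin m) (Fin n) ℝ), NonDegenerate A →
      ∀ (b : Fin n → ℝ) (c : Fin m → ℝ) (step : RandomizedStep m),
        ImplementsLSShortStep C A b c step →
        IsShortStepProcedure A b c (lsEps m n) (lsR m n) (lsLam m n) (lsGamma m n)
          (lsWeight A) step := by
  -- The constant 1 suffices, since the leverage term in the weights is needed only for the tail
  -- bound, which has ample room.
  refine ⟨1, one_pos, fun C hC m n hn A hA b c step hstep => ?_⟩
  have hnm := hA.le
  have hε := lsEps_pos hn hnm
  have hε' := lsEps_le hn hnm
  have hγ' := lsGamma_le hn hnm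
  refine
    { eps_mem := ⟨hε, by linarith⟩
      r_mem := ⟨lsR_pos hn hnm, lsR_lt hn hnm⟩
      lam_ge := lsLam_ge_log hn hnm
      weight_pos := fun x s hx hs => (projWeights_lsWeight hn hA hx hs).pos
      gamma_mem := ⟨(lsGamma_pos hn hnm).le, by linarith⟩
      guarantee := fun x s μ μnew hμnew hcent hμ => ?_ }
  obtain ⟨ch, hadm, hlaw⟩ := hstep x s μ μnew hμnew hcent hμ
  rw [hlaw]
  exact LSInput.shortStepGuarantee ⟨hn, hA, hcent, hadm⟩ hC hμ
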